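/- Consider the metric uncapacitated facility location problem (UFL): finite sets $F\neq\emptyset$ of facilities and $C$ of clients in a (pseudo)metric space, opening costs $f_i\ge 0$, distances $d_{ij}$; the cost of opening $S\subseteq F$ is $\sum_{i\in S}f_i+\sum_{j\in C}\min_{i\in S}d_{ij}$. Its LP relaxation is: minimize $\sum_{i,j}d_{ij}x_{ij}+\sum_i f_iy_i$ subject to $\sum_i x_{ij}=1$ and $0\le x_{ij}\le y_i$. Let $(x^*,y^*)$ be an optimal solution and $Z^*$ its value; $Z^*$ is at most the cost of every nonempty $S\subseteq F$. Algorithms. The JMS algorithm (Jain, Mahdian, Saberi) raises the budgets of all unconnected clients uniformly from $0$. An unconnected client $j$ with budget $t$ offers $\max(t-d_{ij},0)$ to each unopened facility $i$, and a client connected to $i'$ offers $\max(d_{i'j}-d_{ij},0)$. When the offers to an unopened facility sum to its opening cost, it is opened and all clients with a positive offer to it are connected to it; when the budget of an unconnected client equals its distance to an open facility, it is connected to that facility; the algorithm stops when all clients are connected. The Chudak–Shmoys algorithm with parameter $\gamma\ge 1$ scales $y^*$ up by $\gamma$ and splits the facilities into copies $a$ of openings $w_a\in(0,1]$ such that each client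 uses each copy (of the scaled solution $\gamma x^*,\gamma y^*$) completely or not at all and has a set of closest copies among those it uses (its close copies) of total opening exactly $1$. It then repeatedly selects, as a cluster center, an unclustered client that minimizes the average plus the maximal distance to its close copies, and clusters with it all unclustered clients that share a close copy with it. Finally, independently, exactly one close copy of each center is opened, copy $a$ with probability $w_a$, and each copy $a$ that is close to no center is opened with probability $w_a$; every client is connected to a closest open facility. On every instance these algorithms can be executed (and an optimal fractional solution exists). The factor-revealing LP. For $n\ge 1$ let $\gamma_l=1+2\,\frac{n-l}{n}$ ($1\le l\le n$), $p_1^k=1-e^{-\gamma_k/\gamma_1}$, and $p_l^k=e^{-\gamma_k/\gamma_{l-1}}-e^{-\gamma_k/\gamma_l}$ for $l>1$. Let $T_n$ denote the optimum of the LP in the variables $T,f,c,c_1,\dots,c_n$: $$\begin{aligned}\max\ T\quad\text{s.t.}\quad &\gamma_kf+\sum_{l=1}^n c_l\,p_l^k+e^{-\gamma_k}\bigl(\gamma_kc+(3-\gamma_k)c_{k+1}\bigr)\ge T &&(1\le k<n),\\ &1.11f+1.78c\ge T,\\ &\tfrac1{\gamma_1}c_1+\sum_{i=2}^n\Bigl(\tfrac1{\gamma_i}-\tfrac1{\gamma_{i-1}}\Bigr)c_i=c,\\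 &0\le c_i\le c_{i+1}\quad(1\le i<n),\qquad f+c=1,\qquad f,c\ge0,\end{aligned}$$ and let $T_n'$ denote its optimum under the additional constraints $c_2,\dots,c_n\le 1$. Then for all $n\ge1$: (1) The LP (with or without the additional constraints) attains its optimum, and the dual of the LP without them attains its optimum, which equals $T_n$. (2) Run the JMS algorithm once and, independently for each $l=1,\dots,n$, the Chudak–Shmoys algorithm with $\gamma=\gamma_l$ once, on any instance with any optimal $(x^*,y^*)$ and with any choices in the deterministic steps. The expected cost of the best of the $n+1$ solutions is at most $T_n\cdot Z^*$. For $p\in(0,1]$ let $h_j(p)$ be the least $\rho$ with $\sum_{i:d_{ij}\le\rho}x^*_{ij}\ge p$, and let $h=\sum_j h_j$. If the average of $h$ over $(1/\gamma_{i},1/\gamma_{i+1}]$ is at most $Z^*$ for all $1\le i<n$, then this expected cost is also at most $T_n'\cdot Z^*$. (3) In every feasible solution of the dual, the variables $q_k$ ($1\le k<n$) and $q_{\mathrm{JMS}}$ of the first two groups of constraints form a probability distribution. If $v$ is the value of that dual solution, then the randomized algorithm that runs Chudak–Shmoys with $\gamma=\gamma_k$ with probability $q_k$ and JMS with probability $q_{\mathrm{JMS}}$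 has expected cost at most $v\cdot Z^*$, and at least the expected cost of the best solution in (2). In particular, for an optimal dual solution it is at most $T_n\cdot Z^*$. (4) There is an $N$ such that $T_n\le 1.488$ for all $n\ge N$. -/

import Mathlib

noncomputable section

namespace FacilityLocation

/-! ### Uncapacitated facility location and its LP relaxation -/

/-- A metric instance of uncapacitated facility location (UFL): facilities `F` and clients `C` are
placed in a (pseudo)metric space `X`, and facility `i` has opening cost `openCost i ≥ 0`. -/
structure Instance (F C X : Type*) [PseudoMetricSpace X] where
  facility : F → X
  client : C → X
  openCost : F → ℝ
  openCost_nonneg : ∀ i, 0 ≤ openCost i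

variable {F C X : Type*} [PseudoMetricSpace X]

/-- The cost of connecting client `j` to facility `i`. -/
def Instance.d (I : Instance F C X) (i : F) (j : C) : ℝ :=
  dist (I.facility i) (I.client j)

/-- The cost of the solution that opens the facilities in `S` and connects every client to a
closest open facility. -/
def Instance.cost [Fintype C] (I : Instance F C X) (S : Finset F) : ℝ :=
  ∑ i ∈ S, I.openCost i + ∑ j, Metric.infDist (I.client j) (I.facility '' (S : Set F))

/-- Feasibility in the standard LP relaxation of UFL. -/
structure IsFractional [Fintype F] (x : F → C → ℝ) (y : F → ℝ) : Prop where
  sum_eq_one : ∀ j, ∑ i, x i j = 1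
  le_open : ∀ i j, x i j ≤ y i
  x_nonneg : ∀ i j, 0 ≤ x i j
  y_nonneg : ∀ i, 0 ≤ y i

/-- The objective value of the LP relaxation: connection cost plus facility opening cost. -/
def Instance.fracCost [Fintype F] [Fintype C] (I : Instance F C X)
    (x : F → C → ℝ) (y : F → ℝ) : ℝ :=
  ∑ i, ∑ j, I.d i j * x i j + ∑ i, y i * I.openCost i

/-- `(x, y)` is an optimal fractional solution. -/
def Instance.IsOptimalFractional [Fintype F] [Fintype C] (I : Instance F C X)
    (x : F → C → ℝ) (y : F → ℝ) : Prop :=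
  IsFractional x y ∧
    ∀ (x' : F → C → ℝ) (y' : F → ℝ), IsFractional x' y' → I.fracCost x y ≤ I.fracCost x' y'

/-! ### The algorithm of Jain, Mahdian and Saberi -/

/-- A state of the JMS algorithm: the current time (which is the budget of every client that is
not yet connected), the opened facilities, and the current connection of the clients. -/
structure JMSState (F C : Type*) where
  time : ℝ
  opened : Finset F
  assign : C → Option F

/-- The initial state: time `0`, nothing opened, nobody connected. -/
def jmsInit (F C : Type*) : JMSState F C where
  time := 0
  opened := ∅
  assign := fun _ => none

/-- The offer of client `j` to the unopened facility `i` at time `t`: `max (t - d i j) 0` if `j` is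
unconnected, and the saving `max (d i' j - d i j) 0` if `j` is connected to `i'`. -/
def Instance.offer (I : Instance F C X) (s : JMSState F C) (t : ℝ) (i : F) (j : C) : ℝ :=
  match s.assign j with
  | none => max (t - I.d i j) 0
  | some i' => max (I.d i' j - I.d i j) 0

/-- At time `t` the unopened facility `i` is completely paid for by the offers it receives. -/
def Instance.OpenEvent [Fintype C] (I : Instance F C X) (s : JMSState F C) (t : ℝ) (i : F) : Prop :=
  i ∉ s.opened ∧ ∑ j, I.offer s t i j = I.openCost i

/-- At time `t` the budget of the unconnected client `j` reaches its distance to the open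
facility `i`. -/
def Instance.ConnectEvent (I : Instance F C X) (s : JMSState F C) (t : ℝ) (i : F) (j : C) : Prop :=
  i ∈ s.opened ∧ s.assign j = none ∧ t = I.d i j

/-- `t` is the first time, from the time of `s` on, at which some event occurs. -/
def Instance.IsNextTime [Fintype C] (I : Instance F C X) (s : JMSState F C) (t : ℝ) : Prop :=
  IsLeast {t' | s.time ≤ t' ∧
    ((∃ i, I.OpenEvent s t' i) ∨ ∃ i j, I.ConnectEvent s t' i j)} t

/-- One iteration of the JMS algorithm, performed while some client is unconnected. Simultaneous
events may be processed in any order. -/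
inductive Instance.JMSStep [Fintype C] [DecidableEq F] [DecidableEq C] (I : Instance F C X) :
    JMSState F C → JMSState F C → Prop
  | openFacility (s : JMSState F C) (t : ℝ) (i : F)
      (unfinished : ∃ j, s.assign j = none) (next : I.IsNextTime s t) (ev : I.OpenEvent s t i) :
      I.JMSStep s
        { time := t
          opened := insert i s.opened
          assign := fun j => open scoped Classical in
            if 0 < I.offer s t i j then some i else s.assign j }
  | connectClient (s : JMSState F C) (t : ℝ) (i : F) (j : C)
      (next : I.IsNextTime s t) (ev : I.ConnectEvent s t i j) :
      I.JMSStep s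
        { time := t
          opened := s.opened
          assign := Function.update s.assign j (some i) }

/-- `s` is a possible final state of the JMS algorithm. -/
def Instance.JMSOutput [Fintype C] [DecidableEq F] [DecidableEq C] (I : Instance F C X)
    (s : JMSState F C) : Prop :=
  Relation.ReflTransGen I.JMSStep (jmsInit F C) s ∧ ∀ j, s.assign j ≠ none

/-- Cost of a state: opening costs plus the distances of the current connections. -/
def Instance.jmsCost [Fintype C] (I : Instance F C X) (s : JMSState F C) : ℝ :=
  ∑ i ∈ s.opened, I.openCost i +
    ∑ j, match s.assign j with
      | none => 0
      | some i => I.d i j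

/-! ### The algorithm of Chudak and Shmoys with scaling parameter `γ` -/

/-- Scaling and splitting of a fractional solution `(x, y)`. The openings `y` are scaled up by `γ`,
and every facility is split into copies (`orig a` is the facility of which `a` is a copy) of
openings `w a ∈ (0, 1]`, so that every client `j` uses each copy completely or not at all: the
copies in `nbhd j` are those that serve `j`. The close copies `close j` are closest copies in
`nbhd j` of total opening `1`; the remaining elements of `nbhd j` are the distant ones. -/
structure Splitting [Fintype F] [DecidableEq F] (I : Instance F C X)
    (x : F → C → ℝ) (y : F → ℝ) (γ : ℝ) where
  m : ℕ
  orig : Fin m → F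
  w : Fin m → ℝ
  w_pos : ∀ a, 0 < w a
  w_le_one : ∀ a, w a ≤ 1
  sum_orig : ∀ i, ∑ a with orig a = i, w a = γ * y i
  nbhd : C → Finset (Fin m)
  sum_nbhd : ∀ i j, ∑ a ∈ nbhd j with orig a = i, w a = γ * x i j
  close : C → Finset (Fin m)
  close_subset : ∀ j, close j ⊆ nbhd j
  sum_close : ∀ j, ∑ a ∈ close j, w a = 1
  close_le : ∀ j, ∀ a ∈ close j, ∀ b ∈ nbhd j, b ∉ close j → I.d (orig a) j ≤ I.d (orig b) j

/-- Average distance plus maximal distance from client `j` to its close facilities. -/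
def Splitting.key [Fintype F] [DecidableEq F] {I : Instance F C X}
    {x : F → C → ℝ} {y : F → ℝ} {γ : ℝ} (P : Splitting I x y γ) (j : C) : ℝ :=
  ∑ a ∈ P.close j, P.w a * I.d (P.orig a) j + ⨆ a : P.close j, I.d (P.orig a) j

/-- Greedy clustering of the clients in `U`: while there is an unclustered client, choose one that
minimizes `key`, make it a cluster center, and put all unclustered clients that share a close
facility with it into its cluster. The list holds the centers in the order of their choice. -/
inductive Splitting.Clustering [Fintype F] [DecidableEq F] [DecidableEq C] {I : Instance F C X}
    {x : F → C → ℝ} {y : F → ℝ} {γ : ℝ} (P : Splitting I x y γ) : Finset C → List C → Prop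
  | done : P.Clustering ∅ []
  | step (U : Finset C) (j : C) (rest : List C) (mem : j ∈ U)
      (least : ∀ j' ∈ U, P.key j ≤ P.key j')
      (tail : P.Clustering {j' ∈ U | Disjoint (P.close j) (P.close j')} rest) :
      P.Clustering U (j :: rest)

/-- The deterministic part of a run of the algorithm: a splitting of the scaled solution and a
greedy clustering of all clients. -/
structure CSRun [Fintype F] [DecidableEq F] [Fintype C] [DecidableEq C] (I : Instance F C X)
    (x : F → C → ℝ) (y : F → ℝ) (γ : ℝ) extends Splitting I x y γ where
  centers : List C
  clustering : toSplitting.Clustering Finset.univ centers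

section Rounding

variable [Fintype F] [DecidableEq F] [Fintype C] [DecidableEq C] {I : Instance F C X}
  {x : F → C → ℝ} {y : F → ℝ} {γ : ℝ}

/-- The random choices of the rounding step: one close copy for every client (only the
choices of the cluster centers are used), and one coin for every copy (only the coins of copies that
are close to no center are used). -/
abbrev CSRun.Sample (R : CSRun I x y γ) : Type _ := (C → Fin R.m) × (Fin R.m → Bool)

/-- The probability of `ω`: all choices are independent, client `j` chooses its close copy `a` with
probability `w a`, and the coin of copy `a` shows `true` with probability `w a`. -/
def CSRun.prob (R : CSRun I x y γ) (ω : R.Sample) : ℝ :=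
  (∏ j, if ω.1 j ∈ R.close j then R.w (ω.1 j) else 0) *
    ∏ a, if ω.2 a then R.w a else 1 - R.w a

/-- The opened copies: the choice of each center, and the copies that are close to no
center and whose coin shows `true`. -/
def CSRun.openedCopies (R : CSRun I x y γ) (ω : R.Sample) : Finset (Fin R.m) :=
  R.centers.toFinset.image ω.1 ∪
    Finset.univ.filter fun a => ω.2 a = true ∧ ∀ j ∈ R.centers, a ∉ R.close j

/-- A facility is opened if one of its copies is. -/
def CSRun.opened (R : CSRun I x y γ) (ω : R.Sample) : Finset F :=
  (R.openedCopies ω).image R.orig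

/-- The expected cost of the solution returned by the algorithm. -/
def CSRun.expectedCost (R : CSRun I x y γ) : ℝ :=
  ∑ ω, R.prob ω * I.cost (R.opened ω)

/-- The weights `prob` form a probability distribution. -/
theorem CSRun.prob_nonneg (R : CSRun I x y γ) (ω : R.Sample) : 0 ≤ R.prob ω := by
  refine mul_nonneg (Finset.prod_nonneg fun j _ => ?_) (Finset.prod_nonneg fun a _ => ?_)
  · split_ifs
    · exact (R.w_pos _).le
    · exact le_rfl
  · split_ifs
    · exact (R.w_pos _).le
    · linarith [R.w_le_one a]

theorem CSRun.sum_prob (R : CSRun I x y γ) : ∑ ω, R.prob ω = 1 := by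
  have h1 : ∑ u : C → Fin R.m, ∏ j, (if u j ∈ R.close j then R.w (u j) else 0) = 1 := by
    rw [← Fintype.prod_sum (fun j a => if a ∈ R.close j then R.w a else 0)]
    refine Finset.prod_eq_one fun j _ => ?_
    rw [Finset.sum_ite_mem, Finset.univ_inter, R.sum_close]
  have h2 : ∑ v : Fin R.m → Bool, ∏ a, (if v a = true then R.w a else 1 - R.w a) = 1 := by
    rw [← Fintype.prod_sum (fun a (b : Bool) => if b = true then R.w a else 1 - R.w a)]
    refine Finset.prod_eq_one fun j _ => ?_
    simp
  calc ∑ ω, R.prob ω = ∑ u : C → Fin R.m, ∑ v : Fin R.m → Bool, R.prob (u, v) :=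
        Fintype.sum_prod_type _
    _ = (∑ u : C → Fin R.m, ∏ j, (if u j ∈ R.close j then R.w (u j) else 0)) *
          ∑ v : Fin R.m → Bool, ∏ a, (if v a = true then R.w a else 1 - R.w a) := by
        simp only [CSRun.prob, Finset.sum_mul, Finset.mul_sum]
        try exact Finset.sum_comm
    _ = 1 := by rw [h1, h2, one_mul]

end Rounding

/-! ### The factor revealing LP -/

/-- The scaling parameters `γ_l = 1 + 2 (n - l) / n`. -/
def gam (n l : ℕ) : ℝ := 1 + 2 * (((n : ℝ) - l) / n)

/-- `1 / γ_l`, with the convention `1 / γ_0 = 0`. -/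
def lev (n l : ℕ) : ℝ := if l = 0 then 0 else 1 / gam n l

/-- `p_l^k`, which is `1 - exp (-γ_k / γ_1)` for `l = 1` and
`exp (-γ_k / γ_{l-1}) - exp (-γ_k / γ_l)` for `l > 1`. -/
def pr (n k l : ℕ) : ℝ :=
  Real.exp (-(gam n k * lev n (l - 1))) - Real.exp (-(gam n k * lev n l))

/-- Feasibility in the factor revealing LP, whose objective is to maximize `T`. The variables are
`T, f, c` and `cl 1, …, cl n`. -/
structure LPFeasible (n : ℕ) (T f c : ℝ) (cl : ℕ → ℝ) : Prop where
  rounding : ∀ k, 1 ≤ k → k < n →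
    T ≤ gam n k * f + ∑ l ∈ Finset.Icc 1 n, cl l * pr n k l +
      Real.exp (-gam n k) * (gam n k * c + (3 - gam n k) * cl (k + 1))
  jms : T ≤ 1.11 * f + 1.78 * c
  connection : ∑ l ∈ Finset.Icc 1 n, (lev n l - lev n (l - 1)) * cl l = c
  order : ∀ i, 1 ≤ i → i < n → 0 ≤ cl i ∧ cl i ≤ cl (i + 1)
  total : f + c = 1
  f_nonneg : 0 ≤ f
  c_nonneg : 0 ≤ c

/-- The objective values of the feasible points of the factor revealing LP. -/
def lpValues (n : ℕ) : Set ℝ := {T | ∃ f c cl, LPFeasible n T f c cl}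

/-- The optimum of the factor revealing LP. -/
def lpOpt (n : ℕ) : ℝ := sSup (lpValues n)

/-- The objective values of the feasible points that satisfy also `c_2, …, c_n ≤ 1`. -/
def lpValuesCapped (n : ℕ) : Set ℝ :=
  {T | ∃ f c cl, LPFeasible n T f c cl ∧ ∀ i, 1 ≤ i → i < n → cl (i + 1) ≤ 1}

/-- The optimum of the factor revealing LP with the additional constraints `c_2, …, c_n ≤ 1`. -/
def lpOptCapped (n : ℕ) : ℝ := sSup (lpValuesCapped n)

/-- Feasibility in the dual LP, whose objective is to minimize `v`. The variable `q k ≥ 0` belongs to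
the rounding constraint of `k`, `qJ ≥ 0` to the JMS constraint, `u` to the connection
cost equation, `r i ≥ 0` to `cl i ≤ cl (i + 1)` (with `r 0 = r n = 0` as there are no such
constraints for `i = 0, n`), and `v` to `f + c = 1`. The constraints `col_T`, `col_f`, `col_c`,
`col_cl` belong to the primal variables `T` (free) and `f, c, cl i ≥ 0`. -/
structure DualFeasible (n : ℕ) (v : ℝ) (q : ℕ → ℝ) (qJ u : ℝ) (r : ℕ → ℝ) : Prop where
  q_nonneg : ∀ k, 1 ≤ k → k < n → 0 ≤ q k
  qJ_nonneg : 0 ≤ qJ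
  r_nonneg : ∀ i, 1 ≤ i → i < n → 0 ≤ r i
  r_zero : r 0 = 0
  r_last : r n = 0
  col_T : ∑ k ∈ Finset.Ico 1 n, q k + qJ = 1
  col_f : ∑ k ∈ Finset.Ico 1 n, q k * gam n k + 1.11 * qJ ≤ v
  col_c : ∑ k ∈ Finset.Ico 1 n, q k * (Real.exp (-gam n k) * gam n k) + 1.78 * qJ + u ≤ v
  col_cl : ∀ i, 1 ≤ i → i ≤ n →
    ∑ k ∈ Finset.Ico 1 n, q k * (pr n k i +
        if i = k + 1 then Real.exp (-gam n k) * (3 - gam n k) else 0) ≤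
      u * (lev n i - lev n (i - 1)) + r i - r (i - 1)

/-- The objective values of the feasible points of the dual LP. -/
def dualValues (n : ℕ) : Set ℝ := {v | ∃ q qJ u r, DualFeasible n v q qJ u r}

/-! ### Combining the algorithms -/

section Combined

variable [Fintype F] [DecidableEq F] [Fintype C] [DecidableEq C] {I : Instance F C X}
  {x : F → C → ℝ} {y : F → ℝ}

/-- The characteristic function `h_j` of client `j`: `h_j(p)` is the least radius within which `j` is
connected to the extent of at least `p`. -/
def Instance.charFun (I : Instance F C X) (x : F → C → ℝ) (j : C) (p : ℝ) : ℝ :=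
  sInf {ρ | p ≤ ∑ i with I.d i j ≤ ρ, x i j}

/-- The average of `h = ∑ j, h_j` over the interval from `1 / γ_{l-1}` to `1 / γ_l`. -/
def Instance.profile (I : Instance F C X) (x : F → C → ℝ) (n l : ℕ) : ℝ :=
  (lev n l - lev n (l - 1))⁻¹ * ∫ p in lev n (l - 1)..lev n l, ∑ j, I.charFun x j p

/-- The expected cost of the best among a solution of cost `J` and the solutions of
independent runs of the Chudak–Shmoys algorithm with the scaling parameters `γ_1, …, γ_n`
(`R l` is the run with parameter `γ_{l+1}`, `l = 0, …, n - 1`). -/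
def expectedBest {n : ℕ} (J : ℝ) (R : ∀ l : Fin n, CSRun I x y (gam n (l + 1))) : ℝ :=
  ∑ ω : (∀ l, (R l).Sample),
    (∏ l, (R l).prob (ω l)) * min J (⨅ l, I.cost ((R l).opened (ω l)))

/-- The expected cost of the random choice of one algorithm: JMS (of cost `J`) with
probability `qJ`, and the Chudak–Shmoys algorithm with parameter `γ_k` with probability `q k`, for
`k = 1, …, n - 1`. -/
def expectedMixture {n : ℕ} (J : ℝ) (R : ∀ l : Fin n, CSRun I x y (gam n (l + 1)))
    (q : ℕ → ℝ) (qJ : ℝ) : ℝ :=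
  ∑ l : Fin n, (if (l : ℕ) + 1 < n then q (l + 1) * (R l).expectedCost else 0) + qJ * J

end Combined

end FacilityLocation

end

/-!
Write `F*` and `C*` for the opening cost and the connection cost of the fractional optimum, and
`C_l` for the average `profile n l` of the characteristic function `h` over the `l`-th of the
intervals between consecutive levels `1 / γ_l`. The theorem holds because every algorithm obeys a
bound that is linear in `F*`, `C*` and the `C_l`, and because these bounds are exactly the
constraints of the factor revealing LP.

*The JMS algorithm* costs at most `1.11 F* + 1.78 C*` (`Instance.jmsCost_le`). Its cost is the sum
of the budgets, since each opening is paid for by offers. For a single facility and clients in the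
order in which they are connected, the offers never exceed the opening cost, while the triangle
inequality bounds them from below in terms of the budgets (`OfferScheme`). Grouping the clients of
such a star into ten blocks of fixed proportions and averaging over the blocks leaves a finite LP,
for which `block_factor_revealing` is a dual certificate. Summing over the stars with the weights
`x*` gives the bound against the fractional solution.

*The Chudak–Shmoys algorithm.* The expected distance of client `j` to the open facilities is the
integral over the radii `ρ` of the probability that nothing within distance `ρ` is open. The copies
serving `j` within distance `ρ` all stay closed with probability at most `exp (-γ reach ρ)`, where
`reach` is the fraction of `j` that is served within `ρ`, and if all copies that serve `j` are
closed, some close copy of the center of `j` is open. By the choice of the centers, its expected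
distance to `j` can be replaced by the average plus twice the maximal distance of `j` to its close
copies, plus the excess of its distances to the distant copies (`Splitting.sum_fallback_le`,
`CSRun.expected_dist_le`). As `h_j` is the inverse function of `reach`, the integral becomes one
over `[0, 1]`, and bounding the convex function `exp` by chords on the intervals between the levels
turns it into a combination of the `C_l` with the coefficients of the LP (`CSRun.expectedCost_le`).

*Combination.* After division by `Z*` the expected cost of the best solution is the value of a
feasible point of the LP (`lpFeasible_of_pos`); when `Z* = 0` all the bounds vanish. A dual
solution is a convex combination of the constraints, and hence of the algorithms
(`DualFeasible.sum_le`). The primal optimum is attained by compactness (`exists_isGreatest_lp`).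
For the dual, the cone of the primal solutions is spanned by one ray for `f` and by the threshold
profiles, so that dual feasibility has to be checked on `n + 1` rays only (`mem_dualValues`), and
strong duality is the minimax theorem for the game of these rays against the algorithms
(`exists_mixed_strategy`).

*Large `n`.* A dual solution of value `1.488` is obtained by discretizing a fixed distribution of
the parameter `γ`: mass `0.5033` at `1.4793`, density `0.5606` between `1.4793` and `2.0165`, and
the remaining mass for JMS (`lpOpt_le_of_large`). The constraint of the threshold profile at
`t = 1 / γ_i` compares functions of `t` that are convex up to a term which is replaced by tangents,
and therefore has to be checked at finitely many `t` only (`mix_row_le`).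
-/

namespace FacilityLocation

/-! ### The factor-revealing inequality of the JMS algorithm -/

/-- The sizes of the ten blocks into which the clients of a star are divided. -/
noncomputable def blockWidth : Fin 10 → ℝ :=
  ![2 / 100, 13 / 100, 7 / 100, 8 / 100, 19 / 100, 20 / 100, 6 / 100, 3 / 100, 12 / 100, 10 / 100]

set_option maxHeartbeats 2000000 in
/-- The factor-revealing inequality for averages over the ten blocks: `A a` is the average budget
and `D a` the average distance in block `a`, and `O a b` is the average offer of block `b` at the
time at which block `a` is connected. For `a = b` the order of two clients within the block is
unknown; `dg` and `dg'` are what both orders give on average. The proof is a dual solution of this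
finite linear program. -/
theorem block_factor_revealing (A D : Fin 10 → ℝ) (O : Fin 10 → Fin 10 → ℝ) (F : ℝ)
    (hA0 : 0 ≤ A 0) (hA : ∀ a b, a ≤ b → A a ≤ A b) (hD : ∀ a, 0 ≤ D a)
    (nn : ∀ a b, 0 ≤ O a b) (hsum : ∀ a, ∑ b, blockWidth b * O a b ≤ F)
    (up : ∀ a b, a < b → A a - D b ≤ O a b)
    (low : ∀ a b l, b < a → a ≤ l → A l - D l - 2 * D b ≤ O a b)
    (dg : ∀ a, A a - 2 * D a ≤ O a a)
    (dg' : ∀ a' a l, a' < a → a < l → (A a' + (A l - D l) / 2 - 2 * D a) / 2 ≤ O a a)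
    (hF : 0 ≤ F) :
    ∑ a, blockWidth a * A a ≤ 1.11 * F + 1.78 * ∑ a, blockWidth a * D a := by
  have up : ∀ (a b : Fin 10) (_ : a < b := by decide), A a - D b ≤ O a b := up
  have low : ∀ (a b l : Fin 10) (_ : b < a := by decide) (_ : a ≤ l := by decide),
    A l - D l - 2 * D b ≤ O a b := low
  have dg' : ∀ (a' a l : Fin 10) (_ : a' < a := by decide) (_ : a < l := by decide),
    (A a' + (A l - D l) / 2 - 2 * D a) / 2 ≤ O a a := dg'
  have expand : ∀ g : Fin 10 → ℝ, ∑ b, blockWidth b * g b =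
      2 / 100 * g 0 + 13 / 100 * g 1 + 7 / 100 * g 2 + 8 / 100 * g 3 + 19 / 100 * g 4 +
        20 / 100 * g 5 + 6 / 100 * g 6 + 3 / 100 * g 7 + 12 / 100 * g 8 + 10 / 100 * g 9 := by
    intro g
    simp only [Fin.sum_univ_succ, blockWidth]
    simp
    ring
  have tot : ∀ a, 2 * O a 0 + 13 * O a 1 + 7 * O a 2 + 8 * O a 3 + 19 * O a 4 + 20 * O a 5 +
      6 * O a 6 + 3 * O a 7 + 12 * O a 8 + 10 * O a 9 ≤ 100 * F := by
    intro a
    have := hsum a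
    rw [expand] at this
    linarith
  have mono : ∀ (a b : Fin 10) (_ : a ≤ b := by decide), 0 ≤ A b - A a :=
    fun a b h => sub_nonneg.2 (hA a b h)
  -- Each cut `c1, …, c17` bounds the offers at the connection of one block from below, term by
  -- term; the offers for which no lower bound is useful are dropped.
  have c1 : 13 * (A 0 - D 1) + 7 * (A 0 - D 2) + 8 * (A 0 - D 3) + 19 * (A 0 - D 4) +
      20 * (A 0 - D 5) + 6 * (A 0 - D 6) + 3 * (A 0 - D 7) ≤ 100 * F := by
    linear_combination tot 0 + 13 * up 0 1 + 7 * up 0 2 + 8 * up 0 3 + 19 * up 0 4 + 20 * up 0 5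
      + 6 * up 0 6 + 3 * up 0 7 + 2 * nn 0 0 + 12 * nn 0 8 + 10 * nn 0 9
  have c2 : 2 * (A 8 - D 8 - 2 * D 0) + 13 / 2 * (A 0 + (A 8 - D 8) / 2 - 2 * D 1) +
      7 * (A 1 - D 2) + 8 * (A 1 - D 3) + 19 * (A 1 - D 4) + 20 * (A 1 - D 5) + 6 * (A 1 - D 6) +
      3 * (A 1 - D 7) ≤ 100 * F := by
    linear_combination tot 1 + 2 * low 1 0 8 + 13 * dg' 0 1 8 + 7 * up 1 2 + 8 * up 1 3 +
      19 * up 1 4 + 20 * up 1 5 + 6 * up 1 6 + 3 * up 1 7 + 12 * nn 1 8 + 10 * nn 1 9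
  have c3 : 2 * (A 7 - D 7 - 2 * D 0) + 13 * (A 7 - D 7 - 2 * D 1) + 7 / 2 * (A 1 +
      (A 7 - D 7) / 2 - 2 * D 2) + 8 * (A 2 - D 3) + 19 * (A 2 - D 4) + 20 * (A 2 - D 5) +
      6 * (A 2 - D 6) + 3 * (A 2 - D 7) ≤ 100 * F := by
    linear_combination tot 2 + 2 * low 2 0 7 + 13 * low 2 1 7 + 7 * dg' 1 2 7 + 8 * up 2 3 +
      19 * up 2 4 + 20 * up 2 5 + 6 * up 2 6 + 3 * up 2 7 + 12 * nn 2 8 + 10 * nn 2 9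
  have c4 : 2 * (A 9 - D 9 - 2 * D 0) + 13 * (A 9 - D 9 - 2 * D 1) + 8 / 2 * (A 2 +
      (A 9 - D 9) / 2 - 2 * D 3) + 19 * (A 3 - D 4) + 20 * (A 3 - D 5) + 6 * (A 3 - D 6) +
      3 * (A 3 - D 7) ≤ 100 * F := by
    linear_combination tot 3 + 2 * low 3 0 9 + 13 * low 3 1 9 + 8 * dg' 2 3 9 + 19 * up 3 4 +
      20 * up 3 5 + 6 * up 3 6 + 3 * up 3 7 + 7 * nn 3 2 + 12 * nn 3 8 + 10 * nn 3 9
  have c5 : 2 * (A 8 - D 8 - 2 * D 0) + 13 * (A 8 - D 8 - 2 * D 1) + 7 * (A 8 - D 8 - 2 * D 2)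
      + 8 / 2 * (A 2 + (A 8 - D 8) / 2 - 2 * D 3) + 19 * (A 3 - D 4) + 20 * (A 3 - D 5) +
      6 * (A 3 - D 6) + 3 * (A 3 - D 7) + 12 * (A 3 - D 8) + 10 * (A 3 - D 9) ≤ 100 * F := by
    linear_combination tot 3 + 2 * low 3 0 8 + 13 * low 3 1 8 + 7 * low 3 2 8 + 8 * dg' 2 3 8 +
      19 * up 3 4 + 20 * up 3 5 + 6 * up 3 6 + 3 * up 3 7 + 12 * up 3 8 + 10 * up 3 9
  have c6 : 2 * (A 9 - D 9 - 2 * D 0) + 13 * (A 9 - D 9 - 2 * D 1) + 8 * (A 3 - 2 * D 3) +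
      19 * (A 3 - D 4) + 20 * (A 3 - D 5) + 6 * (A 3 - D 6) + 3 * (A 3 - D 7) + 12 * (A 3 - D 8) +
      10 * (A 3 - D 9) ≤ 100 * F := by
    linear_combination tot 3 + 2 * low 3 0 9 + 13 * low 3 1 9 + 8 * dg 3 + 19 * up 3 4 +
      20 * up 3 5 + 6 * up 3 6 + 3 * up 3 7 + 12 * up 3 8 + 10 * up 3 9 + 7 * nn 3 2
  have c7 : 2 * (A 4 - D 4 - 2 * D 0) + 13 * (A 4 - D 4 - 2 * D 1) + 7 * (A 4 - D 4 - 2 * D 2)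
      + 8 * (A 3 - 2 * D 3) + 19 * (A 3 - D 4) + 20 * (A 3 - D 5) + 6 * (A 3 - D 6) +
      3 * (A 3 - D 7) + 12 * (A 3 - D 8) + 10 * (A 3 - D 9) ≤ 100 * F := by
    linear_combination tot 3 + 2 * low 3 0 4 + 13 * low 3 1 4 + 7 * low 3 2 4 + 8 * dg 3 +
      19 * up 3 4 + 20 * up 3 5 + 6 * up 3 6 + 3 * up 3 7 + 12 * up 3 8 + 10 * up 3 9
  have c8 : 13 * (A 5 - D 5 - 2 * D 1) + 7 * (A 5 - D 5 - 2 * D 2) + 8 * (A 5 - D 5 - 2 * D 3)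
      + 19 * (A 4 - 2 * D 4) + 20 * (A 4 - D 5) + 6 * (A 4 - D 6) + 3 * (A 4 - D 7) +
      12 * (A 4 - D 8) + 10 * (A 4 - D 9) ≤ 100 * F := by
    linear_combination tot 4 + 13 * low 4 1 5 + 7 * low 4 2 5 + 8 * low 4 3 5 + 19 * dg 4 +
      20 * up 4 5 + 6 * up 4 6 + 3 * up 4 7 + 12 * up 4 8 + 10 * up 4 9 + 2 * nn 4 0
  have c9 : 2 * (A 9 - D 9 - 2 * D 0) + 13 * (A 9 - D 9 - 2 * D 1) + 7 * (A 9 - D 9 - 2 * D 2)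
      + 8 * (A 9 - D 9 - 2 * D 3) + 19 * (A 4 - 2 * D 4) + 20 * (A 4 - D 5) + 6 * (A 4 - D 6) +
      3 * (A 4 - D 7) + 12 * (A 4 - D 8) + 10 * (A 4 - D 9) ≤ 100 * F := by
    linear_combination tot 4 + 2 * low 4 0 9 + 13 * low 4 1 9 + 7 * low 4 2 9 + 8 * low 4 3 9 +
      19 * dg 4 + 20 * up 4 5 + 6 * up 4 6 + 3 * up 4 7 + 12 * up 4 8 + 10 * up 4 9
  have c10 : 2 * (A 9 - D 9 - 2 * D 0) + 7 * (A 9 - D 9 - 2 * D 2) + 8 * (A 9 - D 9 - 2 * D 3)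
      + 19 * (A 9 - D 9 - 2 * D 4) + 20 * (A 5 - 2 * D 5) + 6 * (A 5 - D 6) + 3 * (A 5 - D 7) +
      12 * (A 5 - D 8) + 10 * (A 5 - D 9) ≤ 100 * F := by
    linear_combination tot 5 + 2 * low 5 0 9 + 7 * low 5 2 9 + 8 * low 5 3 9 + 19 * low 5 4 9 +
      20 * dg 5 + 6 * up 5 6 + 3 * up 5 7 + 12 * up 5 8 + 10 * up 5 9 + 13 * nn 5 1
  have c11 : 2 * (A 5 - D 5 - 2 * D 0) + 13 * (A 5 - D 5 - 2 * D 1) +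
      7 * (A 5 - D 5 - 2 * D 2) + 8 * (A 5 - D 5 - 2 * D 3) + 19 * (A 5 - D 5 - 2 * D 4) +
      20 * (A 5 - 2 * D 5) + 6 * (A 5 - D 6) + 3 * (A 5 - D 7) + 12 * (A 5 - D 8) +
      10 * (A 5 - D 9) ≤ 100 * F := by
    linear_combination tot 5 + 2 * low 5 0 5 + 13 * low 5 1 5 + 7 * low 5 2 5 + 8 * low 5 3 5 +
      19 * low 5 4 5 + 20 * dg 5 + 6 * up 5 6 + 3 * up 5 7 + 12 * up 5 8 + 10 * up 5 9
  have c12 : 8 * (A 8 - D 8 - 2 * D 3) + 19 * (A 8 - D 8 - 2 * D 4) + 20 * (A 5 - 2 * D 5) +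
      6 * (A 5 - D 6) + 3 * (A 5 - D 7) + 12 * (A 5 - D 8) + 10 * (A 5 - D 9) ≤ 100 * F := by
    linear_combination tot 5 + 8 * low 5 3 8 + 19 * low 5 4 8 + 20 * dg 5 + 6 * up 5 6 +
      3 * up 5 7 + 12 * up 5 8 + 10 * up 5 9 + 2 * nn 5 0 + 13 * nn 5 1 + 7 * nn 5 2
  have c13 : 2 * (A 9 - D 9 - 2 * D 0) + 13 * (A 9 - D 9 - 2 * D 1) +
      7 * (A 9 - D 9 - 2 * D 2) + 8 * (A 9 - D 9 - 2 * D 3) + 19 * (A 9 - D 9 - 2 * D 4) +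
      20 * (A 5 - 2 * D 5) + 6 * (A 5 - D 6) + 3 * (A 5 - D 7) + 12 * (A 5 - D 8) +
      10 * (A 5 - D 9) ≤ 100 * F := by
    linear_combination tot 5 + 2 * low 5 0 9 + 13 * low 5 1 9 + 7 * low 5 2 9 + 8 * low 5 3 9 +
      19 * low 5 4 9 + 20 * dg 5 + 6 * up 5 6 + 3 * up 5 7 + 12 * up 5 8 + 10 * up 5 9
  have c14 : 2 * (A 8 - D 8 - 2 * D 0) + 13 * (A 8 - D 8 - 2 * D 1) +
      7 * (A 8 - D 8 - 2 * D 2) + 8 * (A 8 - D 8 - 2 * D 3) + 19 * (A 8 - D 8 - 2 * D 4) +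
      20 * (A 5 - 2 * D 5) + 6 * (A 5 - D 6) + 3 * (A 5 - D 7) + 12 * (A 5 - D 8) +
      10 * (A 5 - D 9) ≤ 100 * F := by
    linear_combination tot 5 + 2 * low 5 0 8 + 13 * low 5 1 8 + 7 * low 5 2 8 + 8 * low 5 3 8 +
      19 * low 5 4 8 + 20 * dg 5 + 6 * up 5 6 + 3 * up 5 7 + 12 * up 5 8 + 10 * up 5 9
  have c15 : 2 * (A 6 - D 6 - 2 * D 0) + 13 * (A 6 - D 6 - 2 * D 1) +
      7 * (A 6 - D 6 - 2 * D 2) + 8 * (A 6 - D 6 - 2 * D 3) + 19 * (A 6 - D 6 - 2 * D 4) +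
      20 * (A 6 - D 6 - 2 * D 5) + 6 * (A 6 - 2 * D 6) + 3 * (A 6 - D 7) + 12 * (A 6 - D 8) +
      10 * (A 6 - D 9) ≤ 100 * F := by
    linear_combination tot 6 + 2 * low 6 0 6 + 13 * low 6 1 6 + 7 * low 6 2 6 + 8 * low 6 3 6 +
      19 * low 6 4 6 + 20 * low 6 5 6 + 6 * dg 6 + 3 * up 6 7 + 12 * up 6 8 + 10 * up 6 9
  have c16 : 2 * (A 9 - D 9 - 2 * D 0) + 7 * (A 9 - D 9 - 2 * D 2) + 8 * (A 9 - D 9 - 2 * D 3)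
      + 19 * (A 9 - D 9 - 2 * D 4) + 20 * (A 9 - D 9 - 2 * D 5) + 6 * (A 6 - 2 * D 6) +
      3 * (A 6 - D 7) + 12 * (A 6 - D 8) + 10 * (A 6 - D 9) ≤ 100 * F := by
    linear_combination tot 6 + 2 * low 6 0 9 + 7 * low 6 2 9 + 8 * low 6 3 9 + 19 * low 6 4 9 +
      20 * low 6 5 9 + 6 * dg 6 + 3 * up 6 7 + 12 * up 6 8 + 10 * up 6 9 + 13 * nn 6 1
  have c17 : 2 * (A 7 - D 7 - 2 * D 0) + 13 * (A 7 - D 7 - 2 * D 1) +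
      7 * (A 7 - D 7 - 2 * D 2) + 8 * (A 7 - D 7 - 2 * D 3) + 19 * (A 7 - D 7 - 2 * D 4) +
      20 * (A 7 - D 7 - 2 * D 5) + 3 * (A 7 - 2 * D 7) + 12 * (A 7 - D 8) + 10 * (A 7 - D 9) ≤
      100 * F := by
    linear_combination tot 7 + 2 * low 7 0 7 + 13 * low 7 1 7 + 7 * low 7 2 7 + 8 * low 7 3 7 +
      19 * low 7 4 7 + 20 * low 7 5 7 + 3 * dg 7 + 12 * up 7 8 + 10 * up 7 9 + 6 * nn 7 6
  have c18 : 2 * (A 9 - D 9 - 2 * D 0) + 7 * (A 9 - D 9 - 2 * D 2) + 8 * (A 9 - D 9 - 2 * D 3)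
      + 19 * (A 9 - D 9 - 2 * D 4) + 20 * (A 9 - D 9 - 2 * D 5) + 6 * (A 9 - D 9 - 2 * D 6) +
      3 * (A 7 - 2 * D 7) + 12 * (A 7 - D 8) + 10 * (A 7 - D 9) ≤ 100 * F := by
    linear_combination tot 7 + 2 * low 7 0 9 + 7 * low 7 2 9 + 8 * low 7 3 9 + 19 * low 7 4 9 +
      20 * low 7 5 9 + 6 * low 7 6 9 + 3 * dg 7 + 12 * up 7 8 + 10 * up 7 9 + 13 * nn 7 1
  have c19 : 2 * (A 8 - D 8 - 2 * D 0) + 13 * (A 8 - D 8 - 2 * D 1) +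
      7 * (A 8 - D 8 - 2 * D 2) + 8 * (A 8 - D 8 - 2 * D 3) + 19 * (A 8 - D 8 - 2 * D 4) +
      20 * (A 8 - D 8 - 2 * D 5) + 3 / 2 * (A 6 + (A 8 - D 8) / 2 - 2 * D 7) + 12 * (A 7 - D 8) +
      10 * (A 7 - D 9) ≤ 100 * F := by
    linear_combination tot 7 + 2 * low 7 0 8 + 13 * low 7 1 8 + 7 * low 7 2 8 + 8 * low 7 3 8 +
      19 * low 7 4 8 + 20 * low 7 5 8 + 3 * dg' 6 7 8 + 12 * up 7 8 + 10 * up 7 9 + 6 * nn 7 6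
  rw [expand, expand]
  have m0 := mono 0 1
  have m1 := mono 1 2
  have m2 := mono 2 3
  have m3 := mono 3 4
  have m4 := mono 4 5
  have m5 := mono 5 6
  have m6 := mono 6 7
  have m7 := mono 7 8
  have m8 := mono 8 9
  -- The multipliers of the cuts are a rounded dual optimum. The rounding is absorbed by the slack
  -- of the monotonicity of `A` and of the signs of `A 0`, `D` and `F`.
  linear_combination 923 / 10000000 * c1 + 19986 / 10000000 * c2 + 11683 / 10000000 * c3 +
    459 / 10000000 * c4 + 10990 / 10000000 * c5 + 16 / 10000000 * c6 + 97 / 10000000 * c7 +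
    15847 / 10000000 * c8 + 11266 / 10000000 * c9 + 5057 / 10000000 * c10 +
    2057 / 10000000 * c11 + 5251 / 10000000 * c12 + 8172 / 10000000 * c13 +
    8005 / 10000000 * c14 + 5602 / 10000000 * c15 + 1079 / 10000000 * c16 + 65 / 10000000 * c17
    + 180 / 10000000 * c18 + 4263 / 10000000 * c19 + 9/125000 * hA0 + 663/10000000 * m0 +
    1309/20000000 * m1 + 1221/20000000 * m2 + 929/20000000 * m3 + 841/20000000 * m4 +
    539/20000000 * m5 + 113/5000000 * m6 + 559/40000000 * m7 + 87/10000000 * m8 +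
    23/2500000 * hD 0 + 611/10000000 * hD 1 + 21/625000 * hD 2 + 9/250000 * hD 3 +
    217/2500000 * hD 4 + 911/10000000 * hD 5 + 69/2500000 * hD 6 + 383/40000000 * hD 7 +
    2333/40000000 * hD 8 + 443/10000000 * hD 9 + 1/50000 * hF

end FacilityLocation

namespace FacilityLocation

/-- Nested averages are monotone on the support of the weights. -/
theorem sum_mul_sum_le {k : ℕ} {p q : ℕ → ℝ} (hp : ∀ i, 0 ≤ p i) (hq : ∀ i, 0 ≤ q i)
    {g h : ℕ → ℕ → ℝ}
    (H : ∀ i ∈ Finset.range k, ∀ j ∈ Finset.range k, 0 < p i → 0 < q j → g i j ≤ h i j) :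
    ∑ i ∈ Finset.range k, p i * ∑ j ∈ Finset.range k, q j * g i j ≤
      ∑ i ∈ Finset.range k, p i * ∑ j ∈ Finset.range k, q j * h i j := by
  refine Finset.sum_le_sum fun i hi => ?_
  rcases (hp i).eq_or_lt with h0 | h0
  · simp [← h0]
  refine mul_le_mul_of_nonneg_left (Finset.sum_le_sum fun j hj => ?_) h0.le
  rcases (hq j).eq_or_lt with h1 | h1
  · simp [← h1]
  exact mul_le_mul_of_nonneg_left (H i hi j hj h0 h1) h1.le

/-- An average of quantities that are at most `c` is at most `c`. -/
theorem sum_mul_le_of_forall_le {k : ℕ} {p : ℕ → ℝ} (hp : ∀ i, 0 ≤ p i)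
    (hp1 : ∑ i ∈ Finset.range k, p i = 1) {g : ℕ → ℝ} {c : ℝ}
    (H : ∀ i ∈ Finset.range k, 0 < p i → g i ≤ c) : ∑ i ∈ Finset.range k, p i * g i ≤ c := by
  calc ∑ i ∈ Finset.range k, p i * g i ≤ ∑ i ∈ Finset.range k, p i * c := by
        refine Finset.sum_le_sum fun i hi => ?_
        rcases (hp i).eq_or_lt with h0 | h0
        · simp [← h0]
        · exact mul_le_mul_of_nonneg_left (H i hi h0) h0.le
    _ = c := by rw [← Finset.sum_mul, hp1, one_mul]

/-- The abstract outcome of a run of the JMS algorithm, as seen from one facility of opening cost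
`f`: `ω` are the weights of the clients, which are numbered in the order in which they are
connected, `α` their budgets, `d` their distances to the facility, and `o i j` is the offer of
client `j` to the facility at the time at which client `i` is connected. -/
structure OfferScheme (k : ℕ) (ω α d : ℕ → ℝ) (o : ℕ → ℕ → ℝ) (f : ℝ) : Prop where
  weight_nonneg : ∀ i, 0 ≤ ω i
  dist_nonneg : ∀ i, 0 ≤ d i
  offer_nonneg : ∀ i j, 0 ≤ o i j
  budget_nonneg : ∀ i, 0 ≤ α i
  budget_mono : ∀ i j, i ≤ j → j < k → α i ≤ α j
  offer_later : ∀ i j, i ≤ j → j < k → α i - d j ≤ o i j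
  offer_earlier : ∀ i j l, j ≤ i → i ≤ l → l < k → α l - d l - 2 * d j ≤ o i j
  offer_sum : ∀ i, i < k → ∑ j ∈ Finset.range k, ω j * o i j ≤ f
  cost_nonneg : 0 ≤ f

/-- The bound on the budgets, given a division of the clients into ten blocks: client `i` makes up
the fraction `m a i` of block `a`. Fractions are needed because the proportions of the
blocks are fixed, while the weights of the clients are arbitrary. -/
theorem OfferScheme.budget_le_of_blocks {k : ℕ} {ω α d : ℕ → ℝ} {o : ℕ → ℕ → ℝ} {f : ℝ}
    (S : OfferScheme k ω α d o f) {W : ℝ} (hW : 0 < W) (m : Fin 10 → ℕ → ℝ)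
    (m_nonneg : ∀ a i, 0 ≤ m a i) (m_sum : ∀ a, ∑ i ∈ Finset.range k, m a i = 1)
    (m_weight : ∀ i, i < k → ∑ a, blockWidth a * m a i = ω i / W)
    (m_order : ∀ a b, a < b → ∀ i j, 0 < m a i → 0 < m b j → i ≤ j) :
    ∑ i ∈ Finset.range k, ω i * α i ≤ 1.11 * f + 1.78 * ∑ i ∈ Finset.range k, ω i * d i := by
  set A : Fin 10 → ℝ := fun a => ∑ i ∈ Finset.range k, m a i * α i with hA
  set D : Fin 10 → ℝ := fun a => ∑ i ∈ Finset.range k, m a i * d i with hD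
  set O : Fin 10 → Fin 10 → ℝ := fun a b =>
    ∑ i ∈ Finset.range k, m a i * ∑ j ∈ Finset.range k, m b j * o i j with hO
  have spread : ∀ g : ℕ → ℝ, ∑ i ∈ Finset.range k, ω i * g i =
      W * ∑ a, blockWidth a * ∑ i ∈ Finset.range k, m a i * g i := by
    intro g
    simp only [Finset.mul_sum]
    rw [Finset.sum_comm]
    refine Finset.sum_congr rfl fun i hi => ?_
    have := m_weight i (Finset.mem_range.1 hi)
    rw [eq_div_iff hW.ne'] at this
    rw [← this, Finset.sum_mul, Finset.sum_mul]
    refine Finset.sum_congr rfl fun a _ => ?_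
    ring
  -- averages of separable functions
  have sep : ∀ a b (g h : ℕ → ℝ), ∑ i ∈ Finset.range k, m a i *
      ∑ j ∈ Finset.range k, m b j * (g i + h j) =
      ∑ i ∈ Finset.range k, m a i * g i + ∑ j ∈ Finset.range k, m b j * h j := by
    intro a b g h
    simp only [mul_add, Finset.sum_add_distrib, ← Finset.sum_mul, m_sum, one_mul]
  have sub : ∀ a (g h : ℕ → ℝ), ∑ i ∈ Finset.range k, m a i * (g i - h i) =
      ∑ i ∈ Finset.range k, m a i * g i - ∑ i ∈ Finset.range k, m a i * h i := by
    intro a g h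
    simp only [mul_sub, Finset.sum_sub_distrib]
  have smul : ∀ a (c : ℝ) (h : ℕ → ℝ), ∑ i ∈ Finset.range k, m a i * (c * h i) =
      c * ∑ i ∈ Finset.range k, m a i * h i := by
    intro a c h
    rw [Finset.mul_sum]
    exact Finset.sum_congr rfl fun i _ => by ring
  -- two clients of the same block, in either order, are treated symmetrically
  have symm : ∀ a (g : ℕ → ℝ),
      (∀ i j, i ≤ j → j < k → 0 < m a i → 0 < m a j → g i + g j ≤ o i j + o j i) →
      ∑ i ∈ Finset.range k, m a i * g i ≤ O a a := by
    intro a g H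
    have h1 : ∑ i ∈ Finset.range k, m a i * ∑ j ∈ Finset.range k, m a j * (g i + g j) ≤
        ∑ i ∈ Finset.range k, m a i * ∑ j ∈ Finset.range k, m a j * (o i j + o j i) := by
      refine sum_mul_sum_le (m_nonneg a) (m_nonneg a) fun i hi j hj hi0 hj0 => ?_
      rcases le_total i j with h | h
      · exact H i j h (Finset.mem_range.1 hj) hi0 hj0
      · linarith [H j i h (Finset.mem_range.1 hi) hj0 hi0]
    have h2 : ∑ i ∈ Finset.range k, m a i * ∑ j ∈ Finset.range k, m a j * (o i j + o j i) =
        O a a + O a a := by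
      simp only [mul_add, Finset.sum_add_distrib]
      congr 1
      simp only [hO, Finset.mul_sum]
      rw [Finset.sum_comm]
      exact Finset.sum_congr rfl fun i _ => Finset.sum_congr rfl fun j _ => by ring
    rw [sep, h2] at h1
    linarith
  have avg_low : ∀ l (c : ℝ) (e : ℝ),
      (∀ i, i < k → 0 < m l i → α i - d i - e ≤ c) → A l - D l - e ≤ c := by
    intro l c e H
    have := sum_mul_le_of_forall_le (m_nonneg l) (m_sum l) (g := fun i => α i - d i) (c := c + e)
      fun i hi h0 => by linarith [H i (Finset.mem_range.1 hi) h0]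
    rw [sub] at this
    linarith
  have key := block_factor_revealing A D O (f / W)
    (Finset.sum_nonneg fun i _ => mul_nonneg (m_nonneg _ _) (S.budget_nonneg i))
    (fun a b hab => by
      rcases hab.eq_or_lt with rfl | hab
      · exact le_rfl
      refine sum_mul_le_of_forall_le (m_nonneg a) (m_sum a) fun i hi hi0 => ?_
      have := sum_mul_le_of_forall_le (m_nonneg b) (m_sum b) (g := fun j => -α j) (c := -α i)
        fun j hj hj0 => neg_le_neg
          (S.budget_mono i j (m_order a b hab i j hi0 hj0) (Finset.mem_range.1 hj))
      simp only [mul_neg, Finset.sum_neg_distrib] at this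
      exact neg_le_neg_iff.1 this)
    (fun a => Finset.sum_nonneg fun i _ => mul_nonneg (m_nonneg _ _) (S.dist_nonneg i))
    (fun a b => Finset.sum_nonneg fun i _ => mul_nonneg (m_nonneg _ _)
      (Finset.sum_nonneg fun j _ => mul_nonneg (m_nonneg _ _) (S.offer_nonneg i j)))
    (fun a => by
      have : ∑ b, blockWidth b * O a b =
          ∑ i ∈ Finset.range k, m a i * ((∑ j ∈ Finset.range k, ω j * o i j) / W) := by
        have hdiv : ∀ i, (∑ j ∈ Finset.range k, ω j * o i j) / W =
            ∑ b, blockWidth b * ∑ j ∈ Finset.range k, m b j * o i j := fun i => by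
          rw [spread, mul_div_cancel_left₀ _ hW.ne']
        simp only [hdiv, hO, Finset.mul_sum]
        rw [Finset.sum_comm]
        refine Finset.sum_congr rfl fun i _ => Finset.sum_congr rfl fun b _ =>
          Finset.sum_congr rfl fun j _ => by ring
      rw [this]
      refine sum_mul_le_of_forall_le (m_nonneg a) (m_sum a) fun i hi _ => ?_
      exact div_le_div_of_nonneg_right (S.offer_sum i (Finset.mem_range.1 hi)) hW.le)
    (fun a b hab => by
      have h := sum_mul_sum_le (k := k) (m_nonneg a) (m_nonneg b) (g := fun i j => α i + -d j)
        (h := o) fun i _ j hj hi0 hj0 => by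
          linarith [S.offer_later i j (m_order a b hab i j hi0 hj0) (Finset.mem_range.1 hj)]
      rw [sep a b α fun j => -d j] at h
      simp only [mul_neg, Finset.sum_neg_distrib] at h
      exact h)
    (fun a b l hba hal => by
      rcases hal.eq_or_lt with rfl | hal
      · have h := sum_mul_sum_le (k := k) (m_nonneg a) (m_nonneg b)
          (g := fun i j => (α i - d i) + -2 * d j)
          (h := o) fun i hi j hj hi0 hj0 => by
            linarith [S.offer_earlier i j i (m_order b a hba j i hj0 hi0) le_rfl
              (Finset.mem_range.1 hi)]
        rw [sep a b (fun i => α i - d i) fun j => -2 * d j, sub, smul] at h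
        linarith
      · have h := sum_mul_sum_le (k := k) (m_nonneg a) (m_nonneg b)
          (g := fun _ j => (A l - D l) + -2 * d j)
          (h := o) fun i hi j hj hi0 hj0 => by
            have := avg_low l (o i j) (2 * d j) fun l' hl' hl0 =>
              S.offer_earlier i j l' (m_order b a hba j i hj0 hi0)
                (m_order a l hal i l' hi0 hl0) hl'
            linarith
        rw [sep a b (fun _ => A l - D l) fun j => -2 * d j, smul, ← Finset.sum_mul, m_sum] at h
        linarith)
    (fun a => by
      have h := symm a (fun i => α i - 2 * d i) fun i j hij hj _ _ => by
        linarith [S.offer_later i j hij hj, S.offer_earlier j i j hij le_rfl hj]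
      rw [sub, smul] at h
      exact h)
    (fun a' a l ha' hal => by
      have h := symm a (fun i => (A a' + (A l - D l) / 2) / 2 - d i) fun i j hij hj hi0 hj0 => by
        have h1 : A a' ≤ α i := sum_mul_le_of_forall_le (m_nonneg a') (m_sum a') fun i' _ hi'0 =>
          S.budget_mono i' i (m_order a' a ha' i' i hi'0 hi0) (hij.trans_lt hj)
        have h2 := avg_low l (o j i) (2 * d i) fun l' hl' hl0 =>
          S.offer_earlier j i l' hij (m_order a l hal j l' hj0 hl0) hl'
        linarith [S.offer_later i j hij hj, S.offer_nonneg j i]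
      rw [sub, ← Finset.sum_mul, m_sum] at h
      linarith)
    (div_nonneg S.cost_nonneg hW.le)
  rw [spread α, spread d]
  have h3 : W * (f / W) = f := mul_div_cancel₀ _ hW.ne'
  calc W * ∑ a, blockWidth a * A a
      ≤ W * (1.11 * (f / W) + 1.78 * ∑ a, blockWidth a * D a) :=
        mul_le_mul_of_nonneg_left key hW.le
    _ = 1.11 * f + 1.78 * (W * ∑ a, blockWidth a * D a) := by
        linear_combination 1.11 * h3

/-- The overlap of the intervals `[s, t]` and `[p, q]`, as a mixed difference of `min`. -/
theorem overlap_nonneg {p q s t : ℝ} (hpq : p ≤ q) (hst : s ≤ t) :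
    0 ≤ min q t - min q s - min p t + min p s := by
  rcases min_cases q t with h | h <;> rcases min_cases q s with h' | h' <;>
    rcases min_cases p t with h'' | h'' <;> rcases min_cases p s with h''' | h''' <;> linarith

theorem overlap_pos {p q s t : ℝ} (hpq : p ≤ q) (hst : s ≤ t)
    (h : 0 < min q t - min q s - min p t + min p s) : p < t ∧ s < q := by
  constructor
  · by_contra! h'
    rw [min_eq_right h', min_eq_right (h'.trans hpq), min_eq_right (hst.trans h'),
      min_eq_right (hst.trans (h'.trans hpq))] at h
    linarith
  · by_contra! h'
    rw [min_eq_left h', min_eq_left (h'.trans hst), min_eq_left (hpq.trans h'),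
      min_eq_left ((hpq.trans h').trans hst)] at h
    linarith

/-- The left end points of the blocks, and the right end point of the last block. -/
noncomputable def blockStart (a : ℕ) : ℝ := ∑ b : Fin 10, if (b : ℕ) < a then blockWidth b else 0

theorem blockWidth_pos (a : Fin 10) : 0 < blockWidth a := by
  fin_cases a <;> norm_num [blockWidth]

theorem blockStart_succ (a : Fin 10) : blockStart (a + 1) = blockStart a + blockWidth a := by
  have : ∀ b : Fin 10, (if (b : ℕ) < a + 1 then blockWidth b else 0) =
      (if (b : ℕ) < a then blockWidth b else 0) + if b = a then blockWidth b else 0 := by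
    intro b
    rcases lt_trichotomy b a with h | h | h
    · have h' : (b : ℕ) < a := h
      simp [h', h.ne, Nat.lt_succ_of_lt h']
    · simp [h]
    · have h' : (a : ℕ) < b := h
      simp [h.ne', not_lt.2 h'.le, not_lt.2 (Nat.succ_le_of_lt h')]
  simp only [blockStart, this, Finset.sum_add_distrib, Finset.sum_ite_eq', Finset.mem_univ, if_true]

theorem blockStart_mono {a b : ℕ} (h : a ≤ b) : blockStart a ≤ blockStart b := by
  refine Finset.sum_le_sum fun c _ => ?_
  by_cases h1 : (c : ℕ) < a
  · simp [h1, h1.trans_le h]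
  · simp only [h1, if_false]
    split_ifs
    exacts [(blockWidth_pos c).le, le_rfl]

theorem blockStart_zero : blockStart 0 = 0 := by simp [blockStart]

theorem blockStart_ten : blockStart 10 = 1 := by
  simp only [blockStart, Fin.is_lt, if_true, Fin.sum_univ_succ, blockWidth]
  simp
  norm_num

/-- The JMS algorithm is a bifactor `(1.11, 1.78)`-approximation: the budgets of the clients pay at
most `1.11` times the opening cost of any facility and `1.78` times the distances to it. -/
theorem OfferScheme.budget_le {k : ℕ} {ω α d : ℕ → ℝ} {o : ℕ → ℕ → ℝ} {f : ℝ}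
    (S : OfferScheme k ω α d o f) :
    ∑ i ∈ Finset.range k, ω i * α i ≤ 1.11 * f + 1.78 * ∑ i ∈ Finset.range k, ω i * d i := by
  set P : ℕ → ℝ := fun i => ∑ j ∈ Finset.range i, ω j with hP
  have P_succ : ∀ i, P (i + 1) = P i + ω i := fun i => Finset.sum_range_succ _ _
  have P_mono : Monotone P := monotone_nat_of_le_succ fun i => by
    rw [P_succ]; linarith [S.weight_nonneg i]
  have P_nonneg : ∀ i, 0 ≤ P i := fun i => Finset.sum_nonneg fun j _ => S.weight_nonneg j
  rcases (P_nonneg k).eq_or_lt with hW | hW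
  · have h0 : ∀ i ∈ Finset.range k, ω i = 0 :=
      (Finset.sum_eq_zero_iff_of_nonneg fun i _ => S.weight_nonneg i).1 hW.symm
    rw [Finset.sum_eq_zero fun i hi => by rw [h0 i hi, zero_mul],
      Finset.sum_eq_zero fun i hi => by rw [h0 i hi, zero_mul]]
    linarith [S.cost_nonneg]
  set W := P k with hWdef
  have q_le : ∀ a : Fin 10, W * blockStart a ≤ W * blockStart (a + 1) := fun a =>
    mul_le_mul_of_nonneg_left (blockStart_mono a.val.le_succ) hW.le
  -- the clients are spread over `[0, W]`, and cut into blocks at the points `W * blockStart a`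
  set v : Fin 10 → ℕ → ℝ := fun a i =>
    min (W * blockStart (a + 1)) (P (i + 1)) - min (W * blockStart (a + 1)) (P i) -
      min (W * blockStart a) (P (i + 1)) + min (W * blockStart a) (P i) with hv
  have v_nonneg : ∀ a i, 0 ≤ v a i := fun a i => overlap_nonneg (q_le a) (P_mono i.le_succ)
  have v_pos : ∀ a i, 0 < v a i → W * blockStart a < P (i + 1) ∧ P i < W * blockStart (a + 1) :=
    fun a i => overlap_pos (q_le a) (P_mono i.le_succ)
  have c_pos : ∀ a, 0 < W * blockWidth a := fun a => mul_pos hW (blockWidth_pos a)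
  refine S.budget_le_of_blocks hW (fun a i => v a i / (W * blockWidth a))
    (fun a i => div_nonneg (v_nonneg a i) (c_pos a).le) (fun a => ?_) (fun i hi => ?_)
    (fun a b hab i j hi hj => ?_)
  · rw [← Finset.sum_div, div_eq_one_iff_eq (c_pos a).ne']
    have : ∀ i, v a i = (min (W * blockStart (a + 1)) (P (i + 1)) - min (W * blockStart a) (P (i + 1)))
        - (min (W * blockStart (a + 1)) (P i) - min (W * blockStart a) (P i)) := fun i => by
      simp only [hv]; ring
    simp only [this]
    rw [Finset.sum_range_sub (fun i => min (W * blockStart (a + 1)) (P i) -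
      min (W * blockStart a) (P i))]
    have hle : ∀ b ≤ 10, W * blockStart b ≤ W := fun b hb => by
      have := mul_le_mul_of_nonneg_left (blockStart_mono hb) hW.le
      rwa [blockStart_ten, mul_one] at this
    have hge : ∀ b, 0 ≤ W * blockStart b := fun b => by
      have := mul_le_mul_of_nonneg_left (blockStart_mono b.zero_le) hW.le
      rwa [blockStart_zero, mul_zero] at this
    have hP0 : P 0 = 0 := by simp [hP]
    rw [hP0, min_eq_left (hle _ a.2), min_eq_left (hle _ a.2.le), min_eq_right (hge _),
      min_eq_right (hge _), blockStart_succ]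
    ring
  · have h1 : ∀ a, blockWidth a * (v a i / (W * blockWidth a)) = v a i / W := fun a => by
      have := (blockWidth_pos a).ne'
      field_simp
    simp only [h1]
    rw [← Finset.sum_div]
    congr 1
    have h2 : ∀ a : Fin 10, v a i = (fun b : ℕ => min (W * blockStart b) (P (i + 1)) -
        min (W * blockStart b) (P i)) (a + 1) - (fun b : ℕ => min (W * blockStart b) (P (i + 1)) -
        min (W * blockStart b) (P i)) a := fun a => by simp only [hv]; ring
    simp only [h2]
    rw [Fin.sum_univ_eq_sum_range (fun a : ℕ =>
      (fun b : ℕ => min (W * blockStart b) (P (i + 1)) - min (W * blockStart b) (P i)) (a + 1) -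
      (fun b : ℕ => min (W * blockStart b) (P (i + 1)) - min (W * blockStart b) (P i)) a) 10,
      Finset.sum_range_sub (fun b : ℕ => min (W * blockStart b) (P (i + 1)) -
        min (W * blockStart b) (P i))]
    simp only [blockStart_ten, blockStart_zero, mul_one, mul_zero]
    rw [min_eq_right (P_mono hi), min_eq_right (P_mono hi.le), min_eq_left (P_nonneg _),
      min_eq_left (P_nonneg _), P_succ]
    ring
  · have hi' := (v_pos a i ((div_pos_iff_of_pos_right (c_pos a)).1 hi)).2
    have hj' := (v_pos b j ((div_pos_iff_of_pos_right (c_pos b)).1 hj)).1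
    have hab' : W * blockStart (a + 1) ≤ W * blockStart b :=
      mul_le_mul_of_nonneg_left (blockStart_mono hab) hW.le
    by_contra! hij
    linarith [P_mono (Nat.succ_le_of_lt hij)]

end FacilityLocation

namespace FacilityLocation

/-! ### Runs of the JMS algorithm -/

section JMS

variable {F C X : Type*} [PseudoMetricSpace X]

theorem Instance.d_nonneg (I : Instance F C X) (i : F) (j : C) : 0 ≤ I.d i j := dist_nonneg

/-- The triangle inequality for two facilities and two clients. -/
theorem Instance.d_le (I : Instance F C X) (i i' : F) (j j' : C) :
    I.d i j ≤ I.d i j' + I.d i' j' + I.d i' j := by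
  unfold Instance.d
  calc dist (I.facility i) (I.client j)
      ≤ dist (I.facility i) (I.client j') + dist (I.client j') (I.facility i') +
        dist (I.facility i') (I.client j) := dist_triangle4 _ _ _ _
    _ = _ := by rw [dist_comm (I.client j')]

theorem Instance.offer_nonneg (I : Instance F C X) (s : JMSState F C) (t : ℝ) (i : F) (j : C) :
    0 ≤ I.offer s t i j := by
  unfold Instance.offer
  split <;> exact le_max_right _ _

theorem Instance.offer_none (I : Instance F C X) {s : JMSState F C} (t : ℝ) (i : F) {j : C}
    (h : s.assign j = none) : I.offer s t i j = max (t - I.d i j) 0 := by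
  simp only [Instance.offer, h]

theorem Instance.offer_some (I : Instance F C X) {s : JMSState F C} (t : ℝ) (i : F) {j : C} {i' : F}
    (h : s.assign j = some i') : I.offer s t i j = max (I.d i' j - I.d i j) 0 := by
  simp only [Instance.offer, h]

theorem Instance.continuous_offer (I : Instance F C X) (s : JMSState F C) (i : F) (j : C) :
    Continuous fun t => I.offer s t i j := by
  unfold Instance.offer
  split <;> fun_prop

variable [Fintype C]

/-- No event of the JMS algorithm is overdue at time `t`: no unopened facility is overpaid, and the
unconnected clients have not passed an open facility. -/
structure Instance.Ready (I : Instance F C X) (s : JMSState F C) (t : ℝ) : Prop where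
  not_overpaid : ∀ i ∉ s.opened, ∑ j, I.offer s t i j ≤ I.openCost i
  not_passed : ∀ i ∈ s.opened, ∀ j, s.assign j = none → t ≤ I.d i j
  assigned : ∀ j i', s.assign j = some i' → i' ∈ s.opened
  closest : ∀ j i', s.assign j = some i' → ∀ i ∈ s.opened, I.d i' j ≤ I.d i j

theorem Instance.Ready.next {I : Instance F C X} {s : JMSState F C} {t : ℝ}
    (h : I.Ready s s.time) (ht : I.IsNextTime s t) : I.Ready s t where
  not_overpaid i hi := by
    by_contra! hlt
    have hc : Continuous fun t => ∑ j, I.offer s t i j :=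
      continuous_finsetSum _ fun j _ => I.continuous_offer s i j
    obtain ⟨t', ⟨h1, h2⟩, h3⟩ := intermediate_value_Icc ht.1.1 hc.continuousOn
      ⟨h.not_overpaid i hi, hlt.le⟩
    have h4 : t ≤ t' := ht.2 ⟨h1, Or.inl ⟨i, hi, h3⟩⟩
    obtain rfl : t = t' := le_antisymm h4 h2
    exact hlt.ne' h3
  not_passed i hi j hj := ht.2 ⟨h.not_passed i hi j hj, Or.inr ⟨i, j, hi, hj, rfl⟩⟩
  assigned := h.assigned
  closest := h.closest

/-- As long as some client is unconnected, there is a next event. -/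
theorem Instance.Ready.exists_next [Fintype F] [Nonempty F] {I : Instance F C X}
    {s : JMSState F C} (h : I.Ready s s.time) (hs : ∃ j, s.assign j = none) :
    ∃ t, I.IsNextTime s t := by
  set E : Set ℝ := {t' | s.time ≤ t' ∧
    ((∃ i, I.OpenEvent s t' i) ∨ ∃ i j, I.ConnectEvent s t' i j)} with hE
  have hcont : ∀ i, Continuous fun t => ∑ j, I.offer s t i j := fun i =>
    continuous_finsetSum _ fun j _ => I.continuous_offer s i j
  have closed : IsClosed E := by
    refine (isClosed_le continuous_const continuous_id).inter (IsClosed.union ?_ ?_)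
    · have : {t' | ∃ i, I.OpenEvent s t' i} = ⋃ i, {t' | I.OpenEvent s t' i} := by ext; simp
      change IsClosed {t' | ∃ i, I.OpenEvent s t' i}
      rw [this]
      exact isClosed_iUnion_of_finite fun i =>
        isClosed_const.inter (isClosed_eq (hcont i) continuous_const)
    · have : {t' | ∃ i j, I.ConnectEvent s t' i j} = ⋃ i, ⋃ j, {t' | I.ConnectEvent s t' i j} := by
        ext; simp
      change IsClosed {t' | ∃ i j, I.ConnectEvent s t' i j}
      rw [this]
      exact isClosed_iUnion_of_finite fun i => isClosed_iUnion_of_finite fun j =>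
        isClosed_const.inter (isClosed_const.inter (isClosed_eq continuous_id continuous_const))
  have nonempty : E.Nonempty := by
    obtain ⟨j, hj⟩ := hs
    obtain ⟨i⟩ := ‹Nonempty F›
    by_cases hi : i ∈ s.opened
    · exact ⟨I.d i j, h.not_passed i hi j hj, Or.inr ⟨i, j, hi, hj, rfl⟩⟩
    · set t₁ := max s.time (I.openCost i + I.d i j)
      have h1 : I.openCost i ≤ ∑ j, I.offer s t₁ i j := by
        refine le_trans ?_ (Finset.single_le_sum (fun j _ => I.offer_nonneg s t₁ i j)
          (Finset.mem_univ j))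
        rw [I.offer_none _ _ hj]
        exact le_max_of_le_left (by linarith [le_max_right s.time (I.openCost i + I.d i j)])
      obtain ⟨t', ⟨h2, -⟩, h3⟩ := intermediate_value_Icc (le_max_left _ _) (hcont i).continuousOn
        ⟨h.not_overpaid i hi, h1⟩
      exact ⟨t', h2, Or.inl ⟨i, hi, h3⟩⟩
  exact ⟨sInf E, closed.csInf_mem nonempty ⟨s.time, fun t ht => ht.1⟩,
    fun t ht => csInf_le ⟨s.time, fun t ht => ht.1⟩ ht⟩

theorem Instance.Ready.connectAt [DecidableEq C] {I : Instance F C X} {s : JMSState F C} {t : ℝ}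
    (h : I.Ready s t) {i : F} {j : C} (ev : I.ConnectEvent s t i j) :
    I.Ready ⟨t, s.opened, Function.update s.assign j (some i)⟩ t where
  not_overpaid i₁ hi₁ := by
    refine le_trans (Finset.sum_le_sum fun j₁ _ => ?_) (h.not_overpaid i₁ hi₁)
    by_cases hj : j₁ = j
    · subst hj
      rw [I.offer_some (i' := i) _ _ (by simp), I.offer_none _ _ ev.2.1, ev.2.2]
    · simp [Instance.offer, hj]
  not_passed i₁ hi₁ j₁ hj₁ := by
    by_cases hj : j₁ = j
    · simp [hj] at hj₁
    · exact h.not_passed i₁ hi₁ j₁ (by simpa [hj] using hj₁)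
  assigned j₁ i' hj₁ := by
    by_cases hj : j₁ = j
    · subst hj
      obtain rfl : i = i' := by simpa using hj₁
      exact ev.1
    · exact h.assigned j₁ i' (by simpa [hj] using hj₁)
  closest j₁ i' hj₁ i₁ hi₁ := by
    by_cases hj : j₁ = j
    · subst hj
      obtain rfl : i = i' := by simpa using hj₁
      rw [← ev.2.2]
      exact h.not_passed i₁ hi₁ j₁ ev.2.1
    · exact h.closest j₁ i' (by simpa [hj] using hj₁) i₁ hi₁

theorem Instance.ready_init (I : Instance F C X) : I.Ready (jmsInit F C) 0 where
  not_overpaid i _ := by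
    refine le_trans (le_of_eq (Finset.sum_eq_zero fun j _ => ?_)) (I.openCost_nonneg i)
    rw [I.offer_none _ _ rfl]
    exact max_eq_right (by linarith [I.d_nonneg i j])
  not_passed i hi := absurd hi (Finset.notMem_empty i)
  assigned j i' h := by simp [jmsInit] at h
  closest j i' h := by simp [jmsInit] at h

variable [DecidableEq F]

/-- The state after facility `i` is opened at time `t`. -/
noncomputable abbrev Instance.openAt (I : Instance F C X) (s : JMSState F C) (t : ℝ) (i : F) :
    JMSState F C where
  time := t
  opened := insert i s.opened
  assign := fun j => open scoped Classical in
    if 0 < I.offer s t i j then some i else s.assign j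

theorem Instance.Ready.openAt {I : Instance F C X} {s : JMSState F C} {t : ℝ}
    (h : I.Ready s t) (i : F) : I.Ready (I.openAt s t i) t where
  not_overpaid i₁ hi₁ := by
    refine le_trans (Finset.sum_le_sum fun j _ => ?_)
      (h.not_overpaid i₁ fun h' => hi₁ (Finset.mem_insert_of_mem h'))
    by_cases hj : 0 < I.offer s t i j
    · have h1 : (I.openAt s t i).assign j = some i := by simp [hj]
      rw [I.offer_some _ _ h1]
      rcases hs : s.assign j with _ | i'
      · rw [I.offer_none _ _ hs] at hj ⊢
        have := (lt_max_iff.1 hj).resolve_right (lt_irrefl _)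
        exact max_le_max (by linarith) le_rfl
      · rw [I.offer_some _ _ hs] at hj ⊢
        have := (lt_max_iff.1 hj).resolve_right (lt_irrefl _)
        exact max_le_max (by linarith) le_rfl
    · have h1 : (I.openAt s t i).assign j = s.assign j := by simp [hj]
      exact le_of_eq (by unfold Instance.offer; rw [h1])
  not_passed i₁ hi₁ j hj := by
    by_cases hj' : 0 < I.offer s t i j
    · simp [hj'] at hj
    have h1 : s.assign j = none := by simpa [hj'] using hj
    rcases Finset.mem_insert.1 hi₁ with rfl | hi₁
    · rw [I.offer_none _ _ h1] at hj'
      by_contra! h2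
      exact hj' (lt_max_of_lt_left (by linarith))
    · exact h.not_passed i₁ hi₁ j h1
  assigned j i' hj := by
    by_cases hj' : 0 < I.offer s t i j
    · have : i = i' := by simpa [hj'] using hj
      simp [this]
    · exact Finset.mem_insert_of_mem (h.assigned j i' (by simpa [hj'] using hj))
  closest j i' hj i₁ hi₁ := by
    by_cases hj' : 0 < I.offer s t i j
    · obtain rfl : i = i' := by simpa [hj'] using hj
      rcases Finset.mem_insert.1 hi₁ with rfl | hi₁
      · exact le_rfl
      rcases hs : s.assign j with _ | i₂
      · rw [I.offer_none _ _ hs] at hj'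
        have := (lt_max_iff.1 hj').resolve_right (lt_irrefl _)
        linarith [h.not_passed i₁ hi₁ j hs]
      · rw [I.offer_some _ _ hs] at hj'
        have := (lt_max_iff.1 hj').resolve_right (lt_irrefl _)
        linarith [h.closest j i₂ hs i₁ hi₁]
    · have hs : s.assign j = some i' := by simpa [hj'] using hj
      rcases Finset.mem_insert.1 hi₁ with rfl | hi₁
      · rw [I.offer_some _ _ hs] at hj'
        by_contra! h2
        exact hj' (lt_max_of_lt_left (by linarith))
      · exact h.closest j i' hs i₁ hi₁

variable [DecidableEq C]

theorem Instance.Ready.step {I : Instance F C X} {s s' : JMSState F C} (h : I.Ready s s.time)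
    (hs : I.JMSStep s s') : I.Ready s' s'.time := by
  cases hs with
  | openFacility t i unfinished next ev => exact (h.next next).openAt i
  | connectClient t i j next ev => exact (h.next next).connectAt ev

/-- Every step opens a facility or connects a client, so that the JMS algorithm terminates. -/
theorem Instance.exists_jmsOutput [Fintype F] [Nonempty F] (I : Instance F C X) :
    ∃ s, I.JMSOutput s := by
  have key : ∀ (N : ℕ) (s : JMSState F C), I.Ready s s.time →
      (Finset.univ \ s.opened).card + {j | s.assign j = none}.toFinset.card ≤ N →
      ∃ s', Relation.ReflTransGen I.JMSStep s s' ∧ ∀ j, s'.assign j ≠ none := by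
    intro N
    induction N with
    | zero =>
      intro s _ hN
      refine ⟨s, .refl, fun j hj => ?_⟩
      have : j ∈ {j | s.assign j = none}.toFinset := by simpa using hj
      have := Finset.card_pos.2 ⟨j, this⟩
      omega
    | succ N ih =>
      intro s hs hN
      by_cases hfin : ∀ j, s.assign j ≠ none
      · exact ⟨s, .refl, hfin⟩
      push Not at hfin
      obtain ⟨t, ht⟩ := hs.exists_next hfin
      have : ∃ s₁, I.JMSStep s s₁ ∧ (Finset.univ \ s₁.opened).card +
          {j | s₁.assign j = none}.toFinset.card <
          (Finset.univ \ s.opened).card + {j | s.assign j = none}.toFinset.card := by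
        rcases ht.1.2 with ⟨i, ev⟩ | ⟨i, j, ev⟩
        · refine ⟨_, .openFacility s t i hfin ht ev, ?_⟩
          refine add_lt_add_of_lt_of_le (Finset.card_lt_card ?_) (Finset.card_le_card ?_)
          · rw [Finset.ssubset_iff_of_subset
              (Finset.sdiff_subset_sdiff le_rfl (Finset.subset_insert i s.opened))]
            exact ⟨i, by simpa using ev.1, by simp⟩
          · intro j hj
            by_cases hj' : 0 < I.offer s t i j
            · simp [hj'] at hj
            · simpa [hj'] using hj
        · refine ⟨_, .connectClient s t i j ht ev, ?_⟩
          refine add_lt_add_of_le_of_lt le_rfl (Finset.card_lt_card ?_)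
          rw [Finset.ssubset_iff_of_subset]
          · exact ⟨j, by simpa using ev.2.1, by simp⟩
          · intro j₁ hj₁
            by_cases hj : j₁ = j
            · simp [hj] at hj₁
            · simpa [hj] using hj₁
      obtain ⟨s₁, h1, h2⟩ := this
      obtain ⟨s', h3, h4⟩ := ih s₁ (hs.step h1) (by omega)
      exact ⟨s', h3.head h1, h4⟩
  exact key _ (jmsInit F C) I.ready_init le_rfl

end JMS

end FacilityLocation

namespace FacilityLocation

/-! ### The cost of the JMS algorithm -/

section JMS

variable {F C X : Type*} [PseudoMetricSpace X] [Fintype C]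

/-- The record of a run of the JMS algorithm up to the state `s`: client `j` has been connected in
the iteration `τ j`, with budget `α j`, and `o i φ j` is the offer of client `j` to facility `φ`
just before the iteration in which client `i` is connected (it is `0` if `φ` is already open). -/
structure Instance.Record (I : Instance F C X) (s : JMSState F C) (N : ℕ) (τ : C → ℕ) (α : C → ℝ)
    (o : C → F → C → ℝ) : Prop where
  lt_count : ∀ j, s.assign j ≠ none → τ j < N
  budget_nonneg : ∀ j, 0 ≤ α j
  budget_le_time : ∀ j, s.assign j ≠ none → α j ≤ s.time
  cost : I.jmsCost s = ∑ j, if s.assign j = none then 0 else α j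
  dist_le : ∀ j i, s.assign j = some i → I.d i j ≤ α j
  mono : ∀ i j, s.assign i ≠ none → s.assign j ≠ none → τ i ≤ τ j → α i ≤ α j
  offer_nonneg : ∀ i φ j, 0 ≤ o i φ j
  offer_sum : ∀ i φ, s.assign i ≠ none → ∑ j, o i φ j ≤ I.openCost φ
  later : ∀ i φ j, s.assign i ≠ none → s.assign j ≠ none → τ i ≤ τ j → α i - I.d φ j ≤ o i φ j
  unconnected : ∀ i φ j, s.assign i ≠ none → s.assign j = none → α i - I.d φ j ≤ o i φ j
  earlier : ∀ i φ j l, s.assign i ≠ none → s.assign j ≠ none → s.assign l ≠ none → τ j ≤ τ i →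
    τ i ≤ τ l → α l - I.d φ l - 2 * I.d φ j ≤ o i φ j
  current : ∀ i φ j i', s.assign i ≠ none → s.assign j = some i' → τ j ≤ τ i →
    I.d i' j - I.d φ j ≤ o i φ j

/-- One iteration at time `t` extends the record: the newly connected clients have budget `t`. -/
theorem Instance.Record.extend {I : Instance F C X} {s s' : JMSState F C} {N : ℕ} {τ : C → ℕ}
    {α : C → ℝ} {o : C → F → C → ℝ} (H : I.Record s N τ α o) {t : ℝ} (hr : I.Ready s t)
    (h0 : 0 ≤ s.time) (hst : s.time ≤ t) (ht : s'.time = t)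
    (hold : ∀ j i, s.assign j = some i → ∃ i', s'.assign j = some i' ∧ I.d i' j ≤ I.d i j)
    (hnew : ∀ j i, s.assign j = none → s'.assign j = some i → I.d i j ≤ t)
    (hcost : I.jmsCost s' = I.jmsCost s +
      ∑ j, if s.assign j = none ∧ s'.assign j ≠ none then t else 0) :
    ∃ N τ α o, I.Record s' N τ α o := by
  classical
  have old_conn : ∀ j, s.assign j ≠ none → s'.assign j ≠ none := by
    intro j hj
    obtain ⟨i, hi⟩ := Option.ne_none_iff_exists'.1 hj
    obtain ⟨i', hi', -⟩ := hold j i hi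
    simp [hi']
  -- the offers just before this iteration
  set sn : F → C → ℝ := fun φ j => if φ ∈ s.opened then 0 else I.offer s t φ j with hsn
  have sn_nonneg : ∀ φ j, 0 ≤ sn φ j := by
    intro φ j
    simp only [hsn]
    split_ifs
    exacts [le_rfl, I.offer_nonneg _ _ _ _]
  have sn_none : ∀ φ j, s.assign j = none → t - I.d φ j ≤ sn φ j := by
    intro φ j hj
    simp only [hsn]
    split_ifs with hφ
    · linarith [hr.not_passed φ hφ j hj]
    · rw [I.offer_none _ _ hj]; exact le_max_left _ _
  have sn_some : ∀ φ j i, s.assign j = some i → I.d i j - I.d φ j ≤ sn φ j := by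
    intro φ j i hj
    simp only [hsn]
    split_ifs with hφ
    · linarith [hr.closest j i hj φ hφ]
    · rw [I.offer_some _ _ hj]; exact le_max_left _ _
  set τ' : C → ℕ := fun j => if s.assign j = none then N else τ j with hτ'
  set α' : C → ℝ := fun j => if s.assign j = none then t else α j with hα'
  set o' : C → F → C → ℝ := fun i => if s.assign i = none then sn else o i with ho'
  have τ_new : ∀ j, s.assign j = none → τ' j = N := fun j h => by simp [hτ', h]
  have τ_old : ∀ j, s.assign j ≠ none → τ' j = τ j := fun j h => by simp [hτ', h]
  have α_new : ∀ j, s.assign j = none → α' j = t := fun j h => by simp [hα', h]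
  have α_old : ∀ j, s.assign j ≠ none → α' j = α j := fun j h => by simp [hα', h]
  have o_new : ∀ j, s.assign j = none → o' j = sn := fun j h => by simp [ho', h]
  have o_old : ∀ j, s.assign j ≠ none → o' j = o j := fun j h => by simp [ho', h]
  have new_of_le : ∀ i j, s.assign i = none → τ' i ≤ τ' j → s.assign j = none := by
    intro i j hi hij
    by_contra hj
    rw [τ_new i hi, τ_old j hj] at hij
    exact absurd (H.lt_count j hj) (not_lt.2 hij)
  have cur_old : ∀ i φ j i', s'.assign i ≠ none → s.assign j = some i' → τ' j ≤ τ' i →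
      I.d i' j - I.d φ j ≤ o' i φ j := by
    intro i φ j i' hi' hj hji
    by_cases hi : s.assign i = none
    · rw [o_new i hi]; exact sn_some φ j i' hj
    · rw [o_old i hi]
      rw [τ_old i hi, τ_old j (by simp [hj])] at hji
      exact H.current i φ j i' hi hj hji
  refine ⟨N + 1, τ', α', o', ?_, ?_, ?_, ?_, ?_, ?_, ?_, ?_, ?_, ?_, ?_, ?_⟩
  · intro j _
    by_cases h : s.assign j = none
    · rw [τ_new j h]; omega
    · rw [τ_old j h]; exact (H.lt_count j h).trans (Nat.lt_succ_self N)
  · intro j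
    by_cases h : s.assign j = none
    · rw [α_new j h]; exact h0.trans hst
    · rw [α_old j h]; exact H.budget_nonneg j
  · intro j _
    rw [ht]
    by_cases h : s.assign j = none
    · rw [α_new j h]
    · rw [α_old j h]; exact (H.budget_le_time j h).trans hst
  · rw [hcost, H.cost, ← Finset.sum_add_distrib]
    refine Finset.sum_congr rfl fun j _ => ?_
    by_cases h : s.assign j = none
    · by_cases h' : s'.assign j = none <;> simp [h, h', α_new j h]
    · simp [h, old_conn j h, α_old j h]
  · intro j i hj
    by_cases h : s.assign j = none
    · rw [α_new j h]; exact hnew j i h hj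
    · rw [α_old j h]
      obtain ⟨i₀, hi₀⟩ := Option.ne_none_iff_exists'.1 h
      obtain ⟨i', hi', hle⟩ := hold j i₀ hi₀
      obtain rfl : i' = i := by simpa [hi'] using hj
      exact hle.trans (H.dist_le j i₀ hi₀)
  · intro i j hi hj hij
    by_cases h : s.assign j = none
    · rw [α_new j h]
      by_cases h' : s.assign i = none
      · rw [α_new i h']
      · rw [α_old i h']; exact (H.budget_le_time i h').trans hst
    · have h' : s.assign i ≠ none := fun h' => h (new_of_le i j h' hij)
      rw [τ_old i h', τ_old j h] at hij
      rw [α_old i h', α_old j h]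
      exact H.mono i j h' h hij
  · intro i φ j
    by_cases h : s.assign i = none
    · rw [o_new i h]; exact sn_nonneg φ j
    · rw [o_old i h]; exact H.offer_nonneg i φ j
  · intro i φ _
    by_cases h : s.assign i = none
    · rw [o_new i h]
      by_cases hφ : φ ∈ s.opened
      · simp [hsn, hφ, I.openCost_nonneg φ]
      · simpa [hsn, hφ] using hr.not_overpaid φ hφ
    · rw [o_old i h]; exact H.offer_sum i φ h
  · intro i φ j hi hj hij
    by_cases h : s.assign i = none
    · rw [o_new i h, α_new i h]; exact sn_none φ j (new_of_le i j h hij)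
    · rw [o_old i h, α_old i h]
      by_cases h' : s.assign j = none
      · exact H.unconnected i φ j h h'
      · rw [τ_old i h, τ_old j h'] at hij
        exact H.later i φ j h h' hij
  · intro i φ j hi hj
    have hj' : s.assign j = none := by
      by_contra h; exact old_conn j h hj
    by_cases h : s.assign i = none
    · rw [o_new i h, α_new i h]; exact sn_none φ j hj'
    · rw [o_old i h, α_old i h]; exact H.unconnected i φ j h hj'
  · intro i φ j l hi hj hl hji hil
    by_cases h : s.assign l = none
    · rw [α_new l h]
      by_cases h' : s.assign j = none
      · have h'' := new_of_le j i h' hji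
        rw [o_new i h'']
        linarith [sn_none φ j h', I.d_nonneg φ l, I.d_nonneg φ j]
      · obtain ⟨i₀, hi₀⟩ := Option.ne_none_iff_exists'.1 h'
        have h1 := cur_old i φ j i₀ hi hi₀ hji
        have h2 := hr.not_passed i₀ (hr.assigned j i₀ hi₀) l h
        linarith [I.d_le i₀ φ l j]
    · have h1 : s.assign i ≠ none := fun h' => h (new_of_le i l h' hil)
      have h2 : s.assign j ≠ none := fun h' => h1 (new_of_le j i h' hji)
      rw [τ_old i h1, τ_old j h2] at hji
      rw [τ_old i h1, τ_old l h] at hil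
      rw [α_old l h, o_old i h1]
      exact H.earlier i φ j l h1 h2 h hji hil
  · intro i φ j i' hi hj hji
    by_cases h : s.assign j = none
    · have h'' := new_of_le j i h hji
      rw [o_new i h'']
      linarith [sn_none φ j h, hnew j i' h hj]
    · obtain ⟨i₀, hi₀⟩ := Option.ne_none_iff_exists'.1 h
      obtain ⟨i₁, hi₁, hle⟩ := hold j i₀ hi₀
      obtain rfl : i₁ = i' := by simpa [hi₁] using hj
      linarith [cur_old i φ j i₀ hi hi₀ hji]

theorem Instance.record_init (I : Instance F C X) :
    I.Record (jmsInit F C) 0 (fun _ => 0) (fun _ => 0) (fun _ _ _ => 0) := by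
  constructor <;> simp [jmsInit, Instance.jmsCost]

/-- The budgets of the clients are covered by any facility together with the distances to it. -/
theorem Instance.Record.budget_le {I : Instance F C X} {s : JMSState F C} {N : ℕ} {τ : C → ℕ}
    {α : C → ℝ} {o : C → F → C → ℝ} (H : I.Record s N τ α o) (hs : ∀ j, s.assign j ≠ none)
    (φ : F) {ω : C → ℝ} (h0 : ∀ j, 0 ≤ ω j) (h1 : ∀ j, ω j ≤ 1) :
    ∑ j, ω j * α j ≤ 1.11 * I.openCost φ + 1.78 * ∑ j, ω j * I.d φ j := by
  set k := Fintype.card C with hk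
  obtain ⟨e, he⟩ : ∃ e : Fin k ≃ C, Monotone (τ ∘ e) := by
    let e₀ := (Fintype.equivFin C).symm
    exact ⟨(Tuple.sort (τ ∘ e₀)).trans e₀, Tuple.monotone_sort (τ ∘ e₀)⟩
  rcases isEmpty_or_nonempty C with hC | ⟨⟨j₀⟩⟩
  · simpa using mul_nonneg (by norm_num) (I.openCost_nonneg φ)
  let e' : ℕ → C := fun i => if h : i < k then e ⟨i, h⟩ else j₀
  have e'_lt : ∀ i (h : i < k), e' i = e ⟨i, h⟩ := fun i h => by simp [e', h]
  have hsum : ∀ g : C → ℝ, ∑ i ∈ Finset.range k, g (e' i) = ∑ j, g j := by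
    intro g
    rw [← Fin.sum_univ_eq_sum_range (fun i => g (e' i)), ← e.sum_comp]
    exact Finset.sum_congr rfl fun i _ => by rw [e'_lt i i.2]
  have mono : ∀ i j, i ≤ j → j < k → τ (e' i) ≤ τ (e' j) := by
    intro i j hij hj
    rw [e'_lt j hj, e'_lt i (hij.trans_lt hj)]
    exact he (a := ⟨i, hij.trans_lt hj⟩) (b := ⟨j, hj⟩) hij
  have S : OfferScheme k (fun i => ω (e' i)) (fun i => α (e' i)) (fun i => I.d φ (e' i))
      (fun i j => o (e' i) φ (e' j)) (I.openCost φ) :=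
    { weight_nonneg := fun i => h0 _
      dist_nonneg := fun i => I.d_nonneg _ _
      offer_nonneg := fun i j => H.offer_nonneg _ _ _
      budget_nonneg := fun i => H.budget_nonneg _
      budget_mono := fun i j hij hj => H.mono _ _ (hs _) (hs _) (mono i j hij hj)
      offer_later := fun i j hij hj => H.later _ _ _ (hs _) (hs _) (mono i j hij hj)
      offer_earlier := fun i j l hji hil hl => H.earlier _ _ _ _ (hs _) (hs _) (hs _)
        (mono j i hji (hil.trans_lt hl)) (mono i l hil hl)
      offer_sum := fun i hi => by
        rw [hsum fun j => ω j * o (e' i) φ j]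
        refine le_trans (Finset.sum_le_sum fun j _ => ?_) (H.offer_sum (e' i) φ (hs _))
        exact mul_le_of_le_one_left (H.offer_nonneg _ _ _) (h1 j)
      cost_nonneg := I.openCost_nonneg φ }
  have := S.budget_le
  rwa [hsum fun j => ω j * α j, hsum fun j => ω j * I.d φ j] at this

/-- The opening cost of a new facility is covered by the offers to it. -/
theorem Instance.jmsCost_openAt [DecidableEq F] (I : Instance F C X) {s : JMSState F C} {t : ℝ}
    {i : F}
    (ev : I.OpenEvent s t i) : I.jmsCost (I.openAt s t i) = I.jmsCost s +
      ∑ j, if s.assign j = none ∧ (I.openAt s t i).assign j ≠ none then t else 0 := by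
  unfold Instance.jmsCost
  rw [Finset.sum_insert ev.1, ← ev.2]
  rw [add_comm (∑ j, I.offer s t i j), add_assoc, add_assoc, ← Finset.sum_add_distrib,
    ← Finset.sum_add_distrib]
  refine congrArg₂ _ rfl (Finset.sum_congr rfl fun j _ => ?_)
  by_cases hj : 0 < I.offer s t i j
  · have h1 : (I.openAt s t i).assign j = some i := by simp [hj]
    rw [h1]
    rcases hs : s.assign j with _ | i'
    · rw [I.offer_none _ _ hs] at hj ⊢
      rw [max_eq_left ((lt_max_iff.1 hj).resolve_right (lt_irrefl _)).le]
      simp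
    · rw [I.offer_some _ _ hs] at hj ⊢
      rw [max_eq_left ((lt_max_iff.1 hj).resolve_right (lt_irrefl _)).le]
      simp
  · have h1 : (I.openAt s t i).assign j = s.assign j := by simp [hj]
    have h2 : I.offer s t i j = 0 := le_antisymm (not_lt.1 hj) (I.offer_nonneg _ _ _ _)
    rw [h1, h2]
    simp

theorem Instance.jmsCost_connectAt [DecidableEq C] (I : Instance F C X) {s : JMSState F C} {t : ℝ}
    {i : F} {j : C}
    (ev : I.ConnectEvent s t i j) :
    I.jmsCost ⟨t, s.opened, Function.update s.assign j (some i)⟩ = I.jmsCost s +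
      ∑ j', if s.assign j' = none ∧ Function.update s.assign j (some i) j' ≠ none then t else 0 := by
  unfold Instance.jmsCost
  rw [add_assoc, ← Finset.sum_add_distrib]
  refine congrArg₂ _ rfl (Finset.sum_congr rfl fun j' _ => ?_)
  by_cases h : j' = j
  · subst h
    simp [ev.2.1, ev.2.2]
  · simp only [Function.update_of_ne h]
    simp

variable [DecidableEq F] [DecidableEq C]

/-- Every reachable state of the JMS algorithm has a record. -/
theorem Instance.exists_record (I : Instance F C X) {s : JMSState F C}
    (hs : Relation.ReflTransGen I.JMSStep (jmsInit F C) s) :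
    I.Ready s s.time ∧ 0 ≤ s.time ∧ ∃ N τ α o, I.Record s N τ α o := by
  induction hs with
  | refl => exact ⟨I.ready_init, le_rfl, _, _, _, _, I.record_init⟩
  | @tail s₁ s₂ _ hstep ih =>
    obtain ⟨hr, h0, N, τ, α, o, H⟩ := ih
    refine ⟨hr.step hstep, ?_⟩
    cases hstep with
    | openFacility t i unfinished next ev =>
      refine ⟨h0.trans next.1.1, H.extend (hr.next next) h0 next.1.1 rfl ?_ ?_
        (I.jmsCost_openAt ev)⟩
      · intro j i' hj
        by_cases hj' : 0 < I.offer s₁ t i j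
        · refine ⟨i, by simp [hj'], ?_⟩
          rw [I.offer_some _ _ hj] at hj'
          linarith [(lt_max_iff.1 hj').resolve_right (lt_irrefl _)]
        · exact ⟨i', by simp [hj', hj], le_rfl⟩
      · intro j i' hj hj1
        by_cases hj' : 0 < I.offer s₁ t i j
        · obtain rfl : i = i' := by simpa [hj'] using hj1
          rw [I.offer_none _ _ hj] at hj'
          linarith [(lt_max_iff.1 hj').resolve_right (lt_irrefl _)]
        · simp [hj', hj] at hj1
    | connectClient t i j next ev =>
      refine ⟨h0.trans next.1.1, H.extend (hr.next next) h0 next.1.1 rfl ?_ ?_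
        (I.jmsCost_connectAt ev)⟩
      · intro j' i' hj'
        have : j' ≠ j := by rintro rfl; simp [ev.2.1] at hj'
        exact ⟨i', by simp [this, hj'], le_rfl⟩
      · intro j' i' hj' h1
        by_cases h : j' = j
        · subst h
          obtain rfl : i = i' := by simpa using h1
          exact ev.2.2.ge
        · simp [h, hj'] at h1

/-- The JMS algorithm costs at most `1.11` times the opening cost plus `1.78` times the connection
cost of any fractional solution. -/
theorem Instance.jmsCost_le [Fintype F] (I : Instance F C X) {s : JMSState F C}
    (hs : I.JMSOutput s) {x : F → C → ℝ} {y : F → ℝ} (hxy : IsFractional x y) :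
    I.jmsCost s ≤ 1.11 * ∑ i, y i * I.openCost i + 1.78 * ∑ i, ∑ j, I.d i j * x i j := by
  obtain ⟨-, -, N, τ, α, o, H⟩ := I.exists_record hs.1
  have h1 : I.jmsCost s = ∑ i, ∑ j, x i j * α j := by
    rw [H.cost, Finset.sum_comm]
    refine Finset.sum_congr rfl fun j _ => ?_
    rw [if_neg (hs.2 j), ← Finset.sum_mul, hxy.sum_eq_one, one_mul]
  rw [h1, Finset.mul_sum, Finset.mul_sum, ← Finset.sum_add_distrib]
  refine Finset.sum_le_sum fun i _ => ?_
  rcases (hxy.y_nonneg i).eq_or_lt with hy | hy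
  · have hx : ∀ j, x i j = 0 := fun j =>
      le_antisymm (hy ▸ hxy.le_open i j) (hxy.x_nonneg i j)
    simp [hx, ← hy]
  have h2 := H.budget_le hs.2 i (ω := fun j => x i j / y i)
    (fun j => div_nonneg (hxy.x_nonneg i j) hy.le)
    (fun j => div_le_one_of_le₀ (hxy.le_open i j) hy.le)
  have h3 : ∀ g : C → ℝ, ∑ j, x i j * g j = y i * ∑ j, x i j / y i * g j := by
    intro g
    rw [Finset.mul_sum]
    exact Finset.sum_congr rfl fun j _ => by field_simp
  have h4 : ∑ j, I.d i j * x i j = ∑ j, x i j * I.d i j :=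
    Finset.sum_congr rfl fun j _ => mul_comm _ _
  rw [h4, h3 α, h3 (I.d i)]
  nlinarith [mul_le_mul_of_nonneg_left h2 hy.le]

end JMS

end FacilityLocation

namespace FacilityLocation

/-! ### Clustering and rounding -/

section Rounding

variable {F C X : Type*} [PseudoMetricSpace X] [Fintype F] [DecidableEq F]
  {I : Instance F C X} {x : F → C → ℝ} {y : F → ℝ} {γ : ℝ}

theorem Splitting.close_nonempty (P : Splitting I x y γ) (j : C) : (P.close j).Nonempty := by
  rw [Finset.nonempty_iff_ne_empty]
  intro h
  have := P.sum_close j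
  simp [h] at this

variable [DecidableEq C]

theorem Splitting.Clustering.mem {P : Splitting I x y γ} {U : Finset C} {L : List C}
    (h : P.Clustering U L) : ∀ c ∈ L, c ∈ U := by
  induction h with
  | done => simp
  | step U j rest mem least tail ih =>
    intro c hc
    rcases List.mem_cons.1 hc with rfl | hc
    · exact mem
    · exact (Finset.mem_filter.1 (ih c hc)).1

theorem Splitting.Clustering.pairwise {P : Splitting I x y γ} {U : Finset C} {L : List C}
    (h : P.Clustering U L) : L.Pairwise fun c c' => Disjoint (P.close c) (P.close c') := by
  induction h with
  | done => exact List.Pairwise.nil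
  | step U j rest mem least tail ih =>
    exact List.Pairwise.cons (fun c hc => (Finset.mem_filter.1 (tail.mem c hc)).2) ih

/-- Every client shares a close copy with some center of at most the same `key`. -/
theorem Splitting.Clustering.exists_center {P : Splitting I x y γ} {U : Finset C} {L : List C}
    (h : P.Clustering U L) : ∀ j ∈ U, ∃ c ∈ L, ¬ Disjoint (P.close c) (P.close j) ∧
      P.key c ≤ P.key j := by
  induction h with
  | done => simp
  | step U j rest mem least tail ih =>
    intro j' hj'
    by_cases hd : Disjoint (P.close j) (P.close j')
    · obtain ⟨c, hc, h⟩ := ih j' (Finset.mem_filter.2 ⟨hj', hd⟩)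
      exact ⟨c, List.mem_cons_of_mem _ hc, h⟩
    · exact ⟨j, List.mem_cons_self, hd, least j' hj'⟩

theorem Splitting.exists_clustering (P : Splitting I x y γ) (U : Finset C) :
    ∃ L, P.Clustering U L := by
  induction U using Finset.strongInduction with
  | H U ih =>
    rcases U.eq_empty_or_nonempty with rfl | hU
    · exact ⟨[], .done⟩
    obtain ⟨j, hj, hmin⟩ := U.exists_min_image P.key hU
    obtain ⟨L, hL⟩ := ih {j' ∈ U | Disjoint (P.close j) (P.close j')} (by
      refine (Finset.filter_ssubset).2 ⟨j, hj, fun h => ?_⟩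
      exact (P.close_nonempty j).ne_empty (disjoint_self.1 h))
    exact ⟨j :: L, .step U j L hj hmin hL⟩

variable [Fintype C]

theorem CSRun.close_disjoint (R : CSRun I x y γ) {c c' : C} (hc : c ∈ R.centers)
    (hc' : c' ∈ R.centers) (h : c ≠ c') : Disjoint (R.close c) (R.close c') :=
  haveI : Std.Symm fun c c' => Disjoint (R.close c) (R.close c') := ⟨fun _ _ h => h.symm⟩
  R.clustering.pairwise.forall hc hc' h

theorem CSRun.mem_close_of_prob_ne_zero (R : CSRun I x y γ) {ω : R.Sample} (h : R.prob ω ≠ 0)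
    (j : C) : ω.1 j ∈ R.close j := by
  by_contra hj
  refine h (mul_eq_zero_of_left (Finset.prod_eq_zero (Finset.mem_univ j) ?_) _)
  rw [if_neg hj]

/-- The expectation of a product of functions of the independent choices. -/
theorem CSRun.sum_prob_mul_prod (R : CSRun I x y γ) (G : C → Fin R.m → ℝ)
    (H : Fin R.m → Bool → ℝ) :
    ∑ ω, R.prob ω * ((∏ j, G j (ω.1 j)) * ∏ a, H a (ω.2 a)) =
      (∏ j, ∑ a ∈ R.close j, R.w a * G j a) *
        ∏ a, (R.w a * H a true + (1 - R.w a) * H a false) := by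
  have h1 : ∏ j, ∑ a ∈ R.close j, R.w a * G j a =
      ∑ u : C → Fin R.m, ∏ j, (if u j ∈ R.close j then R.w (u j) else 0) * G j (u j) := by
    rw [← Fintype.prod_sum (fun j a => (if a ∈ R.close j then R.w a else 0) * G j a)]
    refine Finset.prod_congr rfl fun j _ => ?_
    simp only [ite_mul, zero_mul]
    rw [Finset.sum_ite_mem, Finset.univ_inter]
  have h2 : ∏ a, (R.w a * H a true + (1 - R.w a) * H a false) =
      ∑ v : Fin R.m → Bool, ∏ a, (if v a = true then R.w a else 1 - R.w a) * H a (v a) := by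
    rw [← Fintype.prod_sum (fun a (b : Bool) => (if b = true then R.w a else 1 - R.w a) * H a b)]
    refine Finset.prod_congr rfl fun a _ => ?_
    simp
  rw [h1, h2, Finset.sum_mul_sum, Fintype.sum_prod_type]
  refine Finset.sum_congr rfl fun u _ => Finset.sum_congr rfl fun v _ => ?_
  simp only [CSRun.prob, Finset.prod_mul_distrib]
  ring

theorem CSRun.sum_prob_mul_choice (R : CSRun I x y γ) (c : C) (g : Fin R.m → ℝ) :
    ∑ ω, R.prob ω * g (ω.1 c) = ∑ a ∈ R.close c, R.w a * g a := by
  have h := R.sum_prob_mul_prod (fun j u => if j = c then g u else 1) fun _ _ => 1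
  have h1 : ∀ j, ∑ a ∈ R.close j, R.w a * (if j = c then g a else 1) =
      if j = c then ∑ a ∈ R.close c, R.w a * g a else 1 := by
    intro j
    split_ifs with hj
    · rw [hj]
    · simp [R.sum_close]
  simp only [h1, Finset.prod_ite_eq', Finset.mem_univ, if_true, Finset.prod_const_one, mul_one,
    add_sub_cancel] at h
  simpa using h

theorem CSRun.sum_prob_mul_coin (R : CSRun I x y γ) (a : Fin R.m) :
    ∑ ω, R.prob ω * (if ω.2 a = true then 1 else 0) = R.w a := by
  have h := R.sum_prob_mul_prod (fun _ _ => 1)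
    fun b v => if b = a then (if v = true then 1 else 0) else 1
  have h1 : ∏ b, (R.w b * (if b = a then (if true = true then 1 else 0) else 1) +
      (1 - R.w b) * (if b = a then (if false = true then 1 else 0) else 1)) = R.w a := by
    rw [Finset.prod_eq_single a (fun b _ hb => by simp [hb]) (by simp)]
    simp
  rw [h1] at h
  simpa [R.sum_close] using h

/-- Copy `a` is opened with probability at most `w a`. -/
theorem CSRun.sum_prob_mul_opened (R : CSRun I x y γ) (a : Fin R.m) :
    ∑ ω, R.prob ω * (if a ∈ R.openedCopies ω then 1 else 0) ≤ R.w a := by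
  by_cases ha : ∃ c ∈ R.centers, a ∈ R.close c
  · obtain ⟨c, hc, hac⟩ := ha
    have h := R.sum_prob_mul_choice c fun b => if b = a then 1 else 0
    simp only [mul_ite, mul_one, mul_zero, Finset.sum_ite_eq', hac, if_true] at h
    rw [← h]
    refine Finset.sum_le_sum fun ω _ => ?_
    rcases eq_or_ne (R.prob ω) 0 with h0 | h0
    · simp [h0]
    by_cases ho : a ∈ R.openedCopies ω
    · have : ω.1 c = a := by
        rcases Finset.mem_union.1 ho with h1 | h1
        · obtain ⟨c', hc', h2⟩ := Finset.mem_image.1 h1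
          have h3 := R.mem_close_of_prob_ne_zero h0 c'
          rw [h2] at h3
          by_contra h4
          have : c ≠ c' := by rintro rfl; exact h4 h2
          exact Finset.disjoint_left.1
            (R.close_disjoint hc (List.mem_toFinset.1 hc') this) hac h3
        · exact absurd hac ((Finset.mem_filter.1 h1).2.2 c hc)
      simp [this, ho]
    · simp only [ho, if_false, mul_zero]
      split_ifs
      exacts [R.prob_nonneg ω, le_rfl]
  · push Not at ha
    rw [← R.sum_prob_mul_coin a]
    refine Finset.sum_le_sum fun ω _ => ?_
    rcases eq_or_ne (R.prob ω) 0 with h0 | h0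
    · simp [h0]
    refine mul_le_mul_of_nonneg_left ?_ (R.prob_nonneg ω)
    by_cases ho : a ∈ R.openedCopies ω
    · have : ω.2 a = true := by
        rcases Finset.mem_union.1 ho with h1 | h1
        · obtain ⟨c', hc', h2⟩ := Finset.mem_image.1 h1
          exact absurd (h2 ▸ R.mem_close_of_prob_ne_zero h0 c') (ha c' (List.mem_toFinset.1 hc'))
        · exact (Finset.mem_filter.1 h1).2.1
      simp [this, ho]
    · simp only [ho, if_false]
      split_ifs <;> norm_num

theorem CSRun.expected_openCost_le (R : CSRun I x y γ) :
    ∑ ω, R.prob ω * ∑ i ∈ R.opened ω, I.openCost i ≤ γ * ∑ i, y i * I.openCost i := by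
  calc ∑ ω, R.prob ω * ∑ i ∈ R.opened ω, I.openCost i
      ≤ ∑ ω, R.prob ω * ∑ a, (if a ∈ R.openedCopies ω then 1 else 0) * I.openCost (R.orig a) := by
        refine Finset.sum_le_sum fun ω _ => mul_le_mul_of_nonneg_left ?_ (R.prob_nonneg ω)
        simp only [ite_mul, one_mul, zero_mul]
        rw [Finset.sum_ite_mem, Finset.univ_inter]
        exact Finset.sum_image_le_of_nonneg (f := I.openCost) fun a _ => I.openCost_nonneg _
    _ = ∑ a, (∑ ω, R.prob ω * (if a ∈ R.openedCopies ω then 1 else 0)) * I.openCost (R.orig a) := by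
        simp only [Finset.mul_sum, Finset.sum_mul]
        rw [Finset.sum_comm]
        exact Finset.sum_congr rfl fun a _ => Finset.sum_congr rfl fun ω _ => by ring
    _ ≤ ∑ a, R.w a * I.openCost (R.orig a) := Finset.sum_le_sum fun a _ =>
        mul_le_mul_of_nonneg_right (R.sum_prob_mul_opened a) (I.openCost_nonneg _)
    _ = ∑ i, ∑ a with R.orig a = i, R.w a * I.openCost (R.orig a) :=
        (Finset.sum_fiberwise _ _ _).symm
    _ = γ * ∑ i, y i * I.openCost i := by
        rw [Finset.mul_sum]
        refine Finset.sum_congr rfl fun i _ => ?_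
        rw [← mul_assoc, ← R.sum_orig i, Finset.sum_mul]
        exact Finset.sum_congr rfl fun a ha => by rw [(Finset.mem_filter.1 ha).2]

/-- The copies in a set `S` that contains no close copy of the center `c` all stay closed with
probability at most `exp (- w(S))`, independently of the choice of `c`. -/
theorem CSRun.sum_prob_mul_closed_le (R : CSRun I x y γ) (c : C)
    (S : Finset (Fin R.m)) (hS : Disjoint S (R.close c)) (g : Fin R.m → ℝ) (hg : ∀ a, 0 ≤ g a) :
    ∑ ω, R.prob ω * (if ∀ a ∈ S, a ∉ R.openedCopies ω then g (ω.1 c) else 0) ≤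
      (∑ a ∈ R.close c, R.w a * g a) * Real.exp (-∑ a ∈ S, R.w a) := by
  set free : Fin R.m → Prop := fun a => ∀ j ∈ R.centers, a ∉ R.close j with hfree
  set G : C → Fin R.m → ℝ := fun j u =>
    if j = c then g u else if j ∈ R.centers then (if u ∈ S then 0 else 1) else 1 with hG
  classical
  set H : Fin R.m → Bool → ℝ := fun a v => if a ∈ S ∧ free a then (if v = true then 0 else 1) else 1
    with hH
  have G_nonneg : ∀ j u, 0 ≤ G j u := by
    intro j u
    simp only [hG]
    split_ifs
    exacts [hg u, le_rfl, zero_le_one, zero_le_one]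
  have H_nonneg : ∀ a v, 0 ≤ H a v := by
    intro a v
    simp only [hH]
    split_ifs <;> norm_num
  have step : ∑ ω, R.prob ω * (if ∀ a ∈ S, a ∉ R.openedCopies ω then g (ω.1 c) else 0) ≤
      ∑ ω, R.prob ω * ((∏ j, G j (ω.1 j)) * ∏ a, H a (ω.2 a)) := by
    refine Finset.sum_le_sum fun ω _ => mul_le_mul_of_nonneg_left ?_ (R.prob_nonneg ω)
    split_ifs with h
    · have h1 : ∏ j, G j (ω.1 j) = g (ω.1 c) := by
        rw [Finset.prod_eq_single c (fun j _ hj => ?_) (by simp)]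
        · simp [hG]
        · simp only [hG, hj, if_false]
          split_ifs with h2 h3
          · exact absurd (Finset.mem_union_left _
              (Finset.mem_image_of_mem _ (List.mem_toFinset.2 h2))) (h _ h3)
          · rfl
          · rfl
      have h2 : ∏ a, H a (ω.2 a) = 1 := by
        refine Finset.prod_eq_one fun a _ => ?_
        simp only [hH]
        split_ifs with h2 h3
        · exact absurd (Finset.mem_union_right _ (Finset.mem_filter.2
            ⟨Finset.mem_univ a, h3, h2.2⟩)) (h a h2.1)
        · rfl
        · rfl
      rw [h1, h2, mul_one]
    · exact mul_nonneg (Finset.prod_nonneg fun j _ => G_nonneg _ _)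
        (Finset.prod_nonneg fun a _ => H_nonneg _ _)
  refine step.trans ?_
  rw [R.sum_prob_mul_prod]
  set z : C → ℝ := fun j => if j = c then 0 else if j ∈ R.centers then
    ∑ a ∈ R.close j, (if a ∈ S then R.w a else 0) else 0 with hz
  set z' : Fin R.m → ℝ := fun a => if a ∈ S ∧ free a then R.w a else 0 with hz'
  have A_nonneg : 0 ≤ ∑ a ∈ R.close c, R.w a * g a :=
    Finset.sum_nonneg fun a _ => mul_nonneg (R.w_pos a).le (hg a)
  have h1 : ∏ j, ∑ a ∈ R.close j, R.w a * G j a ≤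
      (∑ a ∈ R.close c, R.w a * g a) * Real.exp (-∑ j, z j) := by
    rw [← Finset.sum_neg_distrib, Real.exp_sum, ← Finset.mul_prod_erase _ _ (Finset.mem_univ c),
      ← Finset.mul_prod_erase _ (fun j => Real.exp (-z j)) (Finset.mem_univ c)]
    have h0 : ∑ a ∈ R.close c, R.w a * G c a = ∑ a ∈ R.close c, R.w a * g a := by simp [hG]
    have h0' : Real.exp (-z c) = 1 := by simp [hz]
    rw [h0, h0', one_mul]
    refine mul_le_mul_of_nonneg_left (Finset.prod_le_prod (fun j _ => Finset.sum_nonneg fun a _ =>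
      mul_nonneg (R.w_pos a).le (G_nonneg _ _)) fun j hj => ?_) A_nonneg
    have hjc := (Finset.mem_erase.1 hj).1
    refine le_trans (le_of_eq ?_) (Real.one_sub_le_exp_neg (z j))
    by_cases hj' : j ∈ R.centers
    · simp only [hG, hz, hjc, hj', if_false, if_true]
      have : (1 : ℝ) = ∑ a ∈ R.close j, R.w a := (R.sum_close j).symm
      nth_rewrite 2 [this]
      rw [← Finset.sum_sub_distrib]
      refine Finset.sum_congr rfl fun a _ => ?_
      split_ifs <;> ring
    · simp [hG, hz, hjc, hj', R.sum_close]
  have h2 : ∏ a, (R.w a * H a true + (1 - R.w a) * H a false) ≤ Real.exp (-∑ a, z' a) := by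
    rw [← Finset.sum_neg_distrib, Real.exp_sum]
    refine Finset.prod_le_prod (fun a _ => add_nonneg (mul_nonneg (R.w_pos a).le (H_nonneg _ _))
      (mul_nonneg (by linarith [R.w_le_one a]) (H_nonneg _ _))) fun a _ => ?_
    refine le_trans (le_of_eq ?_) (Real.one_sub_le_exp_neg (z' a))
    simp only [hH, hz']
    split_ifs <;> simp_all
  have h3 : ∑ a ∈ S, R.w a ≤ ∑ j, z j + ∑ a, z' a := by
    have : ∀ j, z j = ∑ a, (if a ∈ S ∧ j ≠ c ∧ j ∈ R.centers ∧ a ∈ R.close j then R.w a else 0) := by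
      intro j
      simp only [hz]
      by_cases h1 : j = c
      · simp [h1]
      by_cases h2 : j ∈ R.centers
      · simp only [h1, h2, if_false, if_true, ne_eq, not_false_eq_true, true_and]
        rw [← Finset.univ_inter (R.close j), ← Finset.sum_ite_mem]
        refine Finset.sum_congr rfl fun a _ => ?_
        by_cases ha : a ∈ R.close j <;> by_cases ha' : a ∈ S <;> simp [ha, ha']
      · simp [h1, h2]
    have hS' : ∑ a ∈ S, R.w a = ∑ a, if a ∈ S then R.w a else 0 := by
      rw [Finset.sum_ite_mem, Finset.univ_inter]
    rw [hS', Finset.sum_congr rfl fun j _ => this j, Finset.sum_comm, ← Finset.sum_add_distrib]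
    refine Finset.sum_le_sum fun a _ => ?_
    have nonneg : ∀ j, 0 ≤ if a ∈ S ∧ j ≠ c ∧ j ∈ R.centers ∧ a ∈ R.close j then R.w a else 0 := by
      intro j
      split_ifs
      exacts [(R.w_pos a).le, le_rfl]
    by_cases ha : a ∈ S
    · by_cases hf : free a
      · have h4 : z' a = R.w a := by simp [hz', ha, hf]
        rw [if_pos ha, h4]
        exact le_add_of_nonneg_left (Finset.sum_nonneg fun j _ => nonneg j)
      · have hf' : ∃ j ∈ R.centers, a ∈ R.close j := by
          simp only [hfree] at hf
          push Not at hf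
          exact hf
        obtain ⟨j, hj, haj⟩ := hf'
        have hjc : j ≠ c := by
          rintro rfl
          exact Finset.disjoint_left.1 hS ha haj
        have := Finset.single_le_sum (fun j _ => nonneg j) (Finset.mem_univ j)
        rw [if_pos ⟨ha, hjc, hj, haj⟩] at this
        simpa [hz', ha, hf] using this
    · simp only [ha, if_false]
      refine add_nonneg (Finset.sum_nonneg fun j _ => ?_) ?_ <;> simp [hz', ha]
  calc (∏ j, ∑ a ∈ R.close j, R.w a * G j a) *
        ∏ a, (R.w a * H a true + (1 - R.w a) * H a false)
      ≤ ((∑ a ∈ R.close c, R.w a * g a) * Real.exp (-∑ j, z j)) * Real.exp (-∑ a, z' a) :=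
        mul_le_mul h1 h2 (Finset.prod_nonneg fun a _ => add_nonneg
          (mul_nonneg (R.w_pos a).le (H_nonneg _ _))
          (mul_nonneg (by linarith [R.w_le_one a]) (H_nonneg _ _)))
          (mul_nonneg A_nonneg (Real.exp_nonneg _))
    _ = (∑ a ∈ R.close c, R.w a * g a) * Real.exp (-(∑ j, z j + ∑ a, z' a)) := by
        rw [mul_assoc, ← Real.exp_add]
        congr 2
        ring
    _ ≤ _ := mul_le_mul_of_nonneg_left (Real.exp_le_exp.2 (neg_le_neg h3)) A_nonneg

end Rounding

end FacilityLocation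

namespace FacilityLocation

/-! ### The expected connection cost of the Chudak–Shmoys algorithm -/

theorem integral_ite_lt (f : ℝ → ℝ) {L B : ℝ} (h0 : 0 ≤ L) (hB : L ≤ B) :
    ∫ ρ in (0 : ℝ)..B, (if ρ < L then f ρ else 0) = ∫ ρ in (0 : ℝ)..L, f ρ := by
  rw [← intervalIntegral.integral_indicator ⟨h0, hB⟩]
  refine intervalIntegral.integral_congr_ae ?_
  filter_upwards [MeasureTheory.compl_mem_ae_iff.2
    (MeasureTheory.measure_singleton (μ := MeasureTheory.volume) L)] with ρ hρ _
  have hρ' : ρ ≠ L := hρ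
  simp only [Set.indicator, Set.mem_ofPred_eq, lt_iff_le_and_ne, hρ', ne_eq, not_false_eq_true,
    and_true]

theorem integral_ite_lt_one {L B : ℝ} (h0 : 0 ≤ L) (hB : L ≤ B) :
    ∫ ρ in (0 : ℝ)..B, (if ρ < L then (1 : ℝ) else 0) = L := by
  rw [integral_ite_lt (fun _ => 1) h0 hB]
  simp

theorem antitone_ite_lt {f : ℝ → ℝ} (hf : Antitone f) (h0 : ∀ ρ, 0 ≤ f ρ) (L : ℝ) :
    Antitone fun ρ => if ρ < L then f ρ else 0 := by
  intro ρ ρ' h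
  change (if ρ' < L then f ρ' else 0) ≤ (if ρ < L then f ρ else 0)
  split_ifs with h1 h2 h2
  · exact hf h
  · exact absurd (h.trans_lt h1) h2
  · exact h0 ρ
  · exact le_rfl

theorem intervalIntegrable_sum {ι : Type*} {s : Finset ι} {f : ι → ℝ → ℝ} {a b : ℝ}
    (h : ∀ i ∈ s, IntervalIntegrable (f i) MeasureTheory.volume a b) :
    IntervalIntegrable (fun t => ∑ i ∈ s, f i t) MeasureTheory.volume a b := by
  have h' := IntervalIntegrable.sum s h
  have e : ∑ i ∈ s, f i = fun t => ∑ i ∈ s, f i t := by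
    ext t
    rw [Finset.sum_apply]
  rwa [e] at h'

section Rounding

variable {F C X : Type*} [PseudoMetricSpace X] [Fintype F]

/-- The extent to which client `j` is served by the facilities within distance `ρ`. -/
noncomputable def Instance.reach (I : Instance F C X) (x : F → C → ℝ) (j : C) (ρ : ℝ) : ℝ :=
  ∑ i with I.d i j ≤ ρ, x i j

variable [DecidableEq F] {I : Instance F C X} {x : F → C → ℝ} {y : F → ℝ} {γ : ℝ}

theorem Splitting.sum_nbhd_mul (P : Splitting I x y γ) (j : C) (g : F → ℝ) :
    ∑ a ∈ P.nbhd j, P.w a * g (P.orig a) = γ * ∑ i, x i j * g i := by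
  rw [← Finset.sum_fiberwise (P.nbhd j) P.orig, Finset.mul_sum]
  refine Finset.sum_congr rfl fun i _ => ?_
  rw [← mul_assoc, ← P.sum_nbhd i j, Finset.sum_mul]
  exact Finset.sum_congr rfl fun a ha => by rw [(Finset.mem_filter.1 ha).2]

theorem Splitting.sum_nbhd_reach (P : Splitting I x y γ) (j : C) (ρ : ℝ) :
    ∑ a ∈ P.nbhd j with I.d (P.orig a) j ≤ ρ, P.w a = γ * I.reach x j ρ := by
  have := P.sum_nbhd_mul j fun i => if I.d i j ≤ ρ then 1 else 0
  simp only [mul_ite, mul_one, mul_zero] at this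
  rw [Finset.sum_filter, this, Instance.reach, Finset.sum_filter]

/-- The maximal distance from client `j` to its close copies. -/
noncomputable def Splitting.maxClose (P : Splitting I x y γ) (j : C) : ℝ :=
  ⨆ a : P.close j, I.d (P.orig a) j

theorem Splitting.le_maxClose (P : Splitting I x y γ) {j : C} {a : Fin P.m} (ha : a ∈ P.close j) :
    I.d (P.orig a) j ≤ P.maxClose j :=
  le_ciSup (f := fun a : P.close j => I.d (P.orig a) j) (Set.finite_range _).bddAbove ⟨a, ha⟩

theorem Splitting.maxClose_le (P : Splitting I x y γ) {j : C} {b : ℝ}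
    (h : ∀ a ∈ P.close j, I.d (P.orig a) j ≤ b) : P.maxClose j ≤ b := by
  have : Nonempty (P.close j) := (P.close_nonempty j).to_subtype
  exact ciSup_le fun a => h a a.2

theorem Splitting.maxClose_le_distant (P : Splitting I x y γ) {j : C} {b : Fin P.m}
    (hb : b ∈ P.nbhd j \ P.close j) : P.maxClose j ≤ I.d (P.orig b) j :=
  P.maxClose_le fun a ha => P.close_le j a ha b (Finset.mem_sdiff.1 hb).1 (Finset.mem_sdiff.1 hb).2

/-- The total excess of the distances of client `j` to its distant copies over the maximal distance
to its close copies. -/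
noncomputable def Splitting.excess (P : Splitting I x y γ) (j : C) : ℝ :=
  ∑ a ∈ P.nbhd j \ P.close j, P.w a * (I.d (P.orig a) j - P.maxClose j)

theorem Splitting.excess_nonneg (P : Splitting I x y γ) (j : C) : 0 ≤ P.excess j :=
  Finset.sum_nonneg fun a ha =>
    mul_nonneg (P.w_pos a).le (sub_nonneg.2 (P.maxClose_le_distant ha))

/-- The copies through which client `j` can be served by a center `c` with which it shares a close
copy, apart from those that serve `j` anyway and are within distance `K` of `j`, have average
distance at most `K` from `j`, if `K` is not too small. -/
theorem Splitting.sum_fallback_le (P : Splitting I x y γ) {c j : C}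
    (hshare : ¬ Disjoint (P.close c) (P.close j)) (hkey : P.key c ≤ P.key j) {K : ℝ}
    (hK : P.excess j + P.maxClose j + P.key j ≤ K) :
    ∑ a ∈ P.close c with ¬ (a ∈ P.nbhd j ∧ I.d (P.orig a) j ≤ K),
      P.w a * (I.d (P.orig a) j - K) ≤ 0 := by
  set far := {a ∈ P.close c | ¬ (a ∈ P.nbhd j ∧ I.d (P.orig a) j ≤ K)} with hfar
  set near := {a ∈ P.close c | (a ∈ P.nbhd j ∧ I.d (P.orig a) j ≤ K)} with hnear
  set D := dist (I.client j) (I.client c) with hD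
  set E := P.excess j with hE
  set M := P.maxClose j with hM
  set M' := P.maxClose c with hM'
  set av := ∑ a ∈ P.close c, P.w a * I.d (P.orig a) c with hav
  have hkeyc : P.key c = av + M' := rfl
  set β := ∑ a ∈ far, P.w a with hβ
  set S := ∑ a ∈ far, P.w a * I.d (P.orig a) c with hS
  have E_nonneg : 0 ≤ E := P.excess_nonneg j
  have hβ0 : 0 ≤ β := Finset.sum_nonneg fun a _ => (P.w_pos a).le
  have hsum : ∑ a ∈ near, P.w a + β = 1 := by
    rw [← P.sum_close c]
    exact Finset.sum_filter_add_sum_filter_not _ _ _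
  have hβ1 : β ≤ 1 := by
    have : 0 ≤ ∑ a ∈ near, P.w a := Finset.sum_nonneg fun a _ => (P.w_pos a).le
    linarith
  have hav_split : ∑ a ∈ near, P.w a * I.d (P.orig a) c + S = av :=
    Finset.sum_filter_add_sum_filter_not _ _ _
  have tri1 : ∀ a, I.d (P.orig a) j ≤ D + I.d (P.orig a) c := by
    intro a
    have := dist_triangle (I.facility (P.orig a)) (I.client c) (I.client j)
    rw [dist_comm (I.client c)] at this
    unfold Instance.d
    linarith
  have tri2 : ∀ a, D ≤ I.d (P.orig a) j + I.d (P.orig a) c := by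
    intro a
    have := dist_triangle (I.client j) (I.facility (P.orig a)) (I.client c)
    rw [dist_comm (I.client j) (I.facility _)] at this
    exact this
  have hS_le : S ≤ β * M' := by
    rw [hβ, Finset.sum_mul]
    exact Finset.sum_le_sum fun a ha => mul_le_mul_of_nonneg_left
      (P.le_maxClose (Finset.mem_filter.1 ha).1) (P.w_pos a).le
  have hgoal : ∑ a ∈ far, P.w a * (I.d (P.orig a) j - K) ≤ β * D + S - β * K := by
    rw [hβ, hS, Finset.sum_mul, Finset.sum_mul, ← Finset.sum_add_distrib, ← Finset.sum_sub_distrib]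
    exact Finset.sum_le_sum fun a _ => by nlinarith [tri1 a, P.w_pos a]
  have hKβ : β * (E + M + (av + M')) ≤ β * K :=
    mul_le_mul_of_nonneg_left (by linarith) hβ0
  refine hgoal.trans ?_
  rcases le_or_gt D (M + E + av) with hcase | hcase
  · nlinarith
  -- the center is far from `j`, so that the copies serving `j` are far from the center
  have hDM : D ≤ M + M' := by
    obtain ⟨a, ha, ha'⟩ := Finset.not_disjoint_iff.1 hshare
    linarith [tri2 a, P.le_maxClose ha, P.le_maxClose ha']
  have hnear_le : (D - M) * (1 - β) - E ≤ ∑ a ∈ near, P.w a * I.d (P.orig a) c := by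
    have h1 : ∑ a ∈ near, (if a ∈ P.close j then 0 else P.w a * (I.d (P.orig a) j - M)) ≤ E := by
      have h0 : ∑ a ∈ near, (if a ∈ P.close j then 0 else P.w a * (I.d (P.orig a) j - M)) =
          ∑ a ∈ near with a ∉ P.close j, P.w a * (I.d (P.orig a) j - M) := by
        refine Eq.trans ?_ (Finset.sum_filter (s := near) (· ∉ P.close j) _).symm
        exact Finset.sum_congr rfl fun a _ => by by_cases h : a ∈ P.close j <;> simp [h]
      rw [h0, hE]
      refine Finset.sum_le_sum_of_subset_of_nonneg ?_ fun a ha _ =>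
        mul_nonneg (P.w_pos a).le (sub_nonneg.2 (P.maxClose_le_distant ha))
      intro a ha
      rw [Finset.mem_filter] at ha
      exact Finset.mem_sdiff.2 ⟨(Finset.mem_filter.1 ha.1).2.1, ha.2⟩
    have h2 : (D - M) * (1 - β) = ∑ a ∈ near, P.w a * (D - M) := by
      rw [← Finset.sum_mul, ← hsum]; ring
    rw [h2]
    have h3 : ∑ a ∈ near, P.w a * (D - M) ≤ ∑ a ∈ near, (P.w a * I.d (P.orig a) c +
        if a ∈ P.close j then 0 else P.w a * (I.d (P.orig a) j - M)) := by
      refine Finset.sum_le_sum fun a _ => ?_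
      split_ifs with h
      · nlinarith [tri2 a, P.le_maxClose h, P.w_pos a]
      · nlinarith [tri2 a, P.w_pos a]
    rw [Finset.sum_add_distrib] at h3
    linarith
  nlinarith [mul_nonneg (sub_nonneg.2 hβ1) (by linarith : 0 ≤ D - M - (E + av)),
    mul_nonneg hβ0 (by linarith : 0 ≤ M + M' - D)]

variable [Fintype C] [DecidableEq C]

/-- The distance to a closest open facility is at most the length of the set of radii within which
no copy serving `j` is open, cut off at the distance to the copy chosen by the center `c`. -/
theorem CSRun.infDist_opened_le (R : CSRun I x y γ) (ω : R.Sample) {c : C} (hc : c ∈ R.centers)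
    (j : C) {B : ℝ} (hB : ∀ i, I.d i j ≤ B) (S : ℝ → Finset (Fin R.m)) (hS : Monotone S)
    (hSd : ∀ ρ, ∀ a ∈ S ρ, I.d (R.orig a) j ≤ ρ) :
    (Antitone fun ρ => if ∀ a ∈ S ρ, a ∉ R.openedCopies ω then
        (if ρ < I.d (R.orig (ω.1 c)) j then (1 : ℝ) else 0) else 0) ∧
    Metric.infDist (I.client j) (I.facility '' (R.opened ω : Set F)) ≤
      ∫ ρ in (0 : ℝ)..B, if ∀ a ∈ S ρ, a ∉ R.openedCopies ω then
        (if ρ < I.d (R.orig (ω.1 c)) j then (1 : ℝ) else 0) else 0 := by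
  have anti : Antitone fun ρ => if ∀ a ∈ S ρ, a ∉ R.openedCopies ω then
      (if ρ < I.d (R.orig (ω.1 c)) j then (1 : ℝ) else 0) else 0 := by
    intro ρ ρ' h
    change (if _ then _ else _) ≤ (if _ then _ else _)
    split_ifs with h1 h2 h3 h4 h5 h6 h7 <;> try norm_num
    · exact h4 (h.trans_lt h2)
    · exact h3 fun a ha => h1 a (hS h ha)
  refine ⟨anti, ?_⟩
  set L := Metric.infDist (I.client j) (I.facility '' (R.opened ω : Set F)) with hL
  have L_le : ∀ a ∈ R.openedCopies ω, L ≤ I.d (R.orig a) j := by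
    intro a ha
    rw [Instance.d, dist_comm]
    exact Metric.infDist_le_dist_of_mem
      ⟨R.orig a, Finset.mem_coe.2 (Finset.mem_image_of_mem _ ha), rfl⟩
  have hLc : L ≤ I.d (R.orig (ω.1 c)) j := L_le _ (Finset.mem_union_left _
    (Finset.mem_image_of_mem _ (List.mem_toFinset.2 hc)))
  have hL0 : 0 ≤ L := Metric.infDist_nonneg
  have hLB : L ≤ B := hLc.trans (hB _)
  rw [← integral_ite_lt_one hL0 hLB]
  refine intervalIntegral.integral_mono_on (hL0.trans hLB)
    (antitone_ite_lt antitone_const (fun _ => zero_le_one) L).intervalIntegrable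
    anti.intervalIntegrable fun ρ _ => ?_
  by_cases hρ : ρ < L
  · have h1 : ∀ a ∈ S ρ, a ∉ R.openedCopies ω := fun a ha ha' =>
      absurd ((L_le a ha').trans (hSd ρ a ha)) (not_le.2 hρ)
    rw [if_pos hρ, if_pos h1, if_pos (hρ.trans_le hLc)]
  · rw [if_neg hρ]
    split_ifs <;> norm_num

/-- The expected connection cost of client `j`, whose center is `c`, is at most what it would be if
all copies serving `j` were opened independently in infinitesimal pieces, and if `j` could be
connected at cost `K` whenever that is cheaper. -/
theorem CSRun.expected_dist_le (R : CSRun I x y γ) {c j : C} (hc : c ∈ R.centers)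
    (hshare : ¬ Disjoint (R.close c) (R.close j)) (hkey : R.key c ≤ R.key j) {K B : ℝ}
    (hK : R.excess j + R.maxClose j + R.key j ≤ K) (hK0 : 0 ≤ K) (hKB : K ≤ B)
    (hB : ∀ i, I.d i j ≤ B) (hγ : 0 ≤ γ) (hx : ∀ i j, 0 ≤ x i j) :
    ∑ ω, R.prob ω * Metric.infDist (I.client j) (I.facility '' (R.opened ω : Set F)) ≤
      ∫ ρ in (0 : ℝ)..B, if ρ < K then Real.exp (-(γ * I.reach x j ρ)) else 0 := by
  set δ : Fin R.m → ℝ := fun a => I.d (R.orig a) j with hδ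
  set S : ℝ → Finset (Fin R.m) := fun ρ => {a ∈ R.nbhd j \ R.close c | δ a ≤ ρ} with hS
  have S_mono : Monotone S := fun ρ ρ' h =>
    Finset.monotone_filter_right _ fun a _ ha => le_trans ha h
  have S_dist : ∀ ρ, ∀ a ∈ S ρ, δ a ≤ ρ := fun ρ a ha => (Finset.mem_filter.1 ha).2
  set T : ℝ → ℝ := fun ρ => Real.exp (-∑ a ∈ S ρ, R.w a) with hT
  have T_anti : Antitone T := fun ρ ρ' h => Real.exp_le_exp.2 (neg_le_neg
    (Finset.sum_le_sum_of_subset_of_nonneg (S_mono h) fun a _ _ => (R.w_pos a).le))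
  have T_nonneg : ∀ ρ, 0 ≤ T ρ := fun ρ => Real.exp_nonneg _
  have reach_mono : Monotone (I.reach x j) := fun ρ ρ' h =>
    Finset.sum_le_sum_of_subset_of_nonneg
      (Finset.monotone_filter_right _ fun a _ ha => le_trans ha h) fun i _ _ => hx i j
  have exp_anti : Antitone fun ρ => Real.exp (-(γ * I.reach x j ρ)) := fun ρ ρ' h =>
    Real.exp_le_exp.2 (neg_le_neg (mul_le_mul_of_nonneg_left (reach_mono h) hγ))
  set far := {a ∈ R.close c | ¬ (a ∈ R.nbhd j ∧ δ a ≤ K)} with hfar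
  have hB0 : 0 ≤ B := hK0.trans hKB
  have ind_int : ∀ L : ℝ, IntervalIntegrable (fun ρ => if ρ < L then (1 : ℝ) else 0)
      MeasureTheory.volume 0 B := fun L =>
    (antitone_ite_lt antitone_const (fun _ => zero_le_one) L).intervalIntegrable
  -- the bound for a single radius
  have pointwise : ∀ ρ, (∑ a ∈ R.close c, R.w a * (if ρ < δ a then (1 : ℝ) else 0)) * T ρ ≤
      (if ρ < K then Real.exp (-(γ * I.reach x j ρ)) else 0) +
        T K * ∑ a ∈ far, R.w a * ((if ρ < δ a then (1 : ℝ) else 0) - if ρ < K then 1 else 0) := by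
    intro ρ
    rw [← Finset.sum_filter_add_sum_filter_not (R.close c) fun a => a ∈ R.nbhd j ∧ δ a ≤ K]
    by_cases hρ : ρ < K
    · simp only [hρ, if_true]
      set b := ∑ a ∈ R.close c with a ∈ R.nbhd j ∧ δ a ≤ ρ, R.w a with hb
      have h1 : ∑ a ∈ R.close c with a ∈ R.nbhd j ∧ δ a ≤ K,
          R.w a * (if ρ < δ a then (1 : ℝ) else 0) + ∑ a ∈ far, R.w a = 1 - b := by
        suffices h : ∑ a ∈ R.close c with a ∈ R.nbhd j ∧ δ a ≤ K,
            R.w a * (if ρ < δ a then (1 : ℝ) else 0) + ∑ a ∈ far, R.w a =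
            ∑ a ∈ R.close c, R.w a - b by rwa [R.sum_close] at h
        rw [hb, hfar, Finset.sum_filter, Finset.sum_filter, Finset.sum_filter,
          ← Finset.sum_add_distrib, ← Finset.sum_sub_distrib]
        refine Finset.sum_congr rfl fun a _ => ?_
        by_cases h1 : a ∈ R.nbhd j
        · by_cases h2 : δ a ≤ ρ
          · simp [h1, h2, h2.trans hρ.le, not_lt.2 h2]
          · by_cases h3 : δ a ≤ K <;> simp [h1, h2, h3, not_le.1 h2]
        · simp [h1]
      have h2 : b + ∑ a ∈ S ρ, R.w a = γ * I.reach x j ρ := by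
        rw [← R.sum_nbhd_reach j ρ, ← Finset.sum_filter_add_sum_filter_not
          {a ∈ R.nbhd j | δ a ≤ ρ} fun a => a ∈ R.close c]
        congr 1
        · refine Finset.sum_congr ?_ fun _ _ => rfl
          ext a
          simp only [Finset.mem_filter]
          tauto
        · refine Finset.sum_congr ?_ fun _ _ => rfl
          ext a
          simp only [hS, Finset.mem_filter, Finset.mem_sdiff]
          tauto
      have h3 : (1 - b) * T ρ ≤ Real.exp (-(γ * I.reach x j ρ)) := by
        rw [← h2, neg_add, Real.exp_add]
        exact mul_le_mul_of_nonneg_right (Real.one_sub_le_exp_neg b) (T_nonneg ρ)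
      have h4 : (∑ a ∈ far, R.w a * (if ρ < δ a then (1 : ℝ) else 0)) * T ρ ≤
          (∑ a ∈ far, R.w a) * T ρ +
            T K * ∑ a ∈ far, R.w a * ((if ρ < δ a then (1 : ℝ) else 0) - 1) := by
        rw [Finset.sum_mul, Finset.sum_mul, Finset.mul_sum, ← Finset.sum_add_distrib]
        refine Finset.sum_le_sum fun a _ => ?_
        split_ifs
        · linarith
        · nlinarith [mul_le_mul_of_nonneg_left (T_anti hρ.le) (R.w_pos a).le]
      rw [← h1] at h3
      linarith
    · simp only [hρ, if_false, sub_zero, zero_add]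
      have h1 : ∑ a ∈ R.close c with a ∈ R.nbhd j ∧ δ a ≤ K,
          R.w a * (if ρ < δ a then (1 : ℝ) else 0) = 0 := by
        refine Finset.sum_eq_zero fun a ha => ?_
        have := (Finset.mem_filter.1 ha).2.2
        rw [if_neg (by linarith [not_lt.1 hρ]), mul_zero]
      rw [h1, zero_add, mul_comm]
      exact mul_le_mul_of_nonneg_right (T_anti (not_lt.1 hρ)) (Finset.sum_nonneg fun a _ =>
        mul_nonneg (R.w_pos a).le (by split_ifs <;> norm_num))
  calc ∑ ω, R.prob ω * Metric.infDist (I.client j) (I.facility '' (R.opened ω : Set F))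
      ≤ ∑ ω, R.prob ω * ∫ ρ in (0 : ℝ)..B, if ∀ a ∈ S ρ, a ∉ R.openedCopies ω then
        (if ρ < δ (ω.1 c) then (1 : ℝ) else 0) else 0 :=
        Finset.sum_le_sum fun ω _ => mul_le_mul_of_nonneg_left
          (R.infDist_opened_le ω hc j hB S S_mono S_dist).2 (R.prob_nonneg ω)
    _ = ∫ ρ in (0 : ℝ)..B, ∑ ω, R.prob ω * (if ∀ a ∈ S ρ, a ∉ R.openedCopies ω then
        (if ρ < δ (ω.1 c) then (1 : ℝ) else 0) else 0) := by
        rw [intervalIntegral.integral_finsetSum fun ω _ =>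
          ((R.infDist_opened_le ω hc j hB S S_mono S_dist).1.intervalIntegrable).const_mul _]
        refine Finset.sum_congr rfl fun ω _ => ?_
        rw [intervalIntegral.integral_const_mul]
    _ ≤ ∫ ρ in (0 : ℝ)..B, ((if ρ < K then Real.exp (-(γ * I.reach x j ρ)) else 0) +
        T K * ∑ a ∈ far, R.w a * ((if ρ < δ a then (1 : ℝ) else 0) - if ρ < K then 1 else 0)) := by
        refine intervalIntegral.integral_mono_on hB0 ?_ ?_ fun ρ _ => ?_
        · exact intervalIntegrable_sum fun ω _ =>
            ((R.infDist_opened_le ω hc j hB S S_mono S_dist).1.intervalIntegrable).const_mul _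
        · refine IntervalIntegrable.add
            (antitone_ite_lt exp_anti (fun _ => Real.exp_nonneg _) K).intervalIntegrable ?_
          exact (intervalIntegrable_sum fun a _ =>
            ((ind_int (δ a)).sub (ind_int K)).const_mul _).const_mul _
        · refine le_trans ?_ (pointwise ρ)
          refine R.sum_prob_mul_closed_le c (S ρ) ?_ (fun a => if ρ < δ a then 1 else 0) ?_
          · exact Finset.disjoint_of_subset_left (Finset.filter_subset _ _) Finset.sdiff_disjoint
          · intro a
            split_ifs <;> norm_num
    _ = (∫ ρ in (0 : ℝ)..B, if ρ < K then Real.exp (-(γ * I.reach x j ρ)) else 0) +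
        T K * ∑ a ∈ far, R.w a * (δ a - K) := by
        rw [intervalIntegral.integral_add
          (antitone_ite_lt exp_anti (fun _ => Real.exp_nonneg _) K).intervalIntegrable
          ((intervalIntegrable_sum fun a _ =>
            ((ind_int (δ a)).sub (ind_int K)).const_mul _).const_mul _),
          intervalIntegral.integral_const_mul, intervalIntegral.integral_finsetSum fun a _ =>
            ((ind_int (δ a)).sub (ind_int K)).const_mul _]
        refine congrArg₂ _ rfl (congrArg₂ _ rfl (Finset.sum_congr rfl fun a _ => ?_))
        rw [intervalIntegral.integral_const_mul,
          intervalIntegral.integral_sub (ind_int (δ a)) (ind_int K),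
          integral_ite_lt_one (I.d_nonneg _ _) (hB _), integral_ite_lt_one hK0 hKB]
    _ ≤ _ := by
        have := R.sum_fallback_le hshare hkey hK
        nlinarith [T_nonneg K]

end Rounding

end FacilityLocation

namespace FacilityLocation

/-! ### The levels `1 / γ_l` -/

theorem sum_Icc_sub_pred (g : ℕ → ℝ) (n : ℕ) :
    ∑ l ∈ Finset.Icc 1 n, (g l - g (l - 1)) = g n - g 0 := by
  induction n with
  | zero => simp
  | succ n ih =>
    rw [Finset.sum_Icc_succ_top (by omega), ih, Nat.add_sub_cancel]
    ring

theorem gam_self (n : ℕ) : gam n n = 1 := by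
  simp [gam]

theorem one_le_gam {n l : ℕ} (hl : l ≤ n) : 1 ≤ gam n l := by
  have : (l : ℝ) ≤ n := by exact_mod_cast hl
  have : 0 ≤ ((n : ℝ) - l) / n := div_nonneg (by linarith) (Nat.cast_nonneg n)
  unfold gam
  linarith

theorem gam_pos {n l : ℕ} (hl : l ≤ n) : 0 < gam n l := one_pos.trans_le (one_le_gam hl)

theorem gam_le_three (n l : ℕ) : gam n l ≤ 3 := by
  have : ((n : ℝ) - l) / n ≤ 1 :=
    div_le_one_of_le₀ (by linarith [Nat.cast_nonneg (α := ℝ) l]) (Nat.cast_nonneg n)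
  unfold gam
  linarith

theorem gam_lt_gam {n l m : ℕ} (hlm : l < m) (hm : m ≤ n) : gam n m < gam n l := by
  have h1 : (l : ℝ) < m := by exact_mod_cast hlm
  have h2 : (0 : ℝ) < n := by exact_mod_cast (by omega : 0 < n)
  have : ((n : ℝ) - m) / n < (n - l) / n := div_lt_div_of_pos_right (by linarith) h2
  unfold gam
  linarith

@[simp] theorem lev_zero (n : ℕ) : lev n 0 = 0 := if_pos rfl

theorem lev_of_pos {n l : ℕ} (hl : 1 ≤ l) : lev n l = 1 / gam n l := if_neg (by omega)

theorem lev_self {n : ℕ} (hn : 1 ≤ n) : lev n n = 1 := by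
  rw [lev_of_pos hn, gam_self, div_one]

theorem lev_lt_lev {n l m : ℕ} (hlm : l < m) (hm : m ≤ n) : lev n l < lev n m := by
  rw [lev_of_pos (by omega : 1 ≤ m)]
  rcases Nat.eq_zero_or_pos l with rfl | hl
  · rw [lev_zero]
    exact one_div_pos.2 (gam_pos hm)
  · rw [lev_of_pos hl]
    exact one_div_lt_one_div_of_lt (gam_pos hm) (gam_lt_gam hlm hm)

theorem lev_le_lev {n l m : ℕ} (hlm : l ≤ m) (hm : m ≤ n) : lev n l ≤ lev n m := by
  rcases hlm.eq_or_lt with rfl | h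
  · exact le_rfl
  · exact (lev_lt_lev h hm).le

theorem lev_nonneg {n l : ℕ} (hl : l ≤ n) : 0 ≤ lev n l :=
  (lev_zero n).symm.le.trans (lev_le_lev (Nat.zero_le l) hl)

theorem lev_le_one {n l : ℕ} (hl : l ≤ n) : lev n l ≤ 1 := by
  rcases Nat.eq_zero_or_pos n with rfl | hn
  · obtain rfl : l = 0 := by omega
    simp
  · exact (lev_le_lev hl le_rfl).trans_eq (lev_self hn)

/-- On each interval between consecutive levels, the graph of `exp (-γ x)` is below its chord. -/
theorem exp_neg_sub_le_chord {γ s t z : ℝ} (hst : s < t) :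
    Real.exp (-(γ * max z s)) - Real.exp (-(γ * max z t)) ≤
      (Real.exp (-(γ * s)) - Real.exp (-(γ * t))) * ((t - s)⁻¹ * (t - max s (min z t))) := by
  have hts : 0 < t - s := sub_pos.2 hst
  rcases le_total z s with h1 | h1
  · rw [max_eq_right h1, max_eq_right (h1.trans hst.le), min_eq_left (h1.trans hst.le),
      max_eq_left h1, inv_mul_cancel₀ hts.ne', mul_one]
  rcases le_total z t with h2 | h2
  · rw [max_eq_left h1, max_eq_right h2, min_eq_left h2, max_eq_right h1]
    have hconv := convexOn_exp.2 (Set.mem_univ (-(γ * s))) (Set.mem_univ (-(γ * t)))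
      (mul_nonneg (inv_nonneg.2 hts.le) (sub_nonneg.2 h2))
      (mul_nonneg (inv_nonneg.2 hts.le) (sub_nonneg.2 h1)) (by field_simp; ring)
    have e : ((t - s)⁻¹ * (t - z)) • (-(γ * s)) + ((t - s)⁻¹ * (z - s)) • (-(γ * t)) =
        -(γ * z) := by
      simp only [smul_eq_mul]
      field_simp
      ring
    rw [e] at hconv
    have e2 : (t - s)⁻¹ * (z - s) = 1 - (t - s)⁻¹ * (t - z) := by field_simp; ring
    rw [e2] at hconv
    simp only [smul_eq_mul] at hconv
    linarith
  · rw [max_eq_left h1, max_eq_left h2, min_eq_right h2, max_eq_right hst.le]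
    simp

/-! ### The characteristic functions of the clients -/

theorem integral_ite_gt {s t z : ℝ} (hst : s ≤ t) :
    ∫ p in s..t, (if z < p then (1 : ℝ) else 0) = t - max s (min z t) := by
  have h1 : s ≤ max s (min z t) := le_max_left _ _
  have h2 : max s (min z t) ≤ t := max_le hst (min_le_right _ _)
  have mono : Monotone fun p => if z < p then (1 : ℝ) else 0 := by
    intro p p' h
    change (if _ then _ else _) ≤ (if _ then _ else _)
    split_ifs with h1 h2
    · exact le_rfl
    · exact absurd (h1.trans_le h) h2
    · exact zero_le_one
    · exact le_rfl
  rw [← intervalIntegral.integral_add_adjacent_intervals (b := max s (min z t))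
    mono.intervalIntegrable mono.intervalIntegrable]
  have e1 : ∫ p in s..max s (min z t), (if z < p then (1 : ℝ) else 0) = 0 := by
    rw [intervalIntegral.integral_congr_ae (g := fun _ => 0)]
    · simp
    refine Filter.Eventually.of_forall fun p hp => ?_
    rw [Set.uIoc_of_le h1] at hp
    rcases le_max_iff.1 hp.2 with h | h
    · exact absurd hp.1 (not_lt.2 h)
    · rw [if_neg (not_lt.2 (h.trans (min_le_left _ _)))]
  have e2 : ∫ p in max s (min z t)..t, (if z < p then (1 : ℝ) else 0) = t - max s (min z t) := by
    rw [intervalIntegral.integral_congr_ae (g := fun _ => 1)]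
    · simp
    refine Filter.Eventually.of_forall fun p hp => ?_
    rw [Set.uIoc_of_le h2] at hp
    have := (le_max_right s (min z t)).trans_lt hp.1
    rw [if_pos]
    by_contra h
    rw [not_lt] at h
    exact absurd this (not_lt.2 (le_min h hp.2))
  rw [e1, e2, zero_add]

section CharFun

variable {F C X : Type*} [PseudoMetricSpace X] [Fintype F] {I : Instance F C X} {x : F → C → ℝ}
  {y : F → ℝ}

theorem IsFractional.reach_mono (h : IsFractional x y) (j : C) : Monotone (I.reach x j) :=
  fun _ _ hρ => Finset.sum_le_sum_of_subset_of_nonneg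
    (Finset.monotone_filter_right _ fun _ _ ha => le_trans ha hρ) fun i _ _ => h.x_nonneg i j

theorem IsFractional.reach_nonneg (h : IsFractional x y) (j : C) (ρ : ℝ) : 0 ≤ I.reach x j ρ :=
  Finset.sum_nonneg fun i _ => h.x_nonneg i j

theorem IsFractional.reach_le_one (h : IsFractional x y) (j : C) (ρ : ℝ) : I.reach x j ρ ≤ 1 := by
  rw [← h.sum_eq_one j]
  exact Finset.sum_le_sum_of_subset_of_nonneg (Finset.filter_subset _ _)
    fun i _ _ => h.x_nonneg i j

theorem IsFractional.reach_eq_one (h : IsFractional x y) {j : C} {B : ℝ} (hB : ∀ i, I.d i j ≤ B) :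
    I.reach x j B = 1 := by
  rw [← h.sum_eq_one j, Instance.reach, Finset.filter_true_of_mem fun i _ => hB i]

theorem Instance.charFun_le {j : C} {p ρ : ℝ} (hp : 0 < p)
    (h : p ≤ I.reach x j ρ) : I.charFun x j p ≤ ρ := by
  refine csInf_le ⟨0, fun ρ' hρ' => ?_⟩ h
  by_contra hneg
  rw [not_le] at hneg
  have : I.reach x j ρ' = 0 := by
    rw [Instance.reach, Finset.sum_filter]
    exact Finset.sum_eq_zero fun i _ => if_neg (by linarith [I.d_nonneg i j])
  have hρ'' : p ≤ I.reach x j ρ' := hρ'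
  linarith

/-- The infimum in the definition of the characteristic function is attained. -/
theorem IsFractional.le_reach_charFun (h : IsFractional x y) (j : C) {p : ℝ} (hp : 0 < p)
    (hp1 : p ≤ 1) : p ≤ I.reach x j (I.charFun x j p) := by
  classical
  -- the least distance `d i j` at which `reach` is at least `p`
  have key : ∀ ρ, p ≤ I.reach x j ρ → ∃ i, I.d i j ≤ ρ ∧ p ≤ I.reach x j (I.d i j) := by
    intro ρ hρ
    have hne : ({i | I.d i j ≤ ρ} : Finset F).Nonempty := by
      by_contra hne
      rw [Finset.not_nonempty_iff_eq_empty] at hne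
      rw [Instance.reach, hne, Finset.sum_empty] at hρ
      linarith
    obtain ⟨i, hi, hmax⟩ := Finset.exists_max_image _ (fun i => I.d i j) hne
    refine ⟨i, (Finset.mem_filter.1 hi).2, hρ.trans_eq ?_⟩
    refine Finset.sum_congr ?_ fun _ _ => rfl
    ext i'
    simp only [Finset.mem_filter, Finset.mem_univ, true_and]
    exact ⟨fun h' => hmax i' (by simpa using h'),
      fun h' => h'.trans (Finset.mem_filter.1 hi).2⟩
  have hne : ({i | p ≤ I.reach x j (I.d i j)} : Finset F).Nonempty := by
    obtain ⟨B, hB⟩ := (Set.finite_range fun i => I.d i j).bddAbove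
    obtain ⟨i, -, hi⟩ := key B (hp1.trans_eq
      (h.reach_eq_one fun i => hB (Set.mem_range_self i)).symm)
    exact ⟨i, by simpa using hi⟩
  obtain ⟨i, hi, hmin⟩ := Finset.exists_min_image _ (fun i => I.d i j) hne
  have hi' : p ≤ I.reach x j (I.d i j) := (Finset.mem_filter.1 hi).2
  refine hi'.trans (h.reach_mono j ?_)
  refine le_csInf ⟨_, hi'⟩ fun ρ hρ => ?_
  obtain ⟨i', h1, h2⟩ := key ρ hρ
  exact (hmin i' (by simpa using h2)).trans h1

theorem IsFractional.lt_charFun_iff (h : IsFractional x y) {j : C} {p ρ : ℝ} (hp : 0 < p)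
    (hp1 : p ≤ 1) : ρ < I.charFun x j p ↔ I.reach x j ρ < p := by
  rw [← not_le, ← not_le, not_iff_not]
  exact ⟨fun hle => (h.le_reach_charFun j hp hp1).trans (h.reach_mono j hle),
    Instance.charFun_le hp⟩

theorem IsFractional.charFun_of_nonpos (h : IsFractional x y) (j : C) {p : ℝ} (hp : p ≤ 0) :
    I.charFun x j p = 0 := by
  have : {ρ | p ≤ ∑ i with I.d i j ≤ ρ, x i j} = Set.univ :=
    Set.eq_univ_of_forall fun ρ => hp.trans (h.reach_nonneg (I := I) j ρ)
  rw [Instance.charFun, this, Real.sInf_univ]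

theorem IsFractional.charFun_nonneg (h : IsFractional x y) (j : C) {p : ℝ} (hp1 : p ≤ 1) :
    0 ≤ I.charFun x j p := by
  rcases le_or_gt p 0 with hp | hp
  · exact (h.charFun_of_nonpos j hp).symm.le
  · by_contra hneg
    have h1 := h.le_reach_charFun (I := I) j hp hp1
    rw [Instance.reach, Finset.sum_filter, Finset.sum_eq_zero fun i _ =>
      if_neg (by linarith [I.d_nonneg i j])] at h1
    linarith

theorem IsFractional.charFun_monotoneOn (h : IsFractional x y) (j : C) :
    MonotoneOn (I.charFun x j) (Set.Iic 1) := by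
  intro p hp p' hp' hpp
  rcases le_or_gt p 0 with h0 | h0
  · rw [h.charFun_of_nonpos j h0]
    exact h.charFun_nonneg j hp'
  · exact Instance.charFun_le h0 (hpp.trans (h.le_reach_charFun j (h0.trans_le hpp) hp'))

theorem IsFractional.charFun_intervalIntegrable (h : IsFractional x y) (j : C) {s t : ℝ}
    (hs : s ≤ 1) (ht : t ≤ 1) :
    IntervalIntegrable (I.charFun x j) MeasureTheory.volume s t :=
  ((h.charFun_monotoneOn j).mono fun _ hp => hp.2.trans (max_le hs ht)).intervalIntegrable

/-- The characteristic function is the inverse function of `reach`, and so its integral is the area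
beside the graph of `reach`. -/
theorem IsFractional.integral_charFun (h : IsFractional x y) {j : C} {B : ℝ}
    (hB0 : 0 ≤ B) (hB : ∀ i, I.d i j ≤ B) {s t : ℝ} (hs : 0 ≤ s) (hst : s ≤ t) (ht : t ≤ 1) :
    ∫ p in s..t, I.charFun x j p =
      ∫ ρ in (0 : ℝ)..B, (t - max s (min (I.reach x j ρ) t)) := by
  have e1 : ∫ p in s..t, I.charFun x j p =
      ∫ p in s..t, ∫ ρ in (0 : ℝ)..B, if I.reach x j ρ < p then (1 : ℝ) else 0 := by
    refine intervalIntegral.integral_congr_ae (Filter.Eventually.of_forall fun p hp => ?_)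
    rw [Set.uIoc_of_le hst] at hp
    have hp0 := hs.trans_lt hp.1
    have hp1 := hp.2.trans ht
    simp only [← h.lt_charFun_iff hp0 hp1]
    rw [integral_ite_lt_one (h.charFun_nonneg j hp1)]
    exact Instance.charFun_le hp0 (hp1.trans_eq (h.reach_eq_one hB).symm)
  rw [e1, intervalIntegral.integral_of_le hst]
  simp only [intervalIntegral.integral_of_le hB0]
  rw [MeasureTheory.integral_integral_swap]
  · refine MeasureTheory.integral_congr_ae (Filter.Eventually.of_forall fun ρ => ?_)
    change ∫ p in Set.Ioc s t, _ = _
    rw [← intervalIntegral.integral_of_le hst, integral_ite_gt hst]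
  · refine MeasureTheory.Integrable.of_bound (C := 1) ?_ ?_
    · refine (Measurable.ite ?_ measurable_const measurable_const).aestronglyMeasurable
      exact measurableSet_lt ((h.reach_mono j).measurable.comp measurable_snd) measurable_fst
    · refine Filter.Eventually.of_forall fun z => ?_
      simp only [Function.uncurry]
      split_ifs <;> simp

theorem Instance.exists_bound (I : Instance F C X) (j : C) (K : ℝ) :
    ∃ B, 0 ≤ B ∧ K ≤ B ∧ ∀ i, I.d i j ≤ B := by
  obtain ⟨B, hB⟩ := (Set.finite_range fun i => I.d i j).bddAbove
  exact ⟨max 0 (max K B), le_max_left _ _, (le_max_left _ _).trans (le_max_right _ _),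
    fun i => (hB (Set.mem_range_self i)).trans ((le_max_right _ _).trans (le_max_right _ _))⟩

theorem IsFractional.integral_charFun_zero_one (h : IsFractional x y) (j : C) :
    ∫ p in (0 : ℝ)..1, I.charFun x j p = ∑ i, I.d i j * x i j := by
  obtain ⟨B, hB0, -, hB⟩ := I.exists_bound j 0
  rw [h.integral_charFun hB0 hB le_rfl zero_le_one le_rfl]
  have e : ∀ ρ, 1 - max 0 (min (I.reach x j ρ) 1) =
      ∑ i, x i j * (if ρ < I.d i j then (1 : ℝ) else 0) := by
    intro ρ
    rw [min_eq_left (h.reach_le_one j ρ), max_eq_right (h.reach_nonneg j ρ), Instance.reach,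
      Finset.sum_filter]
    nth_rw 1 [← h.sum_eq_one j]
    rw [← Finset.sum_sub_distrib]
    refine Finset.sum_congr rfl fun i _ => ?_
    by_cases hi : I.d i j ≤ ρ
    · simp [hi, not_lt.2 hi]
    · simp [hi, not_le.1 hi]
  simp only [e]
  rw [intervalIntegral.integral_finsetSum fun i _ => ?_]
  · refine Finset.sum_congr rfl fun i _ => ?_
    rw [intervalIntegral.integral_const_mul, integral_ite_lt_one (I.d_nonneg i j) (hB i), mul_comm]
  · exact ((antitone_ite_lt antitone_const (fun _ => zero_le_one) _).intervalIntegrable).const_mul _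

/-- The total length of the radii, weighted with `exp (-γ reach)`, is bounded in terms of
the averages of the characteristic function between consecutive levels. -/
theorem IsFractional.integral_exp_neg_reach_le (h : IsFractional x y) {j : C} {n : ℕ} (hn : 1 ≤ n)
    {γ K B : ℝ} (hK0 : 0 ≤ K) (hKB : K ≤ B) (hB : ∀ i, I.d i j ≤ B) (hγ : 0 ≤ γ) :
    ∫ ρ in (0 : ℝ)..B, (if ρ < K then Real.exp (-(γ * I.reach x j ρ)) else 0) ≤
      ∑ l ∈ Finset.Icc 1 n, (Real.exp (-(γ * lev n (l - 1))) - Real.exp (-(γ * lev n l))) *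
        ((lev n l - lev n (l - 1))⁻¹ * ∫ p in lev n (l - 1)..lev n l, I.charFun x j p) +
      Real.exp (-γ) * K := by
  have hB0 := hK0.trans hKB
  have exp_anti : Antitone fun ρ => Real.exp (-(γ * I.reach x j ρ)) := fun ρ ρ' hρ =>
    Real.exp_le_exp.2 (neg_le_neg (mul_le_mul_of_nonneg_left (h.reach_mono j hρ) hγ))
  have clamp_int : ∀ l, IntervalIntegrable (fun ρ => lev n l -
      max (lev n (l - 1)) (min (I.reach x j ρ) (lev n l))) MeasureTheory.volume 0 B := by
    intro l
    have : Antitone fun ρ => lev n l -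
      max (lev n (l - 1)) (min (I.reach x j ρ) (lev n l)) := fun ρ ρ' hρ =>
      sub_le_sub_left (max_le_max le_rfl (min_le_min (h.reach_mono j hρ) le_rfl)) _
    exact this.intervalIntegrable
  calc ∫ ρ in (0 : ℝ)..B, (if ρ < K then Real.exp (-(γ * I.reach x j ρ)) else 0)
      ≤ ∫ ρ in (0 : ℝ)..B, (∑ l ∈ Finset.Icc 1 n,
          (Real.exp (-(γ * lev n (l - 1))) - Real.exp (-(γ * lev n l))) *
          ((lev n l - lev n (l - 1))⁻¹ * (lev n l -
            max (lev n (l - 1)) (min (I.reach x j ρ) (lev n l)))) +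
          Real.exp (-γ) * (if ρ < K then 1 else 0)) := by
        refine intervalIntegral.integral_mono_on hB0
          (antitone_ite_lt exp_anti (fun _ => Real.exp_nonneg _) K).intervalIntegrable
          ((intervalIntegrable_sum fun l _ => ((clamp_int l).const_mul _).const_mul _).add
            ((antitone_ite_lt antitone_const (fun _ => zero_le_one) K).intervalIntegrable.const_mul
              _)) fun ρ _ => ?_
        set z := I.reach x j ρ
        have hsum : Real.exp (-(γ * z)) - Real.exp (-γ) ≤ ∑ l ∈ Finset.Icc 1 n,
            (Real.exp (-(γ * lev n (l - 1))) - Real.exp (-(γ * lev n l))) *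
            ((lev n l - lev n (l - 1))⁻¹ * (lev n l - max (lev n (l - 1)) (min z (lev n l)))) := by
          have tel := sum_Icc_sub_pred (fun l => -Real.exp (-(γ * max z (lev n l)))) n
          simp only [lev_zero, lev_self hn, max_eq_left (h.reach_nonneg j ρ),
            max_eq_right (h.reach_le_one (I := I) j ρ), z, mul_one] at tel ⊢
          rw [show Real.exp (-(γ * I.reach x j ρ)) - Real.exp (-γ) =
            -Real.exp (-γ) - -Real.exp (-(γ * I.reach x j ρ)) by ring, ← tel]
          refine Finset.sum_le_sum fun l hl => ?_
          rw [Finset.mem_Icc] at hl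
          have := exp_neg_sub_le_chord (γ := γ) (z := I.reach x j ρ)
            (lev_lt_lev (by omega : l - 1 < l) hl.2)
          linarith
        split_ifs
        · linarith
        · have : Real.exp (-γ) ≤ Real.exp (-(γ * z)) := Real.exp_le_exp.2
            (by nlinarith [h.reach_le_one (I := I) j ρ])
          linarith
    _ = _ := by
        rw [intervalIntegral.integral_add
          (intervalIntegrable_sum fun l _ => ((clamp_int l).const_mul _).const_mul _)
          ((antitone_ite_lt antitone_const (fun _ => zero_le_one) K).intervalIntegrable.const_mul
            _), intervalIntegral.integral_const_mul, integral_ite_lt_one hK0 hKB,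
          intervalIntegral.integral_finsetSum fun l _ => ((clamp_int l).const_mul _).const_mul _]
        congr 1
        refine Finset.sum_congr rfl fun l hl => ?_
        rw [Finset.mem_Icc] at hl
        rw [intervalIntegral.integral_const_mul, intervalIntegral.integral_const_mul,
          h.integral_charFun hB0 hB (lev_nonneg (by omega)) (lev_le_lev (by omega) hl.2)
            (lev_le_one hl.2)]

variable [DecidableEq F] {γ : ℝ}

theorem Splitting.maxClose_le_charFun (P : Splitting I x y γ) (h : IsFractional x y) (hγ : 1 ≤ γ)
    (j : C) : P.maxClose j ≤ I.charFun x j (1 / γ) := by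
  have hγ0 : 0 < γ := by linarith
  refine P.maxClose_le fun a ha => ?_
  by_contra hlt
  rw [not_le] at hlt
  have h1 := h.le_reach_charFun (I := I) j (one_div_pos.2 hγ0) (div_le_one_of_le₀ hγ hγ0.le)
  rw [div_le_iff₀' hγ0, ← P.sum_nbhd_reach] at h1
  -- all copies serving `j` within distance `charFun x j (1 / γ)` are close, and so is `a`
  have hsub : insert a {b ∈ P.nbhd j | I.d (P.orig b) j ≤ I.charFun x j (1 / γ)} ⊆ P.close j := by
    intro b hb
    rcases Finset.mem_insert.1 hb with rfl | hb
    · exact ha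
    · rw [Finset.mem_filter] at hb
      by_contra hb'
      linarith [P.close_le j a ha b hb.1 hb', hb.2]
  have hnot : a ∉ ({b ∈ P.nbhd j | I.d (P.orig b) j ≤ I.charFun x j (1 / γ)} : Finset _) :=
    fun ha' => absurd (Finset.mem_filter.1 ha').2 (not_le.2 hlt)
  have h2 := Finset.sum_le_sum_of_subset_of_nonneg hsub fun b _ _ => (P.w_pos b).le
  rw [P.sum_close, Finset.sum_insert hnot] at h2
  linarith [P.w_pos a]

theorem Splitting.excess_add_key (P : Splitting I x y γ) (h : IsFractional x y) (j : C) :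
    P.excess j + P.maxClose j + P.key j =
      γ * ∑ i, I.d i j * x i j + (3 - γ) * P.maxClose j := by
  have e1 := P.sum_nbhd_mul j fun i => I.d i j
  have e2 := P.sum_nbhd_mul j fun _ => 1
  simp only [mul_one, h.sum_eq_one] at e2
  rw [← Finset.sum_sdiff (P.close_subset j)] at e1 e2
  rw [P.sum_close] at e2
  have e3 : P.excess j = ∑ a ∈ P.nbhd j \ P.close j, P.w a * I.d (P.orig a) j -
      (∑ a ∈ P.nbhd j \ P.close j, P.w a) * P.maxClose j := by
    rw [Splitting.excess, Finset.sum_mul, ← Finset.sum_sub_distrib]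
    exact Finset.sum_congr rfl fun a _ => mul_sub _ _ _
  have e4 : P.key j = ∑ a ∈ P.close j, P.w a * I.d (P.orig a) j + P.maxClose j := rfl
  have e5 : ∑ i, I.d i j * x i j = ∑ i, x i j * I.d i j :=
    Finset.sum_congr rfl fun i _ => mul_comm _ _
  rw [e3, e4, e5, ← e1, eq_sub_of_add_eq e2]
  ring

end CharFun

/-! ### The profile -/

section Profile

variable {F C X : Type*} [PseudoMetricSpace X] [Fintype F] [Fintype C] {I : Instance F C X}
  {x : F → C → ℝ} {y : F → ℝ}

theorem IsFractional.profile_eq_sum (h : IsFractional x y) {n l : ℕ} (hl : l ≤ n) :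
    I.profile x n l = ∑ j, (lev n l - lev n (l - 1))⁻¹ *
      ∫ p in lev n (l - 1)..lev n l, I.charFun x j p := by
  rw [Instance.profile, intervalIntegral.integral_finsetSum fun j _ =>
    h.charFun_intervalIntegrable j (lev_le_one (by omega)) (lev_le_one hl), Finset.mul_sum]

theorem IsFractional.profile_le (h : IsFractional x y) {n l : ℕ} (h1 : 1 ≤ l) (hl : l ≤ n) :
    I.profile x n l ≤ ∑ j, I.charFun x j (lev n l) := by
  rw [h.profile_eq_sum hl]
  refine Finset.sum_le_sum fun j _ => ?_
  have hlt : lev n (l - 1) < lev n l := lev_lt_lev (by omega) hl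
  rw [inv_mul_le_iff₀ (sub_pos.2 hlt)]
  have := intervalIntegral.integral_mono_on (μ := MeasureTheory.volume) hlt.le
    (h.charFun_intervalIntegrable (I := I) j (lev_le_one (by omega)) (lev_le_one hl))
    (intervalIntegrable_const (c := I.charFun x j (lev n l)))
    fun p hp => h.charFun_monotoneOn j (hp.2.trans (lev_le_one hl)) (lev_le_one hl) hp.2
  rwa [intervalIntegral.integral_const, smul_eq_mul] at this

theorem IsFractional.le_profile_succ (h : IsFractional x y) {n l : ℕ} (hl : l < n) :
    ∑ j, I.charFun x j (lev n l) ≤ I.profile x n (l + 1) := by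
  rw [h.profile_eq_sum (Nat.succ_le_of_lt hl)]
  refine Finset.sum_le_sum fun j _ => ?_
  have hlt : lev n l < lev n (l + 1) := lev_lt_lev (by omega) hl
  change _ ≤ (lev n (l + 1) - lev n l)⁻¹ * ∫ p in lev n l..lev n (l + 1), I.charFun x j p
  rw [le_inv_mul_iff₀ (sub_pos.2 hlt)]
  have := intervalIntegral.integral_mono_on (μ := MeasureTheory.volume) hlt.le
    (intervalIntegrable_const (c := I.charFun x j (lev n l)))
    (h.charFun_intervalIntegrable (I := I) j (lev_le_one hl.le) (lev_le_one hl))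
    fun p hp => h.charFun_monotoneOn j (lev_le_one hl.le) (hp.2.trans (lev_le_one hl)) hp.1
  rwa [intervalIntegral.integral_const, smul_eq_mul] at this

theorem IsFractional.profile_order (h : IsFractional x y) {n i : ℕ} (h1 : 1 ≤ i) (hi : i < n) :
    0 ≤ I.profile x n i ∧ I.profile x n i ≤ I.profile x n (i + 1) := by
  refine ⟨?_, (h.profile_le h1 hi.le).trans (h.le_profile_succ hi)⟩
  have := h.le_profile_succ (I := I) (n := n) (l := i - 1) (by omega)
  rw [Nat.sub_add_cancel h1] at this
  exact (Finset.sum_nonneg fun j _ => h.charFun_nonneg j (lev_le_one (by omega))).trans this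

theorem IsFractional.sum_profile (h : IsFractional x y) {n : ℕ} (hn : 1 ≤ n) :
    ∑ l ∈ Finset.Icc 1 n, (lev n l - lev n (l - 1)) * I.profile x n l =
      ∑ i, ∑ j, I.d i j * x i j := by
  have hint : ∀ s t : ℝ, s ≤ 1 → t ≤ 1 →
      IntervalIntegrable (fun p => ∑ j, I.charFun x j p) MeasureTheory.volume s t :=
    fun s t hs ht => intervalIntegrable_sum fun j _ => h.charFun_intervalIntegrable j hs ht
  have tel := sum_Icc_sub_pred (fun l => ∫ p in (0 : ℝ)..lev n l, ∑ j, I.charFun x j p) n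
  rw [lev_zero, intervalIntegral.integral_same, sub_zero, lev_self hn,
    intervalIntegral.integral_finsetSum fun j _ =>
      h.charFun_intervalIntegrable j zero_le_one le_rfl] at tel
  rw [Finset.sum_comm, ← Finset.sum_congr rfl fun j _ => h.integral_charFun_zero_one (I := I) j,
    ← tel]
  refine Finset.sum_congr rfl fun l hl => ?_
  rw [Finset.mem_Icc] at hl
  rw [Instance.profile, mul_inv_cancel_left₀ (sub_pos.2 (lev_lt_lev (by omega) hl.2)).ne',
    intervalIntegral.integral_interval_sub_left (hint _ _ zero_le_one (lev_le_one hl.2))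
      (hint _ _ zero_le_one (lev_le_one (by omega)))]

/-! ### The cost of one run of the Chudak–Shmoys algorithm -/

variable [DecidableEq F] [DecidableEq C] {γ : ℝ}

theorem CSRun.expectedCost_le_charFun (R : CSRun I x y γ) (h : IsFractional x y) {n : ℕ}
    (hn : 1 ≤ n) (hγ : 1 ≤ γ) (hγ3 : γ ≤ 3) :
    R.expectedCost ≤ γ * ∑ i, y i * I.openCost i +
      ∑ l ∈ Finset.Icc 1 n,
        (Real.exp (-(γ * lev n (l - 1))) - Real.exp (-(γ * lev n l))) * I.profile x n l +
      Real.exp (-γ) * (γ * (∑ i, ∑ j, I.d i j * x i j) +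
        (3 - γ) * ∑ j, I.charFun x j (1 / γ)) := by
  have dist_le : ∀ j, ∑ ω, R.prob ω *
      Metric.infDist (I.client j) (I.facility '' (R.opened ω : Set F)) ≤
      ∑ l ∈ Finset.Icc 1 n, (Real.exp (-(γ * lev n (l - 1))) - Real.exp (-(γ * lev n l))) *
        ((lev n l - lev n (l - 1))⁻¹ * ∫ p in lev n (l - 1)..lev n l, I.charFun x j p) +
      Real.exp (-γ) * (γ * (∑ i, I.d i j * x i j) + (3 - γ) * I.charFun x j (1 / γ)) := by
    intro j
    have hch : 0 ≤ I.charFun x j (1 / γ) :=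
      h.charFun_nonneg j (div_le_one_of_le₀ hγ (by linarith))
    have hK0 : 0 ≤ γ * (∑ i, I.d i j * x i j) + (3 - γ) * I.charFun x j (1 / γ) :=
      add_nonneg (mul_nonneg (by linarith) (Finset.sum_nonneg fun i _ =>
        mul_nonneg (I.d_nonneg i j) (h.x_nonneg i j))) (mul_nonneg (by linarith) hch)
    obtain ⟨c, hc, hshare, hkey⟩ := R.clustering.exists_center j (Finset.mem_univ j)
    obtain ⟨B, hB0, hKB, hB⟩ := I.exists_bound j
      (γ * (∑ i, I.d i j * x i j) + (3 - γ) * I.charFun x j (1 / γ))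
    refine (R.expected_dist_le hc hshare hkey ?_ hK0 hKB hB (by linarith) h.x_nonneg).trans
      (h.integral_exp_neg_reach_le hn hK0 hKB hB (by linarith))
    rw [R.excess_add_key h]
    have := R.maxClose_le_charFun h hγ j
    nlinarith
  have e : R.expectedCost = ∑ ω, R.prob ω * ∑ i ∈ R.opened ω, I.openCost i +
      ∑ j, ∑ ω, R.prob ω *
        Metric.infDist (I.client j) (I.facility '' (R.opened ω : Set F)) := by
    rw [Finset.sum_comm, ← Finset.sum_add_distrib]
    refine Finset.sum_congr rfl fun ω _ => ?_
    rw [Instance.cost, mul_add, Finset.mul_sum (s := (Finset.univ : Finset C))]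
  have hsum := Finset.sum_le_sum fun j (_ : j ∈ Finset.univ) => dist_le j
  rw [Finset.sum_add_distrib, ← Finset.mul_sum (s := (Finset.univ : Finset C)),
    Finset.sum_add_distrib, ← Finset.mul_sum, ← Finset.mul_sum,
    Finset.sum_comm (f := fun j i => I.d i j * x i j),
    Finset.sum_comm (s := Finset.univ) (t := Finset.Icc 1 n)] at hsum
  have e2 : ∑ l ∈ Finset.Icc 1 n, ∑ j : C,
      (Real.exp (-(γ * lev n (l - 1))) - Real.exp (-(γ * lev n l))) *
        ((lev n l - lev n (l - 1))⁻¹ * ∫ p in lev n (l - 1)..lev n l, I.charFun x j p) =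
      ∑ l ∈ Finset.Icc 1 n,
        (Real.exp (-(γ * lev n (l - 1))) - Real.exp (-(γ * lev n l))) * I.profile x n l :=
    Finset.sum_congr rfl fun l hl => by
      rw [h.profile_eq_sum (Finset.mem_Icc.1 hl).2, Finset.mul_sum]
  rw [e2] at hsum
  rw [e]
  linarith [R.expected_openCost_le]

/-- The cost of the run with parameter `γ_k` satisfies the corresponding rounding constraint of
the factor revealing LP. -/
theorem CSRun.expectedCost_le {n k : ℕ} (hk : 1 ≤ k) (hkn : k < n) (R : CSRun I x y (gam n k))
    (h : IsFractional x y) :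
    R.expectedCost ≤ gam n k * (∑ i, y i * I.openCost i) +
      ∑ l ∈ Finset.Icc 1 n, I.profile x n l * pr n k l +
      Real.exp (-gam n k) * (gam n k * (∑ i, ∑ j, I.d i j * x i j) +
        (3 - gam n k) * I.profile x n (k + 1)) := by
  refine (R.expectedCost_le_charFun h (by omega : 1 ≤ n) (one_le_gam hkn.le)
    (gam_le_three n k)).trans ?_
  have h1 := h.le_profile_succ (I := I) hkn
  rw [lev_of_pos hk] at h1
  have h2 : ∑ l ∈ Finset.Icc 1 n, (Real.exp (-(gam n k * lev n (l - 1))) -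
      Real.exp (-(gam n k * lev n l))) * I.profile x n l =
      ∑ l ∈ Finset.Icc 1 n, I.profile x n l * pr n k l :=
    Finset.sum_congr rfl fun l _ => mul_comm _ _
  rw [h2]
  have := mul_le_mul_of_nonneg_left h1 (by linarith [gam_le_three n k] : 0 ≤ 3 - gam n k)
  gcongr

end Profile

end FacilityLocation

namespace FacilityLocation

/-! ### Weak duality for the factor revealing LP -/

/-- Summation by parts: for the multipliers `r` of the order constraints, the sum telescopes up to
nonnegative terms. -/
theorem sum_mul_sub_pred_le {cl r : ℕ → ℝ} {n : ℕ} (r_zero : r 0 = 0)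
    (r_nonneg : ∀ i, 1 ≤ i → i < n → 0 ≤ r i) (order : ∀ i, 1 ≤ i → i < n → cl i ≤ cl (i + 1))
    {m : ℕ} (hm : 1 ≤ m) (hmn : m ≤ n) :
    ∑ l ∈ Finset.Icc 1 m, cl l * (r l - r (l - 1)) ≤ cl m * r m := by
  induction m, hm using Nat.le_induction with
  | base => simp [r_zero]
  | succ m hm ih =>
    rw [Finset.sum_Icc_succ_top (by omega), Nat.add_sub_cancel]
    nlinarith [ih (by omega), mul_nonneg (r_nonneg m hm (by omega))
      (sub_nonneg.2 (order m hm (by omega)))]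

/-- The entries of the profile are nonnegative. -/
theorem profile_nonneg_of_order {n : ℕ} {c : ℝ} {cl : ℕ → ℝ} (hc : 0 ≤ c)
    (connection : ∑ l ∈ Finset.Icc 1 n, (lev n l - lev n (l - 1)) * cl l = c)
    (order : ∀ i, 1 ≤ i → i < n → 0 ≤ cl i ∧ cl i ≤ cl (i + 1)) :
    ∀ i, 1 ≤ i → i ≤ n → 0 ≤ cl i := by
  intro i h1 hi
  rcases hi.lt_or_eq with h | rfl
  · exact (order i h1 h).1
  rcases h1.lt_or_eq with h | rfl
  · have := order (i - 1) (by omega) (by omega)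
    rw [Nat.sub_add_cancel h1] at this
    exact this.1.trans this.2
  · rw [Finset.Icc_self, Finset.sum_singleton, lev_self le_rfl, lev_zero] at connection
    linarith

/-- The combination of the constraints with the multipliers of a dual solution. It is homogeneous:
the normalisation `f + c = 1` is not needed. -/
theorem DualFeasible.sum_le {n : ℕ} {v qJ u : ℝ} {q r : ℕ → ℝ} (D : DualFeasible n v q qJ u r)
    (hn : 1 ≤ n) {f c : ℝ} {cl : ℕ → ℝ} (hf : 0 ≤ f) (hc : 0 ≤ c)
    (connection : ∑ l ∈ Finset.Icc 1 n, (lev n l - lev n (l - 1)) * cl l = c)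
    (order : ∀ i, 1 ≤ i → i < n → 0 ≤ cl i ∧ cl i ≤ cl (i + 1)) :
    ∑ k ∈ Finset.Ico 1 n, q k * (gam n k * f + ∑ l ∈ Finset.Icc 1 n, cl l * pr n k l +
      Real.exp (-gam n k) * (gam n k * c + (3 - gam n k) * cl (k + 1))) +
      qJ * (1.11 * f + 1.78 * c) ≤ v * (f + c) := by
  have cl_nonneg := profile_nonneg_of_order hc connection order
  have h1 : ∑ l ∈ Finset.Icc 1 n, cl l * ∑ k ∈ Finset.Ico 1 n, q k * (pr n k l +
        if l = k + 1 then Real.exp (-gam n k) * (3 - gam n k) else 0) ≤ u * c := by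
    have h2 : ∑ l ∈ Finset.Icc 1 n, cl l * ∑ k ∈ Finset.Ico 1 n, q k * (pr n k l +
        if l = k + 1 then Real.exp (-gam n k) * (3 - gam n k) else 0) ≤
        ∑ l ∈ Finset.Icc 1 n, (u * ((lev n l - lev n (l - 1)) * cl l) +
          cl l * (r l - r (l - 1))) := by
      refine Finset.sum_le_sum fun l hl => ?_
      rw [Finset.mem_Icc] at hl
      have := mul_le_mul_of_nonneg_left (D.col_cl l hl.1 hl.2) (cl_nonneg l hl.1 hl.2)
      linarith
    rw [Finset.sum_add_distrib, ← Finset.mul_sum, connection] at h2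
    have h3 := sum_mul_sub_pred_le D.r_zero D.r_nonneg (fun i h h' => (order i h h').2) hn le_rfl
    rw [D.r_last, mul_zero] at h3
    linarith
  have h4 : ∑ l ∈ Finset.Icc 1 n, cl l * ∑ k ∈ Finset.Ico 1 n, q k * (pr n k l +
        if l = k + 1 then Real.exp (-gam n k) * (3 - gam n k) else 0) =
      ∑ k ∈ Finset.Ico 1 n, q k * (∑ l ∈ Finset.Icc 1 n, cl l * pr n k l +
        Real.exp (-gam n k) * (3 - gam n k) * cl (k + 1)) := by
    simp only [Finset.mul_sum]
    rw [Finset.sum_comm]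
    refine Finset.sum_congr rfl fun k hk => ?_
    rw [Finset.mem_Ico] at hk
    have h5 : Real.exp (-gam n k) * (3 - gam n k) * cl (k + 1) = ∑ l ∈ Finset.Icc 1 n,
        if l = k + 1 then Real.exp (-gam n k) * (3 - gam n k) * cl l else 0 := by
      rw [Finset.sum_ite_eq', if_pos (Finset.mem_Icc.2 ⟨by omega, by omega⟩)]
    rw [h5, ← Finset.sum_add_distrib, Finset.mul_sum]
    refine Finset.sum_congr rfl fun l _ => ?_
    split_ifs <;> ring
  rw [h4] at h1
  have h6 := mul_le_mul_of_nonneg_right D.col_f hf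
  have h7 := mul_le_mul_of_nonneg_right D.col_c hc
  have h8 : ∑ k ∈ Finset.Ico 1 n, q k * (gam n k * f + ∑ l ∈ Finset.Icc 1 n, cl l * pr n k l +
      Real.exp (-gam n k) * (gam n k * c + (3 - gam n k) * cl (k + 1))) =
      (∑ k ∈ Finset.Ico 1 n, q k * gam n k) * f +
      (∑ k ∈ Finset.Ico 1 n, q k * (Real.exp (-gam n k) * gam n k)) * c +
      ∑ k ∈ Finset.Ico 1 n, q k * (∑ l ∈ Finset.Icc 1 n, cl l * pr n k l +
        Real.exp (-gam n k) * (3 - gam n k) * cl (k + 1)) := by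
    rw [Finset.sum_mul, Finset.sum_mul, ← Finset.sum_add_distrib, ← Finset.sum_add_distrib]
    exact Finset.sum_congr rfl fun k _ => by ring
  rw [h8]
  nlinarith

theorem LPFeasible.le_dual {n : ℕ} (hn : 1 ≤ n) {T f c : ℝ} {cl : ℕ → ℝ}
    (h : LPFeasible n T f c cl) {v qJ u : ℝ} {q r : ℕ → ℝ} (D : DualFeasible n v q qJ u r) :
    T ≤ v := by
  have h1 := D.sum_le hn h.f_nonneg h.c_nonneg h.connection h.order
  rw [h.total, mul_one] at h1
  refine le_trans ?_ h1
  calc T = ∑ k ∈ Finset.Ico 1 n, q k * T + qJ * T := by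
        rw [← Finset.sum_mul, ← add_mul, D.col_T, one_mul]
    _ ≤ _ := by
        refine add_le_add (Finset.sum_le_sum fun k hk => ?_)
          (mul_le_mul_of_nonneg_left h.jms D.qJ_nonneg)
        rw [Finset.mem_Ico] at hk
        exact mul_le_mul_of_nonneg_left (h.rounding k hk.1 hk.2) (D.q_nonneg k hk.1 hk.2)

theorem LPFeasible.le {n : ℕ} {T f c : ℝ} {cl : ℕ → ℝ} (h : LPFeasible n T f c cl) :
    T ≤ 1.78 := by
  linarith [h.jms, h.total, h.f_nonneg]

theorem LPFeasible.le_lpOpt {n : ℕ} {T f c : ℝ} {cl : ℕ → ℝ} (h : LPFeasible n T f c cl) :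
    T ≤ lpOpt n := by
  refine le_csSup ⟨1.78, ?_⟩ ⟨f, c, cl, h⟩
  rintro T' ⟨f', c', cl', h'⟩
  exact h'.le

theorem LPFeasible.le_lpOptCapped {n : ℕ} {T f c : ℝ} {cl : ℕ → ℝ} (h : LPFeasible n T f c cl)
    (hcap : ∀ i, 1 ≤ i → i < n → cl (i + 1) ≤ 1) : T ≤ lpOptCapped n := by
  refine le_csSup ⟨1.78, ?_⟩ ⟨f, c, cl, h, hcap⟩
  rintro T' ⟨f', c', cl', h', -⟩
  exact h'.le

/-! ### Combining independent runs -/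

theorem sum_prod_mul_apply {n : ℕ} {S : Fin n → Type*} [∀ l, Fintype (S l)]
    (p : ∀ l, S l → ℝ) (hp : ∀ l, ∑ s, p l s = 1) (l₀ : Fin n) (g : S l₀ → ℝ) :
    ∑ ω : ∀ l, S l, (∏ l, p l (ω l)) * g (ω l₀) = ∑ s, p l₀ s * g s := by
  classical
  set G : ∀ l, S l → ℝ := fun l s => if h : l = l₀ then g (h ▸ s) else 1 with hG
  have e1 : ∀ ω : ∀ l, S l, (∏ l, p l (ω l)) * g (ω l₀) = ∏ l, p l (ω l) * G l (ω l) := by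
    intro ω
    rw [Finset.prod_mul_distrib, Finset.prod_eq_single (f := fun l => G l (ω l)) l₀]
    · simp [hG]
    · intro l _ hl
      simp [hG, hl]
    · simp
  simp only [e1]
  rw [← Fintype.prod_sum (fun l s => p l s * G l s), Finset.prod_eq_single l₀]
  · simp [hG]
  · intro l _ hl
    simp [hG, hl, hp]
  · simp

theorem sum_prod_eq_one {n : ℕ} {S : Fin n → Type*} [∀ l, Fintype (S l)]
    (p : ∀ l, S l → ℝ) (hp : ∀ l, ∑ s, p l s = 1) :
    ∑ ω : ∀ l, S l, ∏ l, p l (ω l) = 1 := by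
  classical
  rw [← Fintype.prod_sum]
  exact Finset.prod_eq_one fun l _ => hp l

theorem sum_fin_ite_eq_sum_Ico {n : ℕ} (φ : ℕ → ℝ) :
    ∑ l : Fin n, (if (l : ℕ) + 1 < n then φ (l + 1) else 0) = ∑ k ∈ Finset.Ico 1 n, φ k := by
  rw [Fin.sum_univ_eq_sum_range (fun l => if l + 1 < n then φ (l + 1) else 0),
    Finset.sum_Ico_eq_sum_range, ← Finset.sum_filter]
  refine Finset.sum_congr ?_ fun k _ => by rw [add_comm]
  ext k
  simp only [Finset.mem_filter, Finset.mem_range]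
  omega

section Combined

variable {F C X : Type*} [PseudoMetricSpace X] [Fintype F] [DecidableEq F] [Fintype C]
  [DecidableEq C] {I : Instance F C X} {x : F → C → ℝ} {y : F → ℝ} {n : ℕ} {J : ℝ}
  (R : ∀ l : Fin n, CSRun I x y (gam n (l + 1)))

theorem expectedBest_le_jms : expectedBest J R ≤ J := by
  calc expectedBest J R ≤ ∑ ω : (∀ l, (R l).Sample), (∏ l, (R l).prob (ω l)) * J :=
        Finset.sum_le_sum fun ω _ => mul_le_mul_of_nonneg_left (min_le_left _ _)
          (Finset.prod_nonneg fun l _ => (R l).prob_nonneg _)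
    _ = J := by
        rw [← Finset.sum_mul, sum_prod_eq_one _ fun l => (R l).sum_prob, one_mul]

theorem expectedBest_le_run (l : Fin n) : expectedBest J R ≤ (R l).expectedCost := by
  calc expectedBest J R
      ≤ ∑ ω : (∀ l, (R l).Sample), (∏ l, (R l).prob (ω l)) * I.cost ((R l).opened (ω l)) :=
        Finset.sum_le_sum fun ω _ => mul_le_mul_of_nonneg_left
          ((min_le_right _ _).trans (ciInf_le (Set.finite_range _).bddBelow l))
          (Finset.prod_nonneg fun l _ => (R l).prob_nonneg _)
    _ = (R l).expectedCost :=
        sum_prod_mul_apply (fun l => (R l).prob) (fun l => (R l).sum_prob) l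
          fun ω => I.cost ((R l).opened ω)

theorem DualFeasible.expectedBest_le_expectedMixture {v qJ u : ℝ} {q r : ℕ → ℝ}
    (D : DualFeasible n v q qJ u r) : expectedBest J R ≤ expectedMixture J R q qJ := by
  have h1 : expectedBest J R =
      ∑ l : Fin n, (if (l : ℕ) + 1 < n then q (l + 1) * expectedBest J R else 0) +
        qJ * expectedBest J R := by
    rw [sum_fin_ite_eq_sum_Ico fun k => q k * expectedBest J R, ← Finset.sum_mul, ← add_mul,
      D.col_T, one_mul]
  rw [h1]
  refine add_le_add (Finset.sum_le_sum fun l _ => ?_)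
    (mul_le_mul_of_nonneg_left (expectedBest_le_jms R) D.qJ_nonneg)
  split_ifs with hl
  · exact mul_le_mul_of_nonneg_left (expectedBest_le_run R l) (D.q_nonneg _ (by omega) hl)
  · exact le_rfl

/-- The value of the dual solution bounds the cost of the mixture of the algorithms, because
the opening cost, the connection cost and the profile satisfy the constraints of the LP. -/
theorem DualFeasible.expectedMixture_le {v qJ u : ℝ} {q r : ℕ → ℝ} (hn : 1 ≤ n)
    (D : DualFeasible n v q qJ u r) (h : IsFractional x y)
    (hJ : J ≤ 1.11 * ∑ i, y i * I.openCost i + 1.78 * ∑ i, ∑ j, I.d i j * x i j) :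
    expectedMixture J R q qJ ≤ v * I.fracCost x y := by
  have h1 := D.sum_le hn (f := ∑ i, y i * I.openCost i)
    (Finset.sum_nonneg fun i _ => mul_nonneg (h.y_nonneg i) (I.openCost_nonneg i))
    (Finset.sum_nonneg fun i _ => Finset.sum_nonneg fun j _ =>
      mul_nonneg (I.d_nonneg i j) (h.x_nonneg i j)) (h.sum_profile hn) fun i h1 hi =>
      h.profile_order (I := I) h1 hi
  rw [Instance.fracCost, add_comm (∑ i, ∑ j, I.d i j * x i j)]
  refine le_trans ?_ h1
  rw [expectedMixture]
  refine add_le_add ?_ (mul_le_mul_of_nonneg_left hJ D.qJ_nonneg)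
  rw [← sum_fin_ite_eq_sum_Ico]
  refine Finset.sum_le_sum fun l _ => ?_
  split_ifs with hl
  · exact mul_le_mul_of_nonneg_left ((R l).expectedCost_le (by omega) hl h)
      (D.q_nonneg _ (by omega) hl)
  · exact le_rfl

/-- Scaling down all costs by the fractional optimum yields a feasible point of the LP. -/
theorem lpFeasible_of_pos (hn : 1 ≤ n) (h : IsFractional x y)
    (hJ : J ≤ 1.11 * ∑ i, y i * I.openCost i + 1.78 * ∑ i, ∑ j, I.d i j * x i j)
    (hZ : 0 < I.fracCost x y) :
    LPFeasible n (expectedBest J R / I.fracCost x y)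
      ((∑ i, y i * I.openCost i) / I.fracCost x y)
      ((∑ i, ∑ j, I.d i j * x i j) / I.fracCost x y)
      (fun l => I.profile x n l / I.fracCost x y) where
  rounding k h1 hk := by
    have hR := (expectedBest_le_run (J := J) R ⟨k - 1, by omega⟩)
    have e : k - 1 + 1 = k := by omega
    have hR' := hR.trans (((R ⟨k - 1, by omega⟩).expectedCost_le (by simp) (by simp; omega) h))
    simp only [e] at hR'
    rw [div_le_iff₀ hZ]
    refine hR'.trans_eq ?_
    have e2 : ∑ l ∈ Finset.Icc 1 n, I.profile x n l / I.fracCost x y * pr n k l =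
        (∑ l ∈ Finset.Icc 1 n, I.profile x n l * pr n k l) / I.fracCost x y := by
      rw [Finset.sum_div]
      exact Finset.sum_congr rfl fun l _ => by ring
    rw [e2]
    field_simp
  jms := by
    rw [div_le_iff₀ hZ]
    refine ((expectedBest_le_jms R).trans hJ).trans_eq ?_
    field_simp
  connection := by
    rw [← h.sum_profile hn, Finset.sum_div]
    exact Finset.sum_congr rfl fun l _ => by ring
  order i h1 hi := by
    have := h.profile_order (I := I) h1 hi
    exact ⟨div_nonneg this.1 hZ.le, div_le_div_of_nonneg_right this.2 hZ.le⟩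
  total := by
    rw [← add_div, add_comm]
    exact div_self hZ.ne'
  f_nonneg := div_nonneg
    (Finset.sum_nonneg fun i _ => mul_nonneg (h.y_nonneg i) (I.openCost_nonneg i)) hZ.le
  c_nonneg := div_nonneg (Finset.sum_nonneg fun i _ => Finset.sum_nonneg fun j _ =>
    mul_nonneg (I.d_nonneg i j) (h.x_nonneg i j)) hZ.le

theorem expectedBest_le_mul (h : IsFractional x y)
    (hJ : J ≤ 1.11 * ∑ i, y i * I.openCost i + 1.78 * ∑ i, ∑ j, I.d i j * x i j) {t : ℝ}
    (ht : 0 < I.fracCost x y → expectedBest J R / I.fracCost x y ≤ t) :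
    expectedBest J R ≤ t * I.fracCost x y := by
  have hF : 0 ≤ ∑ i, y i * I.openCost i :=
    Finset.sum_nonneg fun i _ => mul_nonneg (h.y_nonneg i) (I.openCost_nonneg i)
  have hC : 0 ≤ ∑ i, ∑ j, I.d i j * x i j := Finset.sum_nonneg fun i _ =>
    Finset.sum_nonneg fun j _ => mul_nonneg (I.d_nonneg i j) (h.x_nonneg i j)
  rcases (add_nonneg hC hF : 0 ≤ I.fracCost x y).eq_or_lt with hZ | hZ
  · have hZ' : I.fracCost x y = 0 := hZ.symm
    rw [hZ', mul_zero]
    linarith [expectedBest_le_jms (J := J) R]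
  · exact (div_le_iff₀ hZ).1 (ht hZ)

end Combined

theorem Instance.IsOptimalFractional.fracCost_le_cost {F C X : Type*} [PseudoMetricSpace X]
    [Fintype F] [Fintype C] {I : Instance F C X} {x : F → C → ℝ} {y : F → ℝ}
    (h : I.IsOptimalFractional x y) {S : Finset F} (hS : S.Nonempty) :
    I.fracCost x y ≤ I.cost S := by
  classical
  have near : ∀ j, ∃ i ∈ S, I.d i j = Metric.infDist (I.client j) (I.facility '' (S : Set F)) := by
    intro j
    obtain ⟨i, hi, hmin⟩ := S.exists_min_image (fun i => I.d i j) hS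
    refine ⟨i, hi, le_antisymm ?_ ?_⟩
    · rw [Metric.le_infDist ((Finset.coe_nonempty.2 hS).image _)]
      rintro _ ⟨i', hi', rfl⟩
      rw [dist_comm]
      exact hmin i' hi'
    · rw [Instance.d, dist_comm]
      exact Metric.infDist_le_dist_of_mem ⟨i, hi, rfl⟩
  choose σ hσ hd using near
  have hfrac : IsFractional (fun i j => if i = σ j then (1 : ℝ) else 0)
      (fun i => if i ∈ S then (1 : ℝ) else 0) := by
    refine ⟨fun j => by simp, fun i j => ?_, fun i j => ?_, fun i => ?_⟩
    · by_cases hi : i = σ j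
      · simp [hi, hσ]
      · simp only [hi, if_false]
        split_ifs <;> norm_num
    · split_ifs <;> norm_num
    · split_ifs <;> norm_num
  refine (h.2 _ _ hfrac).trans_eq ?_
  rw [Instance.fracCost, Instance.cost, add_comm, Finset.sum_comm]
  simp [hd]

end FacilityLocation

namespace FacilityLocation

/-! ### Attainment of the optimum of the factor revealing LP -/

theorem lpFeasible_one {n : ℕ} : LPFeasible n 1 1 0 (fun _ => 0) where
  rounding k _ hk := by simpa using one_le_gam hk.le
  jms := by norm_num
  connection := by simp
  order _ _ _ := ⟨le_rfl, le_rfl⟩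
  total := by norm_num
  f_nonneg := zero_le_one
  c_nonneg := le_rfl

theorem LPFeasible.truncate {n : ℕ} {T f c : ℝ} {cl : ℕ → ℝ} (h : LPFeasible n T f c cl) :
    LPFeasible n T f c (fun l => if l ∈ Finset.Icc 1 n then cl l else 0) where
  rounding k h1 hk := by
    refine (h.rounding k h1 hk).trans_eq ?_
    rw [if_pos (Finset.mem_Icc.2 ⟨by omega, by omega⟩)]
    congr 2
    exact Finset.sum_congr rfl fun l hl => by rw [if_pos hl]
  jms := h.jms
  connection := by
    rw [← h.connection]
    exact Finset.sum_congr rfl fun l hl => by rw [if_pos hl]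
  order i h1 hi := by
    rw [if_pos (Finset.mem_Icc.2 ⟨h1, hi.le⟩), if_pos (Finset.mem_Icc.2 ⟨by omega, hi⟩)]
    exact h.order i h1 hi
  total := h.total
  f_nonneg := h.f_nonneg
  c_nonneg := h.c_nonneg

theorem LPFeasible.cl_le {n : ℕ} {T f c : ℝ} {cl : ℕ → ℝ}
    (h : LPFeasible n T f c cl) {l : ℕ} (h1 : 1 ≤ l) (hl : l ≤ n) :
    cl l ≤ (lev n l - lev n (l - 1))⁻¹ := by
  have cl_nonneg := profile_nonneg_of_order h.c_nonneg h.connection h.order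
  have lev_diff : ∀ i, 1 ≤ i → i ≤ n → 0 < lev n i - lev n (i - 1) := fun i h1 hi =>
    sub_pos.2 (lev_lt_lev (by omega) hi)
  have h2 : (lev n l - lev n (l - 1)) * cl l ≤ 1 := by
    have h3 := Finset.single_le_sum (f := fun l => (lev n l - lev n (l - 1)) * cl l)
      (fun i hi => mul_nonneg (lev_diff i (Finset.mem_Icc.1 hi).1 (Finset.mem_Icc.1 hi).2).le
        (cl_nonneg i (Finset.mem_Icc.1 hi).1 (Finset.mem_Icc.1 hi).2)) (Finset.mem_Icc.2 ⟨h1, hl⟩)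
    rw [h.connection] at h3
    linarith [h.total, h.f_nonneg]
  rw [← one_div, le_div_iff₀' (lev_diff l h1 hl)]
  exact h2

theorem isClosed_lpFeasible (n : ℕ) :
    IsClosed {z : ℝ × ℝ × ℝ × (ℕ → ℝ) | LPFeasible n z.1 z.2.1 z.2.2.1 z.2.2.2} := by
  have e : {z : ℝ × ℝ × ℝ × (ℕ → ℝ) | LPFeasible n z.1 z.2.1 z.2.2.1 z.2.2.2} =
      {z | (∀ k, 1 ≤ k → k < n →
        z.1 ≤ gam n k * z.2.1 + ∑ l ∈ Finset.Icc 1 n, z.2.2.2 l * pr n k l +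
          Real.exp (-gam n k) * (gam n k * z.2.2.1 + (3 - gam n k) * z.2.2.2 (k + 1))) ∧
        z.1 ≤ 1.11 * z.2.1 + 1.78 * z.2.2.1 ∧
        ∑ l ∈ Finset.Icc 1 n, (lev n l - lev n (l - 1)) * z.2.2.2 l = z.2.2.1 ∧
        (∀ i, 1 ≤ i → i < n → 0 ≤ z.2.2.2 i ∧ z.2.2.2 i ≤ z.2.2.2 (i + 1)) ∧
        z.2.1 + z.2.2.1 = 1 ∧ 0 ≤ z.2.1 ∧ 0 ≤ z.2.2.1} := by
    ext z
    exact ⟨fun h => ⟨h.1, h.2, h.3, h.4, h.5, h.6, h.7⟩,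
      fun ⟨h1, h2, h3, h4, h5, h6, h7⟩ => ⟨h1, h2, h3, h4, h5, h6, h7⟩⟩
  rw [e]
  simp only [Set.ofPred_and, Set.ofPred_forall]
  refine IsClosed.inter ?_ (IsClosed.inter ?_ (IsClosed.inter ?_ (IsClosed.inter ?_
    (IsClosed.inter ?_ (IsClosed.inter ?_ ?_)))))
  · exact isClosed_iInter fun k => isClosed_iInter fun _ => isClosed_iInter fun _ =>
      isClosed_le (by fun_prop) (by fun_prop)
  · exact isClosed_le (by fun_prop) (by fun_prop)
  · exact isClosed_eq (by fun_prop) (by fun_prop)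
  · exact isClosed_iInter fun k => isClosed_iInter fun _ => isClosed_iInter fun _ =>
      (isClosed_le (by fun_prop) (by fun_prop)).inter (isClosed_le (by fun_prop) (by fun_prop))
  · exact isClosed_eq (by fun_prop) (by fun_prop)
  · exact isClosed_le (by fun_prop) (by fun_prop)
  · exact isClosed_le (by fun_prop) (by fun_prop)

/-- The factor revealing LP attains its optimum over every closed set of profiles that contains
`0` and in which the irrelevant entries can be set to `0`. -/
theorem exists_isGreatest_lp (n : ℕ) {E : Set (ℕ → ℝ)} (hE : IsClosed E)
    (h0 : (fun _ => 0) ∈ E)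
    (htr : ∀ cl ∈ E, (fun l => if l ∈ Finset.Icc 1 n then cl l else 0) ∈ E) :
    ∃ T, IsGreatest {T | ∃ f c cl, LPFeasible n T f c cl ∧ cl ∈ E} T := by
  set M : ℕ → ℝ := fun l => if l ∈ Finset.Icc 1 n then (lev n l - lev n (l - 1))⁻¹ else 0
  set K : Set (ℝ × ℝ × ℝ × (ℕ → ℝ)) := (Set.Icc 1 1.78 ×ˢ Set.Icc 0 1 ×ˢ Set.Icc 0 1 ×ˢ
    Set.pi Set.univ fun l => Set.Icc 0 (M l)) ∩
      ({z | LPFeasible n z.1 z.2.1 z.2.2.1 z.2.2.2} ∩ {z | z.2.2.2 ∈ E}) with hK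
  have K_compact : IsCompact K :=
    (isCompact_Icc.prod (isCompact_Icc.prod (isCompact_Icc.prod
      (isCompact_univ_pi fun l => isCompact_Icc)))).inter_right
      ((isClosed_lpFeasible n).inter (hE.preimage (by fun_prop)))
  have mem_K : ∀ T f c cl, LPFeasible n T f c cl → cl ∈ E → 1 ≤ T →
      (T, f, c, fun l => if l ∈ Finset.Icc 1 n then cl l else 0) ∈ K := by
    intro T f c cl h hcl hT
    have cl_nonneg := profile_nonneg_of_order h.c_nonneg h.connection h.order
    refine ⟨⟨⟨hT, h.le⟩, ⟨h.f_nonneg, by linarith [h.total, h.c_nonneg]⟩,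
      ⟨h.c_nonneg, by linarith [h.total, h.f_nonneg]⟩, fun l _ => ?_⟩, h.truncate, htr cl hcl⟩
    by_cases hl : l ∈ Finset.Icc 1 n
    · simp only [M, if_pos hl]
      rw [Finset.mem_Icc] at hl
      exact ⟨cl_nonneg l hl.1 hl.2, h.cl_le hl.1 hl.2⟩
    · simp only [M, if_neg hl, Set.mem_Icc, le_refl, and_self]
  obtain ⟨T, ⟨z, hz, rfl⟩, hmax⟩ := (K_compact.image continuous_fst).exists_isGreatest
    ⟨1, _, mem_K 1 1 0 _ lpFeasible_one h0 le_rfl, rfl⟩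
  refine ⟨z.1, ⟨_, _, _, hz.2.1, hz.2.2⟩, ?_⟩
  rintro T ⟨f, c, cl, h, hcl⟩
  rcases le_or_gt 1 T with hT | hT
  · exact hmax ⟨_, mem_K T f c cl h hcl hT, rfl⟩
  · exact hT.le.trans hz.1.1.1

theorem isGreatest_lpOpt (n : ℕ) : IsGreatest (lpValues n) (lpOpt n) := by
  obtain ⟨T, hT⟩ := exists_isGreatest_lp n isClosed_univ (Set.mem_univ _) fun _ _ => Set.mem_univ _
  have e : {T | ∃ f c cl, LPFeasible n T f c cl ∧ cl ∈ Set.univ} = lpValues n := by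
    simp [lpValues]
  rw [e] at hT
  rwa [lpOpt, hT.csSup_eq]

theorem isGreatest_lpOptCapped (n : ℕ) : IsGreatest (lpValuesCapped n) (lpOptCapped n) := by
  have closed : IsClosed {cl : ℕ → ℝ | ∀ i, 1 ≤ i → i < n → cl (i + 1) ≤ 1} := by
    simp only [Set.ofPred_forall]
    exact isClosed_iInter fun i => isClosed_iInter fun _ => isClosed_iInter fun _ =>
      isClosed_le (by fun_prop) (by fun_prop)
  obtain ⟨T, hT⟩ := exists_isGreatest_lp n closed (fun _ _ _ => zero_le_one)
    fun cl hcl i h1 hi => by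
      dsimp only
      split_ifs
      · exact hcl i h1 hi
      · exact zero_le_one
  have hT' : IsGreatest (lpValuesCapped n) T := hT
  rwa [lpOptCapped, hT'.csSup_eq]

/-! ### Strong duality -/

/-- The minimax theorem for matrix games: if every mixed strategy of the row player leaves the
column player an answer of payoff at most `V`, then some mixed strategy of the column player
guarantees a payoff of at most `V`. -/
theorem exists_mixed_strategy {α β : Type*} [Fintype α] [Nonempty α] [Fintype β]
    (M : α → β → ℝ) (V : ℝ)
    (h : ∀ p : α → ℝ, (∀ a, 0 ≤ p a) → ∑ a, p a = 1 → ∃ b, ∑ a, p a * M a b ≤ V) :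
    ∃ q : β → ℝ, (∀ b, 0 ≤ q b) ∧ ∑ b, q b = 1 ∧ ∀ a, ∑ b, q b * M a b ≤ V := by
  classical
  set P : Set (β → ℝ) := {z | ∃ p : α → ℝ, (∀ a, 0 ≤ p a) ∧ ∑ a, p a = 1 ∧
    z = fun b => ∑ a, p a * M a b} with hP
  set Q : Set (β → ℝ) := Set.pi Set.univ fun _ => Set.Ioi V with hQ
  have P_convex : Convex ℝ P := by
    rintro _ ⟨p, hp, hp1, rfl⟩ _ ⟨p', hp', hp1', rfl⟩ s t hs ht hst
    refine ⟨fun a => s * p a + t * p' a, fun a => add_nonneg (mul_nonneg hs (hp a))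
      (mul_nonneg ht (hp' a)), ?_, ?_⟩
    · rw [Finset.sum_add_distrib, ← Finset.mul_sum, ← Finset.mul_sum, hp1, hp1']
      linarith
    · ext b
      simp only [Pi.add_apply, Pi.smul_apply, smul_eq_mul, Finset.mul_sum]
      rw [← Finset.sum_add_distrib]
      exact Finset.sum_congr rfl fun a _ => by ring
  have Q_convex : Convex ℝ Q := convex_pi fun _ _ => convex_Ioi V
  have Q_open : IsOpen Q := isOpen_set_pi Set.finite_univ fun _ _ => isOpen_Ioi
  have disj : Disjoint Q P := by
    rw [Set.disjoint_left]
    rintro _ hz ⟨p, hp, hp1, rfl⟩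
    obtain ⟨b, hb⟩ := h p hp hp1
    exact absurd (hz b (Set.mem_univ b)) (not_lt.2 hb)
  obtain ⟨φ, s, hφQ, hφP⟩ := geometric_hahn_banach_open Q_convex Q_open P_convex disj
  -- the separating functional has the coefficients `-g b`
  set g : β → ℝ := fun b => -φ (Pi.single b 1) with hg
  have φ_eq : ∀ z, φ z = -∑ b, g b * z b := by
    intro z
    have : z = ∑ b, z b • (Pi.single b (1 : ℝ) : β → ℝ) := by
      ext b
      simp [Finset.sum_apply, Pi.single_apply]
    conv_lhs => rw [this]
    rw [map_sum, ← Finset.sum_neg_distrib]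
    refine Finset.sum_congr rfl fun b _ => ?_
    rw [map_smul, smul_eq_mul, hg]
    ring
  have hQ' : ∀ z : β → ℝ, (∀ b, V < z b) → -s < ∑ b, g b * z b := by
    intro z hz
    have := hφQ z fun b _ => hz b
    rw [φ_eq] at this
    linarith
  have hP' : ∀ a, ∑ b, g b * M a b ≤ -s := by
    intro a
    have := hφP (fun b => ∑ a', (if a' = a then 1 else 0) * M a' b) ⟨fun a' => if a' = a then 1 else 0,
      fun a' => by dsimp only; split_ifs <;> norm_num, by simp, rfl⟩
    rw [φ_eq] at this
    simp only [ite_mul, one_mul, zero_mul, Finset.sum_ite_eq', Finset.mem_univ, if_true] at this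
    linarith
  have g_nonneg : ∀ b, 0 ≤ g b := by
    intro b
    by_contra hb
    rw [not_le] at hb
    -- increasing the coordinate `b` of a point of `Q` contradicts the separation
    set A := ∑ b', g b' * (V + 1) with hA
    have h1 := hQ' (fun b' => V + 1 + if b' = b then max 0 ((-s - A) / g b) else 0) fun b' => by
      have : 0 ≤ if b' = b then max 0 ((-s - A) / g b) else 0 := by
        split_ifs
        · exact le_max_left _ _
        · exact le_rfl
      linarith
    have h2 : ∑ b', g b' * (V + 1 + if b' = b then max 0 ((-s - A) / g b) else 0) =
        A + g b * max 0 ((-s - A) / g b) := by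
      simp only [mul_add, Finset.sum_add_distrib, hA, mul_ite, mul_zero, Finset.sum_ite_eq',
        Finset.mem_univ, if_true]
    have h3 : g b * max 0 ((-s - A) / g b) ≤ -s - A := by
      refine (mul_le_mul_of_nonpos_left (le_max_right 0 _) hb.le).trans_eq ?_
      rw [mul_div_cancel₀ _ hb.ne]
    linarith
  have sum_pos : 0 < ∑ b, g b := by
    refine (Finset.sum_nonneg fun b _ => g_nonneg b).lt_of_ne fun h0 => ?_
    have hz : ∀ b, g b = 0 := fun b =>
      (Finset.sum_eq_zero_iff_of_nonneg fun b _ => g_nonneg b).1 h0.symm b (Finset.mem_univ b)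
    have h1 := hQ' (fun _ => V + 1) fun _ => by linarith
    have h2 := hP' (Classical.arbitrary α)
    simp only [hz, zero_mul, Finset.sum_const_zero] at h1 h2
    linarith
  have s_le : -s ≤ (∑ b, g b) * V := by
    refine le_of_forall_pos_le_add fun ε hε => ?_
    have h1 := hQ' (fun _ => V + ε / ∑ b, g b) fun _ => by linarith [div_pos hε sum_pos]
    rw [← Finset.sum_mul, mul_add, mul_div_cancel₀ _ sum_pos.ne'] at h1
    exact h1.le
  refine ⟨fun b => g b / ∑ b, g b, fun b => div_nonneg (g_nonneg b) sum_pos.le, ?_, fun a => ?_⟩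
  · rw [← Finset.sum_div, div_self sum_pos.ne']
  · have : ∑ b, g b / (∑ b, g b) * M a b = (∑ b, g b * M a b) / ∑ b, g b := by
      rw [Finset.sum_div]
      exact Finset.sum_congr rfl fun b _ => by ring
    rw [this, div_le_iff₀' sum_pos]
    exact (hP' a).trans s_le

theorem sum_Icc_succ_sub_pred (g : ℕ → ℝ) {i n : ℕ} (hi : i ≤ n) :
    ∑ l ∈ Finset.Icc (i + 1) n, (g l - g (l - 1)) = g n - g i := by
  induction n, hi using Nat.le_induction with
  | base => simp
  | succ n hn ih =>
    rw [Finset.sum_Icc_succ_top (by omega), ih, Nat.add_sub_cancel]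
    ring

/-- The coefficient of `cl l` in the rounding constraint of `k`. -/
noncomputable def clCoeff (n k l : ℕ) : ℝ :=
  pr n k l + if l = k + 1 then Real.exp (-gam n k) * (3 - gam n k) else 0

/-- The constraints of the dual LP, checked on the extreme rays of the cone of the primal solutions
`(f, c, cl)`: the ray `f`, and the rays of the threshold profiles `cl l = 1` for `l > i` and
`cl l = 0` for `l ≤ i`. -/
theorem mem_dualValues {n : ℕ} (hn : 1 ≤ n) {V qJ : ℝ} {q : ℕ → ℝ}
    (q_nonneg : ∀ k, 1 ≤ k → k < n → 0 ≤ q k) (qJ_nonneg : 0 ≤ qJ)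
    (sum_one : ∑ k ∈ Finset.Ico 1 n, q k + qJ = 1)
    (row_f : ∑ k ∈ Finset.Ico 1 n, q k * gam n k + 1.11 * qJ ≤ V)
    (row_cl : ∀ i < n, ∑ l ∈ Finset.Icc (i + 1) n, ∑ k ∈ Finset.Ico 1 n, q k * clCoeff n k l ≤
      (V - (∑ k ∈ Finset.Ico 1 n, q k * (Real.exp (-gam n k) * gam n k) + 1.78 * qJ)) *
        (1 - lev n i)) : V ∈ dualValues n := by
  set B := ∑ k ∈ Finset.Ico 1 n, q k * (Real.exp (-gam n k) * gam n k) + 1.78 * qJ with hB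
  set A : ℕ → ℝ := fun l => ∑ k ∈ Finset.Ico 1 n, q k * clCoeff n k l with hA
  set w : ℕ → ℝ := fun l => (V - B) * (lev n l - lev n (l - 1)) - A l with hw
  have tail : ∀ i < n, 0 ≤ ∑ l ∈ Finset.Icc (i + 1) n, w l := by
    intro i hi
    have h1 := row_cl i hi
    rw [hw, Finset.sum_sub_distrib, ← Finset.mul_sum, sum_Icc_succ_sub_pred _ hi.le, lev_self hn]
    linarith
  refine ⟨q, qJ, V - B, fun i => if i = 0 then 0 else ∑ l ∈ Finset.Icc (i + 1) n, w l, ?_⟩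
  refine ⟨q_nonneg, qJ_nonneg, fun i h1 hi => ?_, if_pos rfl, ?_, sum_one, row_f, ?_,
    fun i h1 hi => ?_⟩
  · rw [if_neg (by omega)]
    exact tail i hi
  · rw [if_neg (by omega), Finset.Icc_eq_empty (by omega), Finset.sum_empty]
  · linarith
  · have h2 : ∑ l ∈ Finset.Icc i n, w l = w i + ∑ l ∈ Finset.Icc (i + 1) n, w l := by
      rw [← Finset.insert_Icc_add_one_left_eq_Icc hi, Finset.sum_insert (by simp)]
    change A i ≤ _
    have h3 : A i = (V - B) * (lev n i - lev n (i - 1)) - w i := by rw [hw]; ring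
    rw [if_neg (by omega : i ≠ 0), h3]
    rcases h1.eq_or_lt with rfl | h1'
    · have := tail 0 (by omega)
      rw [zero_add] at this
      simp only [Nat.sub_self, if_true]
      linarith
    · rw [if_neg (by omega : i - 1 ≠ 0), Nat.sub_add_cancel h1]
      linarith

/-- Against every mixture of the extreme primal solutions, which is itself feasible, some algorithm
attains at most `lpOpt n`. By the minimax theorem, some mixture of the algorithms does so against
all of them. -/
theorem lpOpt_mem_dualValues {n : ℕ} (hn : 1 ≤ n) : lpOpt n ∈ dualValues n := by
  classical
  have lev_lt_one : ∀ i : Fin n, 0 < 1 - lev n i := fun i =>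
    sub_pos.2 ((lev_lt_lev i.2 le_rfl).trans_eq (lev_self hn))
  -- the rows are the extreme primal solutions with `f + c = 1`, the columns are the algorithms
  set M : Option (Fin n) → Option (Fin (n - 1)) → ℝ := fun a b => match a, b with
    | none, none => 1.11
    | none, some k => gam n (k + 1)
    | some _, none => 1.78
    | some i, some k => (∑ l ∈ Finset.Icc ((i : ℕ) + 1) n, clCoeff n (k + 1) l) / (1 - lev n i) +
        Real.exp (-gam n (k + 1)) * gam n (k + 1) with hM
  suffices h : ∀ p : Option (Fin n) → ℝ, (∀ a, 0 ≤ p a) → ∑ a, p a = 1 →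
      ∃ b, ∑ a, p a * M a b ≤ lpOpt n by
    obtain ⟨q, q_nonneg, q_sum, hq⟩ := exists_mixed_strategy M (lpOpt n) h
    set q' : ℕ → ℝ := fun k => if h : k - 1 < n - 1 then q (some ⟨k - 1, h⟩) else 0 with hq'
    have sum_q' : ∀ φ : ℕ → ℝ, ∑ k ∈ Finset.Ico 1 n, q' k * φ k =
        ∑ k : Fin (n - 1), q (some k) * φ (k + 1) := by
      intro φ
      rw [Finset.sum_Ico_eq_sum_range,
        ← Fin.sum_univ_eq_sum_range (fun k => q' (1 + k) * φ (1 + k))]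
      refine Finset.sum_congr rfl fun k _ => ?_
      simp [hq', add_comm 1]
    refine mem_dualValues hn (q := q') (qJ := q none) (fun k _ _ => ?_) (q_nonneg _) ?_ ?_ ?_
    · simp only [hq']
      split_ifs
      · exact q_nonneg _
      · exact le_rfl
    · have := sum_q' fun _ => 1
      simp only [mul_one] at this
      rw [this, ← q_sum, Fintype.sum_option]
      ring
    · rw [sum_q']
      have := hq none
      rw [Fintype.sum_option] at this
      simp only [hM] at this
      linarith
    · intro i hi
      have := hq (some ⟨i, hi⟩)
      rw [Fintype.sum_option] at this
      simp only [hM, mul_add, Finset.sum_add_distrib] at this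
      simp only [sum_q']
      rw [Finset.sum_comm, ← div_le_iff₀ (show 0 < 1 - lev n i from lev_lt_one ⟨i, hi⟩),
        Finset.sum_div]
      simp only [← Finset.mul_sum, mul_div_assoc]
      linarith
  intro p p_nonneg p_sum
  obtain ⟨b, -, hb⟩ := Finset.exists_min_image Finset.univ (fun b => ∑ a, p a * M a b)
    ⟨none, Finset.mem_univ _⟩
  refine ⟨b, ?_⟩
  set T := ∑ a, p a * M a b with hT
  rw [Fintype.sum_option] at p_sum
  set cl : ℕ → ℝ := fun l => ∑ i : Fin n, if (i : ℕ) + 1 ≤ l then p (some i) / (1 - lev n i) else 0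
    with hcl
  have sum_cl : ∀ g : ℕ → ℝ, ∑ l ∈ Finset.Icc 1 n, cl l * g l =
      ∑ i : Fin n, p (some i) * ((∑ l ∈ Finset.Icc ((i : ℕ) + 1) n, g l) / (1 - lev n i)) := by
    intro g
    simp only [hcl, Finset.sum_mul]
    rw [Finset.sum_comm]
    refine Finset.sum_congr rfl fun i _ => ?_
    have e : Finset.Icc ((i : ℕ) + 1) n = {l ∈ Finset.Icc 1 n | (i : ℕ) + 1 ≤ l} := by
      ext l
      simp only [Finset.mem_Icc, Finset.mem_filter]
      omega
    rw [e, Finset.sum_filter, Finset.sum_div, Finset.mul_sum]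
    refine Finset.sum_congr rfl fun l _ => ?_
    split_ifs
    · ring
    · simp
  have cl_term : ∀ i : Fin n, 0 ≤ p (some i) / (1 - lev n i) := fun i =>
    div_nonneg (p_nonneg _) (lev_lt_one i).le
  have feasible : LPFeasible n T (p none) (1 - p none) cl := by
    refine ⟨fun k h1 hk => ?_, ?_, ?_, fun i _ _ => ⟨?_, ?_⟩, by ring, p_nonneg _, ?_⟩
    · have h2 := hb (some ⟨k - 1, by omega⟩) (Finset.mem_univ _)
      rw [Fintype.sum_option] at h2
      simp only [hM, Nat.sub_add_cancel h1, mul_add, Finset.sum_add_distrib] at h2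
      rw [← sum_cl, ← Finset.sum_mul] at h2
      have h3 : ∑ l ∈ Finset.Icc 1 n, cl l * clCoeff n k l =
          ∑ l ∈ Finset.Icc 1 n, cl l * pr n k l +
            Real.exp (-gam n k) * (3 - gam n k) * cl (k + 1) := by
        simp only [clCoeff, mul_add, Finset.sum_add_distrib, mul_ite, mul_zero]
        rw [Finset.sum_ite_eq', if_pos (Finset.mem_Icc.2 ⟨by omega, by omega⟩)]
        ring
      have h4 : ∑ i, p (some i) = 1 - p none := by linarith
      rw [h3, h4] at h2
      linarith
    · have h2 := hb none (Finset.mem_univ _)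
      rw [Fintype.sum_option] at h2
      simp only [hM] at h2
      rw [← Finset.sum_mul] at h2
      have : ∑ i, p (some i) = 1 - p none := by linarith
      rw [this] at h2
      linarith
    · have h2 := sum_cl fun l => lev n l - lev n (l - 1)
      have h3 : ∀ i : Fin n, (∑ l ∈ Finset.Icc ((i : ℕ) + 1) n, (lev n l - lev n (l - 1))) /
          (1 - lev n i) = 1 := fun i => by
        rw [sum_Icc_succ_sub_pred _ i.2.le, lev_self hn, div_self (lev_lt_one i).ne']
      simp only [h3, mul_one] at h2
      rw [Finset.sum_congr rfl fun l _ => mul_comm _ _, h2]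
      linarith
    · exact Finset.sum_nonneg fun i _ => by
        split_ifs
        · exact cl_term i
        · exact le_rfl
    · refine Finset.sum_le_sum fun i' _ => ?_
      split_ifs
      · exact le_rfl
      · omega
      · exact cl_term i'
      · exact le_rfl
    · rw [← p_sum]
      have := Finset.sum_nonneg fun i (_ : i ∈ Finset.univ) => p_nonneg (some i)
      linarith
  exact feasible.le_lpOpt

theorem isLeast_dualValues {n : ℕ} (hn : 1 ≤ n) : IsLeast (dualValues n) (lpOpt n) := by
  refine ⟨lpOpt_mem_dualValues hn, ?_⟩
  rintro v ⟨q, qJ, u, r, D⟩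
  obtain ⟨f, c, cl, h⟩ := (isGreatest_lpOpt n).1
  exact h.le_dual hn D

end FacilityLocation

namespace FacilityLocation

/-! ### Existence of optimal fractional solutions -/

theorem Instance.exists_isOptimalFractional {F C X : Type*} [PseudoMetricSpace X] [Fintype F]
    [Nonempty F] [Fintype C] (I : Instance F C X) : ∃ x y, I.IsOptimalFractional x y := by
  classical
  set K : Set ((F → C → ℝ) × (F → ℝ)) := (Set.Icc 0 1 ×ˢ Set.Icc 0 1) ∩
    {z | (∀ j, ∑ i, z.1 i j = 1) ∧ ∀ i j, z.1 i j ≤ z.2 i}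
  have K_compact : IsCompact K := by
    refine (isCompact_Icc.prod isCompact_Icc).inter_right ?_
    simp only [Set.ofPred_and, Set.ofPred_forall]
    exact (isClosed_iInter fun j => isClosed_eq (by fun_prop) (by fun_prop)).inter
      (isClosed_iInter fun i => isClosed_iInter fun j => isClosed_le (by fun_prop) (by fun_prop))
  have K_nonempty : K.Nonempty := by
    obtain ⟨i₀⟩ := ‹Nonempty F›
    refine ⟨(fun i _ => if i = i₀ then 1 else 0, fun _ => 1), ⟨⟨⟨fun i j => ?_, fun i j => ?_⟩,
      ⟨fun _ => zero_le_one, fun _ => le_rfl⟩⟩, fun j => by simp, fun i j => ?_⟩⟩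
    all_goals
      dsimp
      split_ifs <;> norm_num
  obtain ⟨⟨x, y⟩, hz, hmin⟩ := K_compact.exists_isMinOn K_nonempty
    (f := fun z => I.fracCost z.1 z.2) (by unfold Instance.fracCost; fun_prop)
  refine ⟨x, y, ⟨hz.2.1, hz.2.2, fun i j => hz.1.1.1 i j, fun i => hz.1.2.1 i⟩,
    fun x' y' h => ?_⟩
  have x'_le : ∀ i j, x' i j ≤ 1 := fun i j => by
    rw [← h.sum_eq_one j]
    exact Finset.single_le_sum (f := fun i => x' i j) (fun i _ => h.x_nonneg i j)
      (Finset.mem_univ i)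
  -- openings larger than `1` can be reduced to `1`
  have h1 : I.fracCost x y ≤ I.fracCost x' fun i => min (y' i) 1 :=
    hmin (a := (x', fun i => min (y' i) 1)) ⟨⟨⟨fun i j => h.x_nonneg i j, fun i j => x'_le i j⟩,
      ⟨fun i => le_min (h.y_nonneg i) zero_le_one, fun i => min_le_right _ _⟩⟩, h.sum_eq_one,
      fun i j => le_min (h.le_open i j) (x'_le i j)⟩
  refine h1.trans (add_le_add le_rfl (Finset.sum_le_sum fun i _ => ?_))
  exact mul_le_mul_of_nonneg_right (min_le_left _ _) (I.openCost_nonneg i)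

/-! ### Existence of splittings -/

/-- A finite set of breakpoints divides an interval into gaps, where the gap `w b` ends at `b`. -/
theorem exists_gaps (B : Finset ℝ) (h0 : 0 ∈ B) :
    ∃ w : ℝ → ℝ, (∀ b ∈ B, 0 < b → 0 < w b ∧ ∀ b' ∈ B, b' < b → w b ≤ b - b') ∧
      ∀ z ∈ B, 0 ≤ z → ∑ b ∈ B with 0 < b ∧ b ≤ z, w b = z := by
  have exists_pred : ∀ b, 0 < b → ∃ p ∈ B, p < b ∧ 0 ≤ p ∧ ∀ b' ∈ B, b' < b → b' ≤ p := by
    intro b hb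
    obtain ⟨p, hp, hmax⟩ := ({b' ∈ B | b' < b}).exists_max_image id
      ⟨0, Finset.mem_filter.2 ⟨h0, hb⟩⟩
    rw [Finset.mem_filter] at hp
    exact ⟨p, hp.1, hp.2, hmax 0 (Finset.mem_filter.2 ⟨h0, hb⟩),
      fun b' h1 h2 => hmax b' (Finset.mem_filter.2 ⟨h1, h2⟩)⟩
  choose! p hpB hpb hp0 hpmax using exists_pred
  refine ⟨fun b => b - p b, fun b hb hb0 => ⟨sub_pos.2 (hpb b hb0), fun b' h1 h2 =>
    sub_le_sub_left (hpmax b hb0 b' h1 h2) b⟩, ?_⟩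
  suffices h : ∀ N, ∀ z ∈ B, 0 ≤ z → ({b ∈ B | b < z}).card ≤ N →
      ∑ b ∈ B with 0 < b ∧ b ≤ z, (b - p b) = z from fun z hz hz0 => h _ z hz hz0 le_rfl
  intro N
  induction N with
  | zero =>
    intro z hz hz0 hcard
    rcases hz0.eq_or_lt with rfl | hz0
    · exact Finset.sum_eq_zero fun b hb => by linarith [(Finset.mem_filter.1 hb).2]
    · rw [Nat.le_zero, Finset.card_eq_zero] at hcard
      have : (0 : ℝ) ∈ ({b ∈ B | b < z} : Finset ℝ) := Finset.mem_filter.2 ⟨h0, hz0⟩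
      rw [hcard] at this
      exact absurd this (Finset.notMem_empty _)
  | succ N ih =>
    intro z hz hz0 hcard
    rcases hz0.eq_or_lt with rfl | hz0
    · exact Finset.sum_eq_zero fun b hb => by linarith [(Finset.mem_filter.1 hb).2]
    have h1 := ih (p z) (hpB z hz0) (hp0 z hz0) (Nat.le_of_lt_succ (lt_of_lt_of_le
      (Finset.card_lt_card ?_) hcard))
    · have e : ({b ∈ B | 0 < b ∧ b ≤ z} : Finset ℝ) =
          insert z {b ∈ B | 0 < b ∧ b ≤ p z} := by
        ext b
        simp only [Finset.mem_filter, Finset.mem_insert]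
        constructor
        · rintro ⟨h1, h2, h3⟩
          rcases h3.eq_or_lt with rfl | h3
          · exact Or.inl rfl
          · exact Or.inr ⟨h1, h2, hpmax z hz0 b h1 h3⟩
        · rintro (rfl | ⟨h1, h2, h3⟩)
          · exact ⟨hz, hz0, le_rfl⟩
          · exact ⟨h1, h2, h3.trans (hpb z hz0).le⟩
      rw [e, Finset.sum_insert, h1]
      · ring
      · exact fun h => absurd (Finset.mem_filter.1 h).2.2 (not_le.2 (hpb z hz0))
    · refine ⟨fun b hb => ?_, fun hsub => ?_⟩
      · rw [Finset.mem_filter] at hb ⊢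
        exact ⟨hb.1, hb.2.trans (hpb z hz0)⟩
      · have := hsub (Finset.mem_filter.2 ⟨hpB z hz0, hpb z hz0⟩)
        exact absurd (Finset.mem_filter.1 this).2 (lt_irrefl _)

/-- A part of total size `s` of the supplies `X` that uses the supplies in the order of their
distances `d`. -/
theorem exists_greedy {ι : Type*} [DecidableEq ι] (X d : ι → ℝ) (hX : ∀ i, 0 ≤ X i) {s : ℝ}
    (hs : 0 ≤ s) (S : Finset ι) (hsum : s ≤ ∑ i ∈ S, X i) :
    ∃ t : ι → ℝ, (∀ i, 0 ≤ t i ∧ t i ≤ X i) ∧ ∑ i ∈ S, t i = s ∧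
      ∀ a ∈ S, ∀ b ∈ S, 0 < t a → t b < X b → d a ≤ d b := by
  induction S using Finset.induction_on_max_value d with
  | empty =>
    rw [Finset.sum_empty] at hsum
    exact ⟨fun _ => 0, fun i => ⟨le_rfl, hX i⟩, by simp; linarith, by simp⟩
  | insert a S ha hmax ih =>
    rw [Finset.sum_insert ha] at hsum
    rcases le_or_gt s (∑ i ∈ S, X i) with h | h
    · obtain ⟨t, ht, hts, htd⟩ := ih h
      refine ⟨fun i => if i = a then 0 else t i, fun i => ?_, ?_, ?_⟩
      · dsimp only
        split_ifs
        · exact ⟨le_rfl, hX i⟩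
        · exact ht i
      · rw [Finset.sum_insert ha, if_pos rfl, zero_add, ← hts]
        exact Finset.sum_congr rfl fun i hi => if_neg fun h : i = a => ha (h ▸ hi)
      · intro i hi i' hi' h1 h2
        by_cases hia : i = a
        · simp [hia] at h1
        have hiS := Finset.mem_of_mem_insert_of_ne hi hia
        by_cases hia' : i' = a
        · rw [hia']
          exact hmax i hiS
        · simp only [hia, hia', if_false] at h1 h2
          exact htd i hiS i' (Finset.mem_of_mem_insert_of_ne hi' hia') h1 h2
    · refine ⟨fun i => if i = a then s - ∑ i ∈ S, X i else X i, fun i => ?_, ?_, ?_⟩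
      · by_cases hia : i = a
        · subst hia
          simp only [if_true]
          exact ⟨by linarith, by linarith⟩
        · simp only [hia, if_false]
          exact ⟨hX i, le_rfl⟩
      · rw [Finset.sum_insert ha, if_pos rfl,
          Finset.sum_congr rfl fun i hi => if_neg fun h : i = a => ha (h ▸ hi)]
        ring
      · intro i hi i' hi' _ h2
        by_cases hia' : i' = a
        · rw [hia']
          rcases Finset.mem_insert.1 hi with rfl | hi
          · exact le_rfl
          · exact hmax i hi
        · simp [hia'] at h2

theorem IsFractional.nonempty_splitting {F C X : Type*} [PseudoMetricSpace X] [Fintype F]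
    [DecidableEq F] [Fintype C] {I : Instance F C X} {x : F → C → ℝ} {y : F → ℝ}
    (h : IsFractional x y) {γ : ℝ} (hγ : 1 ≤ γ) : Nonempty (Splitting I x y γ) := by
  classical
  have hγ0 : 0 ≤ γ := by linarith
  have cut := fun j => exists_greedy (fun i => γ * x i j) (fun i => I.d i j)
    (fun i => mul_nonneg hγ0 (h.x_nonneg i j)) zero_le_one Finset.univ
    (by rw [← Finset.mul_sum, h.sum_eq_one, mul_one]; exact hγ)
  choose t ht tsum td using cut
  -- the breakpoints for facility `i`; the natural numbers keep the copies small
  set B : F → Finset ℝ := fun i => insert (γ * y i)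
    ((Finset.range (⌈γ * y i⌉₊ + 1)).image (fun k : ℕ => (k : ℝ)) ∪
      Finset.univ.image (fun j => γ * x i j) ∪ Finset.univ.image (fun j => t j i)) with hB
  have B_nat : ∀ i, ∀ k ≤ ⌈γ * y i⌉₊, (k : ℝ) ∈ B i := fun i k hk => by
    refine Finset.mem_insert_of_mem (Finset.mem_union_left _ (Finset.mem_union_left _ ?_))
    exact Finset.mem_image_of_mem (fun k : ℕ => (k : ℝ))
      (Finset.mem_range.2 (Nat.lt_succ_of_le hk))
  have B_zero : ∀ i, 0 ∈ B i := fun i => by simpa using B_nat i 0 (Nat.zero_le _)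
  have B_top : ∀ i, γ * y i ∈ B i := fun i => Finset.mem_insert_self _ _
  have B_x : ∀ i j, γ * x i j ∈ B i := fun i j =>
    Finset.mem_insert_of_mem (Finset.mem_union_left _ (Finset.mem_union_right _
      (Finset.mem_image_of_mem (fun j => γ * x i j) (Finset.mem_univ j))))
  have B_t : ∀ i j, t j i ∈ B i := fun i j =>
    Finset.mem_insert_of_mem (Finset.mem_union_right _
      (Finset.mem_image_of_mem (fun j => t j i) (Finset.mem_univ j)))
  choose w hw wsum using fun i => exists_gaps (B i) (B_zero i)
  have x_le : ∀ i j, γ * x i j ≤ γ * y i := fun i j =>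
    mul_le_mul_of_nonneg_left (h.le_open i j) hγ0
  -- the copies are the pairs of a facility and a positive breakpoint
  set A : Finset (Σ _ : F, ℝ) := Finset.univ.sigma fun i => {b ∈ B i | 0 < b ∧ b ≤ γ * y i}
    with hA
  set z : Fin A.card → Σ _ : F, ℝ := fun a => (A.equivFin.symm a).1 with hz
  have z_mem : ∀ a, (z a).2 ∈ B (z a).1 ∧ 0 < (z a).2 ∧ (z a).2 ≤ γ * y (z a).1 := fun a =>
    Finset.mem_filter.1 (Finset.mem_sigma.1 (A.equivFin.symm a).2).2
  have sum_copies : ∀ (τ : F → ℝ) (g : F → ℝ), (∀ i, τ i ∈ B i) → (∀ i, 0 ≤ τ i) →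
      (∀ i, τ i ≤ γ * y i) →
      ∑ a, (if (z a).2 ≤ τ (z a).1 then w (z a).1 (z a).2 * g (z a).1 else 0) =
        ∑ i, τ i * g i := by
    intro τ g h1 h2 h3
    set G : (Σ _ : F, ℝ) → ℝ := fun v => if v.2 ≤ τ v.1 then w v.1 v.2 * g v.1 else 0
    change ∑ a, G (A.equivFin.symm a).1 = _
    rw [A.equivFin.symm.sum_comp (fun v : A => G v.1), Finset.sum_coe_sort A G, hA,
      Finset.sum_sigma]
    refine Finset.sum_congr rfl fun i _ => ?_
    rw [← Finset.sum_filter, Finset.filter_filter]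
    refine (Finset.sum_mul _ (w i) (g i)).symm.trans (congrArg (· * g i) ?_)
    refine Eq.trans (Finset.sum_congr ?_ fun _ _ => rfl) (wsum i (τ i) (h1 i) (h2 i))
    ext b
    simp only [Finset.mem_filter]
    exact ⟨fun h => ⟨h.1, h.2.1.1, h.2.2⟩, fun h => ⟨h.1, ⟨h.2.1, h.2.2.trans (h3 i)⟩, h.2.2⟩⟩
  refine ⟨{
    m := A.card
    orig := fun a => (z a).1
    w := fun a => w (z a).1 (z a).2
    w_pos := fun a => (hw _ _ (z_mem a).1 (z_mem a).2.1).1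
    w_le_one := fun a => ?_
    sum_orig := fun i => ?_
    nbhd := fun j => {a | (z a).2 ≤ γ * x (z a).1 j}
    sum_nbhd := fun i j => ?_
    close := fun j => {a | (z a).2 ≤ t j (z a).1}
    close_subset := fun j a ha => ?_
    sum_close := fun j => ?_
    close_le := fun j a ha b hb hb' => ?_ }⟩
  · obtain ⟨h1, h2, h3⟩ := z_mem a
    -- the largest natural number below the breakpoint is also a breakpoint
    have hpos : 0 < ⌈(z a).2⌉₊ := Nat.ceil_pos.2 h2
    have hcast : ((⌈(z a).2⌉₊ - 1 : ℕ) : ℝ) = ⌈(z a).2⌉₊ - 1 := by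
      rw [Nat.cast_sub hpos, Nat.cast_one]
    have hlt : ((⌈(z a).2⌉₊ - 1 : ℕ) : ℝ) < (z a).2 := by
      rw [hcast]
      linarith [Nat.ceil_lt_add_one h2.le]
    have := (hw _ _ h1 h2).2 _ (B_nat _ (⌈(z a).2⌉₊ - 1)
      ((Nat.sub_le _ _).trans (Nat.ceil_le_ceil h3))) hlt
    rw [hcast] at this
    linarith [Nat.le_ceil (z a).2]
  · have := sum_copies (fun i => γ * y i) (fun i' => if i' = i then 1 else 0) B_top
      (fun i => mul_nonneg hγ0 (h.y_nonneg i)) fun i => le_rfl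
    simp only [(z_mem _).2.2, if_true, mul_ite, mul_one, mul_zero, Finset.sum_ite_eq',
      Finset.mem_univ] at this
    rw [Finset.sum_filter, this]
  · have := sum_copies (fun i => γ * x i j) (fun i' => if i' = i then 1 else 0) (B_x · j)
      (fun i => mul_nonneg hγ0 (h.x_nonneg i j)) (x_le · j)
    simp only [mul_ite, mul_one, mul_zero, Finset.sum_ite_eq', Finset.mem_univ, if_true] at this
    rw [Finset.sum_filter, Finset.sum_filter, this]
  · simp only [Finset.mem_filter, Finset.mem_univ, true_and] at ha ⊢
    exact ha.trans (ht j _).2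
  · have := sum_copies (fun i => t j i) (fun _ => 1) (B_t · j)
      (fun i => (ht j i).1) fun i => (ht j i).2.trans (x_le i j)
    simp only [mul_one, tsum] at this
    rw [Finset.sum_filter, this]
  · simp only [Finset.mem_filter, Finset.mem_univ, true_and, not_le] at ha hb hb'
    exact td j _ (Finset.mem_univ _) _ (Finset.mem_univ _) ((z_mem a).2.1.trans_le ha)
      (hb'.trans_le hb)

theorem IsFractional.nonempty_csRun {F C X : Type*} [PseudoMetricSpace X] [Fintype F]
    [DecidableEq F] [Fintype C] [DecidableEq C] {I : Instance F C X} {x : F → C → ℝ} {y : F → ℝ}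
    (h : IsFractional x y) {γ : ℝ} (hγ : 1 ≤ γ) : Nonempty (CSRun I x y γ) := by
  obtain ⟨P⟩ := h.nonempty_splitting (I := I) hγ
  obtain ⟨L, hL⟩ := P.exists_clustering Finset.univ
  exact ⟨{ P with centers := L, clustering := hL }⟩

end FacilityLocation

namespace FacilityLocation

/-! ### Distributions over the scaling parameters -/

/-- The distribution function of a measure on the scaling parameters: mass `θ` at `a`, and density
`ρ` on the interval from `a` to `b`. -/
noncomputable def paramCdf (a b θ ρ γ : ℝ) : ℝ := if γ < a then 0 else θ + ρ * (min γ b - a)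

/-- The discretized measure: `γ_k` receives the mass of the interval from `γ_{k+1}` to `γ_k`. -/
noncomputable def paramWeight (a b θ ρ : ℝ) (n k : ℕ) : ℝ :=
  paramCdf a b θ ρ (gam n k) - paramCdf a b θ ρ (gam n (k + 1))

theorem sum_Ico_sub_succ (g : ℕ → ℝ) {n : ℕ} (hn : 1 ≤ n) :
    ∑ k ∈ Finset.Ico 1 n, (g k - g (k + 1)) = g 1 - g n := by
  induction n, hn using Nat.le_induction with
  | base => simp
  | succ n hn ih =>
    rw [Finset.sum_Ico_succ_top hn, ih]
    ring

theorem paramCdf_mono {a b θ ρ : ℝ} (hθ : 0 ≤ θ) (hρ : 0 ≤ ρ) (hab : a ≤ b) :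
    Monotone (paramCdf a b θ ρ) := by
  intro x y hxy
  unfold paramCdf
  split_ifs with h1 h2
  · exact le_rfl
  · exact add_nonneg hθ (mul_nonneg hρ (sub_nonneg.2 (le_min (not_lt.1 h2) hab)))
  · exact absurd (hxy.trans_lt (by assumption)) h1
  · gcongr

theorem paramWeight_nonneg {a b θ ρ : ℝ} (hθ : 0 ≤ θ) (hρ : 0 ≤ ρ) (hab : a ≤ b) {n k : ℕ}
    (hk : k < n) : 0 ≤ paramWeight a b θ ρ n k :=
  sub_nonneg.2 (paramCdf_mono hθ hρ hab (gam_lt_gam (Nat.lt_succ_self k) hk).le)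

theorem paramWeight_of_lt {a b θ ρ : ℝ} {n k : ℕ} (hk : k < n) (h : gam n k < a) :
    paramWeight a b θ ρ n k = 0 := by
  rw [paramWeight, paramCdf, paramCdf, if_pos h,
    if_pos ((gam_lt_gam (Nat.lt_succ_self k) hk).trans h), sub_zero]

theorem sum_paramWeight {a b θ ρ : ℝ} {n : ℕ} (hn : 1 ≤ n) (ha : 1 < a) (hab : a ≤ b)
    (hb : b ≤ gam n 1) : ∑ k ∈ Finset.Ico 1 n, paramWeight a b θ ρ n k = θ + ρ * (b - a) := by
  unfold paramWeight
  rw [sum_Ico_sub_succ (fun k => paramCdf a b θ ρ (gam n k)) hn, gam_self]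
  simp only [paramCdf]
  rw [if_pos ha, if_neg (not_lt.2 (hab.trans hb)), min_eq_right hb, sub_zero]

/-- A sum over the discretized measure is at most the corresponding integral, given by an
antiderivative `P`, if the summand is at most the integrand on each of the intervals of the
discretization. -/
theorem sum_paramWeight_mul_le {a b θ ρ : ℝ} (hθ : 0 ≤ θ) (hρ : 0 ≤ ρ) {n : ℕ} (hn : 1 ≤ n)
    (ha : 1 < a) (hab : a ≤ b) (hb : b ≤ gam n 1) {c : ℕ → ℝ} {P : ℝ → ℝ} {A : ℝ}
    (hA : ∀ k ∈ Finset.Ico 1 n, gam n (k + 1) < a → a ≤ gam n k → c k ≤ A)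
    (hP : ∀ k ∈ Finset.Ico 1 n, ∀ x y, a ≤ x → x ≤ y → y ≤ b → gam n (k + 1) ≤ x → y ≤ gam n k →
      c k * (y - x) ≤ P y - P x) :
    ∑ k ∈ Finset.Ico 1 n, paramWeight a b θ ρ n k * c k ≤ θ * A + ρ * (P b - P a) := by
  set Φ : ℝ → ℝ := fun γ => if γ < a then 0 else θ * A + ρ * (P (min γ b) - P a) with hΦ
  have term : ∀ k ∈ Finset.Ico 1 n, paramWeight a b θ ρ n k * c k ≤
      Φ (gam n k) - Φ (gam n (k + 1)) := by
    intro k hk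
    have hA' := hA k hk
    have hP' := hP k hk
    rw [Finset.mem_Ico] at hk
    have hxy := gam_lt_gam (Nat.lt_succ_self k) hk.2
    rcases lt_or_ge (gam n k) a with hy | hy
    · rw [paramWeight_of_lt hk.2 hy]
      simp only [hΦ, if_pos hy, if_pos (hxy.trans hy)]
      simp
    have hy' : a ≤ min (gam n k) b := le_min hy hab
    rw [paramWeight, paramCdf, paramCdf]
    simp only [hΦ, if_neg (not_lt.2 hy)]
    rcases lt_or_ge (gam n (k + 1)) a with hx | hx
    · rw [if_pos hx, if_pos hx]
      have h1 := mul_le_mul_of_nonneg_left (hA' hx hy) hθ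
      have h2 := mul_le_mul_of_nonneg_left
        (hP' a _ le_rfl hy' (min_le_right _ _) hx.le (min_le_left _ _)) hρ
      nlinarith
    · rw [if_neg (not_lt.2 hx), if_neg (not_lt.2 hx)]
      rcases le_or_gt (gam n (k + 1)) b with hxb | hxb
      · rw [min_eq_left hxb]
        have h2 := mul_le_mul_of_nonneg_left (hP' _ _ hx (le_min hxy.le hxb) (min_le_right _ _)
          le_rfl (min_le_left _ _)) hρ
        nlinarith
      · rw [min_eq_right hxb.le, min_eq_right (hxb.trans hxy).le]
        simp
  refine (Finset.sum_le_sum term).trans_eq ?_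
  rw [sum_Ico_sub_succ (fun k => Φ (gam n k)) hn, gam_self]
  simp only [hΦ]
  rw [if_pos ha, if_neg (not_lt.2 (hab.trans hb)), min_eq_right hb, sub_zero]

theorem mul_sub_le_of_hasDerivAt {P ψ : ℝ → ℝ} {c x y : ℝ} (hxy : x ≤ y)
    (hP : ∀ z ∈ Set.Icc x y, HasDerivAt P (ψ z) z) (hc : ∀ z ∈ Set.Icc x y, c ≤ ψ z) :
    c * (y - x) ≤ P y - P x := by
  refine (convex_Icc x y).mul_sub_le_image_sub_of_le_deriv
    (fun z hz => (hP z hz).continuousAt.continuousWithinAt)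
    (fun z hz => (hP z (interior_subset hz)).differentiableAt.differentiableWithinAt)
    (fun z hz => ?_) x (Set.left_mem_Icc.2 hxy) y (Set.right_mem_Icc.2 hxy) hxy
  rw [(hP z (interior_subset hz)).deriv]
  exact hc z (interior_subset hz)

/-- The same bound if the summand is at most a single function `ψ` with antiderivative `P`. -/
theorem sum_paramWeight_mul_le_of_hasDerivAt {a b θ ρ : ℝ} (hθ : 0 ≤ θ) (hρ : 0 ≤ ρ) {n : ℕ}
    (hn : 1 ≤ n) (ha : 1 < a) (hab : a ≤ b) (hb : b ≤ gam n 1) {c : ℕ → ℝ} {P ψ : ℝ → ℝ}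
    (hP : ∀ z, HasDerivAt P (ψ z) z)
    (hc : ∀ k ∈ Finset.Ico 1 n, ∀ z, a ≤ z → gam n (k + 1) ≤ z → z ≤ gam n k → c k ≤ ψ z) :
    ∑ k ∈ Finset.Ico 1 n, paramWeight a b θ ρ n k * c k ≤ θ * ψ a + ρ * (P b - P a) :=
  sum_paramWeight_mul_le hθ hρ hn ha hab hb (fun k hk h1 h2 => hc k hk a le_rfl h1.le h2)
    fun k hk _ _ hx hxy _ hkx hyk => mul_sub_le_of_hasDerivAt hxy (fun z _ => hP z)
      fun z hz => hc k hk z (hx.trans hz.1) (hkx.trans hz.1) (hz.2.trans hyk)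

theorem gam_sub_gam_succ {n k : ℕ} (hn : 1 ≤ n) : gam n k - gam n (k + 1) = 2 / n := by
  have : (n : ℝ) ≠ 0 := by positivity
  unfold gam
  push_cast
  field_simp
  ring

/-! ### Derivatives and bounds of exponential functions -/

theorem hasDerivAt_exp_neg_mul (t z : ℝ) :
    HasDerivAt (fun z => Real.exp (-(z * t))) (-t * Real.exp (-(z * t))) z := by
  have h := ((hasDerivAt_id' z).mul_const t).fun_neg.exp
  exact h.congr_deriv (by ring)

theorem hasDerivAt_exp_neg (z : ℝ) :
    HasDerivAt (fun z => Real.exp (-z)) (-Real.exp (-z)) z := by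
  simpa using hasDerivAt_exp_neg_mul 1 z

theorem hasDerivAt_sub_two_mul_exp_neg (z : ℝ) :
    HasDerivAt (fun z => (z - 2) * Real.exp (-z)) ((3 - z) * Real.exp (-z)) z := by
  have h := ((hasDerivAt_id' z).sub_const 2).fun_mul (hasDerivAt_exp_neg z)
  exact h.congr_deriv (by ring)

theorem hasDerivAt_neg_add_one_mul_exp_neg (z : ℝ) :
    HasDerivAt (fun z => -((z + 1) * Real.exp (-z))) (z * Real.exp (-z)) z := by
  have h := (((hasDerivAt_id' z).add_const 1).fun_mul (hasDerivAt_exp_neg z)).fun_neg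
  exact h.congr_deriv (by ring)

theorem exp_neg_le_exp_neg_add {x y : ℝ} (h : x ≤ y) (hx : 0 ≤ x) :
    Real.exp (-x) ≤ Real.exp (-y) + (y - x) := by
  have h1 : Real.exp (-y) = Real.exp (-x) * Real.exp (-(y - x)) := by
    rw [← Real.exp_add]
    ring_nf
  have h2 := Real.one_sub_le_exp_neg (y - x)
  have h3 : Real.exp (-x) ≤ 1 := Real.exp_le_one_iff.2 (by linarith)
  rw [h1]
  nlinarith [mul_le_mul_of_nonneg_left h2 (Real.exp_nonneg (-x))]

theorem mul_exp_neg_le {x y : ℝ} (h : x ≤ y) (hx : 1 ≤ x) :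
    y * Real.exp (-y) ≤ x * Real.exp (-x) := by
  have h1 : Real.exp (-x) = Real.exp (-y) * Real.exp (y - x) := by
    rw [← Real.exp_add]
    ring_nf
  have h2 := Real.add_one_le_exp (y - x)
  have h3 : y ≤ x * Real.exp (y - x) := by nlinarith
  rw [h1]
  nlinarith [Real.exp_pos (-y)]

theorem three_sub_mul_exp_neg_le {x y : ℝ} (h : x ≤ y) (hx : x ≤ 3) :
    (3 - y) * Real.exp (-y) ≤ (3 - x) * Real.exp (-x) := by
  have h1 : Real.exp (-y) ≤ Real.exp (-x) := Real.exp_le_exp.2 (by linarith)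
  calc (3 - y) * Real.exp (-y) ≤ (3 - x) * Real.exp (-y) := by
        nlinarith [Real.exp_pos (-y)]
    _ ≤ _ := mul_le_mul_of_nonneg_left h1 (by linarith)

/-- As a function of `1 / g`, the antiderivative `(g - 2) * exp (-g)` is concave for the relevant
`g`, and so it is below its tangents. -/
theorem sub_two_mul_exp_neg_le_tangent {g m : ℝ} (hg : g ∈ Set.Icc (1.3 : ℝ) 2.1)
    (hm : m ∈ Set.Icc (1.3 : ℝ) 2.1) :
    (g - 2) * Real.exp (-g) ≤
      (m - 2) * Real.exp (-m) - m ^ 2 * (3 - m) * Real.exp (-m) * (1 / g - 1 / m) := by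
  set Q : ℝ → ℝ := fun g => g ^ 2 * (3 - g) * Real.exp (-g) with hQ
  have Q_anti : AntitoneOn Q (Set.Icc 1.3 2.1) := by
    have hder : ∀ z, HasDerivAt Q (z * (z ^ 2 - 6 * z + 6) * Real.exp (-z)) z := by
      intro z
      have h := ((((hasDerivAt_id' z).fun_pow 2).fun_mul ((hasDerivAt_id' z).const_sub 3)).fun_mul
        (hasDerivAt_exp_neg z))
      exact h.congr_deriv (by ring)
    refine antitoneOn_of_deriv_nonpos (convex_Icc _ _)
      (fun z _ => (hder z).continuousAt.continuousWithinAt)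
      (fun z _ => (hder z).differentiableAt.differentiableWithinAt) fun z hz => ?_
    rw [(hder z).deriv]
    have hz' := interior_subset hz
    have h1 : z ^ 2 - 6 * z + 6 ≤ 0 := by nlinarith [hz'.1, hz'.2]
    exact mul_nonpos_of_nonpos_of_nonneg
      (mul_nonpos_of_nonneg_of_nonpos (by linarith [hz'.1]) h1) (Real.exp_nonneg _)
  set G : ℝ → ℝ := fun g => (g - 2) * Real.exp (-g) + Q m * g⁻¹ with hG
  have G_der : ∀ z, 0 < z → HasDerivAt G ((Q z - Q m) / z ^ 2) z := by
    intro z hz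
    have h := (hasDerivAt_sub_two_mul_exp_neg z).fun_add ((hasDerivAt_inv hz.ne').const_mul (Q m))
    refine h.congr_deriv ?_
    simp only [hQ]
    field_simp
    ring
  have key : G g ≤ G m := by
    rcases le_total g m with hgm | hgm
    · have hsub : Set.Icc g m ⊆ Set.Icc 1.3 2.1 := Set.Icc_subset_Icc hg.1 hm.2
      have pos : ∀ z ∈ Set.Icc g m, 0 < z := fun z hz => by linarith [(hsub hz).1]
      refine monotoneOn_of_deriv_nonneg (convex_Icc g m)
        (fun z hz => (G_der z (pos z hz)).continuousAt.continuousWithinAt)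
        (fun z hz => (G_der z (pos z (interior_subset hz))).differentiableAt.differentiableWithinAt)
        (fun z hz => ?_) (Set.left_mem_Icc.2 hgm) (Set.right_mem_Icc.2 hgm) hgm
      have hz' := interior_subset hz
      rw [(G_der z (pos z hz')).deriv]
      exact div_nonneg (sub_nonneg.2 (Q_anti (hsub hz') hm hz'.2)) (sq_nonneg z)
    · have hsub : Set.Icc m g ⊆ Set.Icc 1.3 2.1 := Set.Icc_subset_Icc hm.1 hg.2
      have pos : ∀ z ∈ Set.Icc m g, 0 < z := fun z hz => by linarith [(hsub hz).1]
      refine antitoneOn_of_deriv_nonpos (convex_Icc m g)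
        (fun z hz => (G_der z (pos z hz)).continuousAt.continuousWithinAt)
        (fun z hz => (G_der z (pos z (interior_subset hz))).differentiableAt.differentiableWithinAt)
        (fun z hz => ?_) (Set.left_mem_Icc.2 hgm) (Set.right_mem_Icc.2 hgm) hgm
      have hz' := interior_subset hz
      rw [(G_der z (pos z hz')).deriv]
      exact div_nonpos_of_nonpos_of_nonneg (sub_nonpos.2 (Q_anti hm (hsub hz') hz'.1)) (sq_nonneg z)
  simp only [hG, hQ] at key
  simp only [one_div]
  linarith

theorem convexOn_sum_mul_exp (s : Finset ℕ) {q g : ℕ → ℝ} (hq : ∀ k ∈ s, 0 ≤ q k) (α β : ℝ) :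
    ConvexOn ℝ Set.univ fun t => ∑ k ∈ s, q k * Real.exp (-(g k * t)) + (α + β * t) := by
  refine ⟨convex_univ, fun x _ y _ u v hu hv huv => ?_⟩
  simp only [smul_eq_mul]
  have h : ∑ k ∈ s, q k * Real.exp (-(g k * (u * x + v * y))) ≤
      u * ∑ k ∈ s, q k * Real.exp (-(g k * x)) + v * ∑ k ∈ s, q k * Real.exp (-(g k * y)) := by
    rw [Finset.mul_sum, Finset.mul_sum, ← Finset.sum_add_distrib]
    refine Finset.sum_le_sum fun k hk => ?_
    have h1 := convexOn_exp.2 (Set.mem_univ (-(g k * x))) (Set.mem_univ (-(g k * y))) hu hv huv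
    simp only [smul_eq_mul] at h1
    have h2 := mul_le_mul_of_nonneg_left h1 (hq k hk)
    rw [show u * -(g k * x) + v * -(g k * y) = -(g k * (u * x + v * y)) by ring] at h2
    linarith
  have h3 : α + β * (u * x + v * y) = u * (α + β * x) + v * (α + β * y) := by
    linear_combination -α * huv
  rw [h3]
  linarith

end FacilityLocation

namespace FacilityLocation

/-! ### Numerical bounds of exponentials -/

/-- The Taylor polynomial of `exp (-y)` of degree `9`. -/
noncomputable def expNegTaylor (y : ℝ) : ℝ :=
  1 - y * (1 - y / 2 * (1 - y / 3 * (1 - y / 4 * (1 - y / 5 * (1 - y / 6 * (1 - y / 7 *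
    (1 - y / 8 * (1 - y / 9))))))))

theorem exp_neg_mem {x y l u : ℝ} (hx : x = 4 * y) (h0 : 0 ≤ y) (h1 : y ≤ 1)
    (hpos : 0 ≤ expNegTaylor y - y ^ 10) (hl : l ≤ (expNegTaylor y - y ^ 10 / 3000000) ^ 4)
    (hu : (expNegTaylor y + y ^ 10 / 3000000) ^ 4 ≤ u) :
    l ≤ Real.exp (-x) ∧ Real.exp (-x) ≤ u := by
  have h := Real.exp_bound (x := -y) (by rwa [abs_neg, abs_of_nonneg h0]) (n := 10) (by norm_num)
  have e1 : ∑ m ∈ Finset.range 10, (-y) ^ m / (m.factorial : ℝ) = expNegTaylor y := by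
    simp only [Finset.sum_range_succ, Finset.sum_range_zero, Nat.factorial, expNegTaylor]
    push_cast
    ring
  rw [e1, abs_neg, abs_of_nonneg h0, abs_le] at h
  have hy : 0 ≤ y ^ 10 := pow_nonneg h0 10
  have e2 : y ^ 10 * (((10 : ℕ).succ : ℝ) / (((10 : ℕ).factorial : ℝ) * (10 : ℕ))) ≤
      y ^ 10 / 3000000 := by
    rw [div_eq_mul_inv]
    refine mul_le_mul_of_nonneg_left ?_ hy
    norm_num [Nat.factorial]
  have e3 : Real.exp (-x) = Real.exp (-y) ^ 4 := by
    rw [← Real.exp_nat_mul, hx]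
    norm_num
  rw [e3]
  exact ⟨hl.trans (pow_le_pow_left₀ (by linarith) (by linarith [h.1]) 4),
    (pow_le_pow_left₀ (Real.exp_nonneg _) (by linarith [h.2]) 4).trans hu⟩

theorem exp_neg_1_4793 : 0.22779708 ≤ Real.exp (-1.4793) ∧
    Real.exp (-1.4793) ≤ 0.22779710 := by
  refine exp_neg_mem (y := 0.369825) ?_ ?_ ?_ ?_ ?_ ?_ <;> norm_num [expNegTaylor]

theorem exp_neg_2_0165 : 0.13312057 ≤ Real.exp (-2.0165) ∧
    Real.exp (-2.0165) ≤ 0.13312058 := by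
  refine exp_neg_mem (y := 0.504125) ?_ ?_ ?_ ?_ ?_ ?_ <;> norm_num [expNegTaylor]

theorem exp_neg_1_99 : 0.13669542 ≤ Real.exp (-1.99) ∧
    Real.exp (-1.99) ≤ 0.13669543 := by
  refine exp_neg_mem (y := 0.4975) ?_ ?_ ?_ ?_ ?_ ?_ <;> norm_num [expNegTaylor]

theorem exp_neg_1_95 : 0.14227406 ≤ Real.exp (-1.95) ∧
    Real.exp (-1.95) ≤ 0.14227408 := by
  refine exp_neg_mem (y := 0.4875) ?_ ?_ ?_ ?_ ?_ ?_ <;> norm_num [expNegTaylor]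

theorem exp_neg_1_88 : 0.15259010 ≤ Real.exp (-1.88) ∧
    Real.exp (-1.88) ≤ 0.15259011 := by
  refine exp_neg_mem (y := 0.47) ?_ ?_ ?_ ?_ ?_ ?_ <;> norm_num [expNegTaylor]

theorem exp_neg_1_72 : 0.17906614 ≤ Real.exp (-1.72) ∧
    Real.exp (-1.72) ≤ 0.17906615 := by
  refine exp_neg_mem (y := 0.43) ?_ ?_ ?_ ?_ ?_ ?_ <;> norm_num [expNegTaylor]

theorem exp_neg_1_48 : 0.22763768 ≤ Real.exp (-1.48) ∧
    Real.exp (-1.48) ≤ 0.22763770 := by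
  refine exp_neg_mem (y := 0.37) ?_ ?_ ?_ ?_ ?_ ?_ <;> norm_num [expNegTaylor]

theorem exp_neg_1_4793_mul_0_496 : 0.48011347 ≤ Real.exp (-(1.4793 * 0.496)) ∧
    Real.exp (-(1.4793 * 0.496)) ≤ 0.48011348 := by
  refine exp_neg_mem (y := 0.1834332) ?_ ?_ ?_ ?_ ?_ ?_ <;> norm_num [expNegTaylor]

theorem exp_neg_2_0165_mul_0_496 : 0.36781175 ≤ Real.exp (-(2.0165 * 0.496)) ∧
    Real.exp (-(2.0165 * 0.496)) ≤ 0.36781176 := by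
  refine exp_neg_mem (y := 0.250046) ?_ ?_ ?_ ?_ ?_ ?_ <;> norm_num [expNegTaylor]

theorem exp_neg_1_4793_mul_0_508 : 0.47166588 ≤ Real.exp (-(1.4793 * 0.508)) ∧
    Real.exp (-(1.4793 * 0.508)) ≤ 0.47166590 := by
  refine exp_neg_mem (y := 0.1878711) ?_ ?_ ?_ ?_ ?_ ?_ <;> norm_num [expNegTaylor]

theorem exp_neg_2_0165_mul_0_508 : 0.35901826 ≤ Real.exp (-(2.0165 * 0.508)) ∧
    Real.exp (-(2.0165 * 0.508)) ≤ 0.35901828 := by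
  refine exp_neg_mem (y := 0.2560955) ?_ ?_ ?_ ?_ ?_ ?_ <;> norm_num [expNegTaylor]

theorem exp_neg_1_4793_mul_0_523 : 0.46131512 ≤ Real.exp (-(1.4793 * 0.523)) ∧
    Real.exp (-(1.4793 * 0.523)) ≤ 0.46131513 := by
  refine exp_neg_mem (y := 0.193418475) ?_ ?_ ?_ ?_ ?_ ?_ <;> norm_num [expNegTaylor]

theorem exp_neg_2_0165_mul_0_523 : 0.34832145 ≤ Real.exp (-(2.0165 * 0.523)) ∧
    Real.exp (-(2.0165 * 0.523)) ≤ 0.34832146 := by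
  refine exp_neg_mem (y := 0.263657375) ?_ ?_ ?_ ?_ ?_ ?_ <;> norm_num [expNegTaylor]

theorem exp_neg_1_4793_mul_0_555 : 0.43998638 ≤ Real.exp (-(1.4793 * 0.555)) ∧
    Real.exp (-(1.4793 * 0.555)) ≤ 0.43998639 := by
  refine exp_neg_mem (y := 0.205252875) ?_ ?_ ?_ ?_ ?_ ?_ <;> norm_num [expNegTaylor]

theorem exp_neg_2_0165_mul_0_555 : 0.32655479 ≤ Real.exp (-(2.0165 * 0.555)) ∧
    Real.exp (-(2.0165 * 0.555)) ≤ 0.32655481 := by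
  refine exp_neg_mem (y := 0.279789375) ?_ ?_ ?_ ?_ ?_ ?_ <;> norm_num [expNegTaylor]

theorem exp_neg_1_4793_mul_0_624 : 0.39729221 ≤ Real.exp (-(1.4793 * 0.624)) ∧
    Real.exp (-(1.4793 * 0.624)) ≤ 0.39729223 := by
  refine exp_neg_mem (y := 0.2307708) ?_ ?_ ?_ ?_ ?_ ?_ <;> norm_num [expNegTaylor]

theorem exp_neg_2_0165_mul_0_624 : 0.28413778 ≤ Real.exp (-(2.0165 * 0.624)) ∧
    Real.exp (-(2.0165 * 0.624)) ≤ 0.28413779 := by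
  refine exp_neg_mem (y := 0.314574) ?_ ?_ ?_ ?_ ?_ ?_ <;> norm_num [expNegTaylor]

theorem exp_neg_1_4793_mul_0_676 : 0.36787693 ≤ Real.exp (-(1.4793 * 0.676)) ∧
    Real.exp (-(1.4793 * 0.676)) ≤ 0.36787695 := by
  refine exp_neg_mem (y := 0.2500017) ?_ ?_ ?_ ?_ ?_ ?_ <;> norm_num [expNegTaylor]

theorem exp_neg_2_0165_mul_0_676 : 0.25585254 ≤ Real.exp (-(2.0165 * 0.676)) ∧
    Real.exp (-(2.0165 * 0.676)) ≤ 0.25585255 := by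
  refine exp_neg_mem (y := 0.3407885) ?_ ?_ ?_ ?_ ?_ ?_ <;> norm_num [expNegTaylor]

/-! ### The factor revealing LP for large `n` -/

section Large

/-- The mixture of the scaling parameters that shows that the optimum is at most `1.488`. Its
parameters are chosen numerically so that the value of the dual solution is small; the remaining
mass `0.19554568` belongs to the JMS algorithm. -/
noncomputable abbrev mixWeight (n k : ℕ) : ℝ := paramWeight 1.4793 2.0165 0.5033 0.5606 n k

variable {n : ℕ}

theorem le_gam_one (hn : 1000000 ≤ n) : 2.0165 ≤ gam n 1 ∧ (2 : ℝ) / n ≤ 0.000002 := by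
  have h1 : (1000000 : ℝ) ≤ n := by exact_mod_cast hn
  have h2 : (2 : ℝ) / n ≤ 0.000002 := by
    rw [div_le_iff₀ (by linarith)]
    linarith
  refine ⟨?_, h2⟩
  have h3 := gam_sub_gam_succ (n := n) (k := 0) (by omega)
  have h4 : gam n 0 = 3 := by
    have : (n : ℝ) ≠ 0 := by linarith
    rw [gam, Nat.cast_zero, sub_zero, div_self this]
    norm_num
  rw [h4, zero_add] at h3
  linarith

theorem sum_mixWeight_mul_le (hn : 1000000 ≤ n) {c : ℕ → ℝ} {P ψ : ℝ → ℝ}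
    (hP : ∀ z, HasDerivAt P (ψ z) z)
    (hc : ∀ k ∈ Finset.Ico 1 n, ∀ z, 1.4793 ≤ z → gam n (k + 1) ≤ z → z ≤ gam n k → c k ≤ ψ z) :
    ∑ k ∈ Finset.Ico 1 n, mixWeight n k * c k ≤
      0.5033 * ψ 1.4793 + 0.5606 * (P 2.0165 - P 1.4793) :=
  sum_paramWeight_mul_le_of_hasDerivAt (by norm_num) (by norm_num) (by omega) (by norm_num)
    (by norm_num) (le_gam_one hn).1 hP hc

theorem mixWeight_nonneg {k : ℕ} (hk : k < n) : 0 ≤ mixWeight n k :=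
  paramWeight_nonneg (by norm_num) (by norm_num) (by norm_num) hk

theorem sum_mixWeight (hn : 1000000 ≤ n) :
    ∑ k ∈ Finset.Ico 1 n, mixWeight n k = 0.80445432 := by
  rw [sum_paramWeight (by omega) (by norm_num) (by norm_num) (le_gam_one hn).1]
  norm_num

theorem sum_mixWeight_mul_gam_le (hn : 1000000 ≤ n) :
    ∑ k ∈ Finset.Ico 1 n, mixWeight n k * gam n k ≤ 1.270942 := by
  refine (sum_mixWeight_mul_le hn (P := fun z => z ^ 2 / 2 + 0.000002 * z)
    (ψ := fun z => z + 0.000002) (fun z => ?_) fun k _ z _ hz _ => ?_).trans ?_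
  · have h := (((hasDerivAt_id' z).fun_pow 2).div_const 2).fun_add
      ((hasDerivAt_id' z).const_mul 0.000002)
    exact h.congr_deriv (by norm_num)
  · have h1 := gam_sub_gam_succ (n := n) (k := k) (by omega)
    have h2 := (le_gam_one hn).2
    linarith
  · norm_num

theorem le_sum_mixWeight_mul_exp (hn : 1000000 ≤ n) :
    0.1677185 ≤ ∑ k ∈ Finset.Ico 1 n, mixWeight n k * Real.exp (-gam n k) := by
  have h := sum_mixWeight_mul_le hn (c := fun k => -Real.exp (-gam n k))
    (P := fun z => Real.exp (-z) + 0.000002 * z) (ψ := fun z => -Real.exp (-z) + 0.000002)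
    (fun z => ?_) fun k _ z hz hkz hzk => ?_
  · have h1 := exp_neg_1_4793
    have h2 := exp_neg_2_0165
    simp only [mul_neg, Finset.sum_neg_distrib] at h
    linarith
  · have h := (hasDerivAt_exp_neg z).fun_add ((hasDerivAt_id' z).const_mul 0.000002)
    exact h.congr_deriv (by ring)
  · have h1 := gam_sub_gam_succ (n := n) (k := k) (by omega)
    have h2 := (le_gam_one hn).2
    have h3 := exp_neg_le_exp_neg_add hzk (by linarith)
    linarith

theorem sum_mixWeight_mul_exp_mul_gam_le (hn : 1000000 ≤ n) :
    ∑ k ∈ Finset.Ico 1 n, mixWeight n k * (Real.exp (-gam n k) * gam n k) ≤ 0.2611029 := by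
  refine (sum_mixWeight_mul_le hn (P := fun z => -((z + 1) * Real.exp (-z)))
    (ψ := fun z => z * Real.exp (-z)) hasDerivAt_neg_add_one_mul_exp_neg
    fun k _ z hz hkz hzk => ?_).trans ?_
  · rw [mul_comm]
    exact mul_exp_neg_le hzk (by linarith)
  · have h1 := exp_neg_1_4793
    have h2 := exp_neg_2_0165
    linarith

theorem sum_mixWeight_mul_exp_mul_le (hn : 1000000 ≤ n) {s l u y : ℝ} (hs : 0 < s)
    (hu : Real.exp (-(1.4793 * s)) ≤ u) (hl : l ≤ Real.exp (-(2.0165 * s)))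
    (h : 0.5033 * u * s + 0.5606 * (u - l) ≤ y * s) :
    ∑ k ∈ Finset.Ico 1 n, mixWeight n k * Real.exp (-(gam n k * s)) ≤ y := by
  refine (sum_mixWeight_mul_le hn (P := fun z => -(Real.exp (-(z * s)) / s))
    (ψ := fun z => Real.exp (-(z * s))) (fun z => ?_) fun k _ z _ _ hzk => ?_).trans ?_
  · have h := ((hasDerivAt_exp_neg_mul s z).div_const s).fun_neg
    exact h.congr_deriv (by field_simp)
  · exact Real.exp_le_exp.2 (neg_le_neg (mul_le_mul_of_nonneg_right hzk hs.le))
  · have e : 0.5033 * Real.exp (-(1.4793 * s)) + 0.5606 * (-(Real.exp (-(2.0165 * s)) / s) -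
        -(Real.exp (-(1.4793 * s)) / s)) = (0.5033 * Real.exp (-(1.4793 * s)) * s +
          0.5606 * (Real.exp (-(1.4793 * s)) - Real.exp (-(2.0165 * s)))) / s := by
      field_simp
      ring
    rw [e, div_le_iff₀ hs]
    nlinarith

/-- The contribution of the maximal distances to the dual constraint of the level `1 / γ_i`. -/
noncomputable def mixTail (n i : ℕ) : ℝ :=
  ∑ k ∈ Finset.Ico 1 n, mixWeight n k *
    (if i ≤ k then (3 - gam n k) * Real.exp (-gam n k) else 0)

theorem mixTail_le (hn : 1000000 ≤ n) (i : ℕ) : mixTail n i ≤ 0.2420751 := by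
  refine (sum_mixWeight_mul_le hn (P := fun z => (z - 2) * Real.exp (-z))
    (ψ := fun z => (3 - z) * Real.exp (-z)) hasDerivAt_sub_two_mul_exp_neg
    fun k _ z hz hkz hzk => ?_).trans ?_
  · have hz3 := hzk.trans (gam_le_three n k)
    split_ifs
    · exact three_sub_mul_exp_neg_le hzk hz3
    · exact mul_nonneg (by linarith) (Real.exp_nonneg _)
  · have h1 := exp_neg_1_4793
    have h2 := exp_neg_2_0165
    linarith

theorem mixTail_eq_zero {i : ℕ} (h : gam n i < 1.4793) : mixTail n i = 0 := by
  refine Finset.sum_eq_zero fun k hk => ?_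
  have hkn := (Finset.mem_Ico.1 hk).2
  split_ifs with hik
  · have : gam n k ≤ gam n i := by
      rcases hik.eq_or_lt with rfl | hik
      · exact le_rfl
      · exact (gam_lt_gam hik hkn.le).le
    rw [show mixWeight n k = 0 from paramWeight_of_lt hkn (this.trans_lt h), zero_mul]
  · rw [mul_zero]

theorem mixTail_le_of_le (hn : 1000000 ≤ n) {i : ℕ} (h1 : 1.4793 ≤ gam n i)
    (h2 : gam n i ≤ 2.0165) :
    mixTail n i ≤ 0.5033 * ((3 - 1.4793) * Real.exp (-1.4793)) +
      0.5606 * ((gam n i - 2) * Real.exp (-gam n i) - (1.4793 - 2) * Real.exp (-1.4793)) := by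
  set τ := gam n i with hτ
  set P : ℝ → ℝ := fun z => (min z τ - 2) * Real.exp (-min z τ) with hP
  have bound := sum_paramWeight_mul_le (a := 1.4793) (b := 2.0165) (θ := 0.5033) (ρ := 0.5606)
    (by norm_num) (by norm_num) (by omega : 1 ≤ n) (by norm_num) (by norm_num) (le_gam_one hn).1
    (c := fun k => if i ≤ k then (3 - gam n k) * Real.exp (-gam n k) else 0) (P := P)
    (A := (3 - 1.4793) * Real.exp (-1.4793)) ?_ ?_
  · simp only [hP, min_eq_left h1, min_eq_right h2] at bound
    exact bound
  · intro k _ _ hk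
    split_ifs
    · exact three_sub_mul_exp_neg_le hk (by norm_num)
    · exact mul_nonneg (by norm_num) (Real.exp_nonneg _)
  · intro k hk x y hx hxy hy _ hyk
    split_ifs with hik
    · have hkτ : gam n k ≤ τ := by
        rcases hik.eq_or_lt with rfl | hik
        · exact le_rfl
        · exact (gam_lt_gam hik (Finset.mem_Ico.1 hk).2.le).le
      simp only [hP, min_eq_left (hyk.trans hkτ), min_eq_left (hxy.trans (hyk.trans hkτ))]
      exact mul_sub_le_of_hasDerivAt hxy (fun z _ => hasDerivAt_sub_two_mul_exp_neg z)
        fun z hz => three_sub_mul_exp_neg_le (hz.2.trans hyk) (by linarith [hz.2])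
    · have := mul_sub_le_of_hasDerivAt (c := 0) (min_le_min_right τ hxy)
        (fun z _ => hasDerivAt_sub_two_mul_exp_neg z) fun z hz => mul_nonneg
          (by linarith [hz.2, min_le_left y τ]) (Real.exp_nonneg _)
      linarith

/-- The dual constraint of the level `t = 1 / γ_i`. The left-hand side is convex in `t`, apart from
the contribution of the maximal distances, which is bounded by its tangents. -/
theorem mix_row_le (hn : 1000000 ≤ n) {i : ℕ} (hi : i < n) {X M : ℝ}
    (hX : X = ∑ k ∈ Finset.Ico 1 n, mixWeight n k * Real.exp (-gam n k))
    (hM : 0.8788257 ≤ M) :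
    ∑ k ∈ Finset.Ico 1 n, mixWeight n k * Real.exp (-(gam n k * lev n i)) - X + mixTail n i ≤
      M * (1 - lev n i) := by
  set Y : ℝ → ℝ := fun t => ∑ k ∈ Finset.Ico 1 n, mixWeight n k * Real.exp (-(gam n k * t)) with hY
  change Y (lev n i) - X + mixTail n i ≤ M * (1 - lev n i)
  have hX0 : 0.1677185 ≤ X := hX ▸ le_sum_mixWeight_mul_exp hn
  -- a convex function that is nonpositive at both ends of an interval is so in between
  have piece : ∀ {s e t α β : ℝ}, s ≤ t → t ≤ e → Y s + (α + β * s) ≤ 0 → Y e + (α + β * e) ≤ 0 →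
      Y t + (α + β * t) ≤ 0 := by
    intro s e t α β hst hte hs he
    have conv := convexOn_sum_mul_exp (Finset.Ico 1 n) (q := mixWeight n) (g := gam n)
      (fun k hk => mixWeight_nonneg (Finset.mem_Ico.1 hk).2) α β
    exact (conv.le_max_of_mem_Icc (Set.mem_univ s) (Set.mem_univ e) ⟨hst, hte⟩).trans
      (max_le hs he)
  have Y_zero : Y 0 = 0.80445432 := by
    simp only [hY, mul_zero, neg_zero, Real.exp_zero, mul_one]
    exact sum_mixWeight hn
  have Y_one : Y 1 = X := by simp only [hY, mul_one, hX]
  have Y_0_496 : Y 0.496 ≤ 0.3685693 := sum_mixWeight_mul_exp_mul_le hn (by norm_num)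
    exp_neg_1_4793_mul_0_496.2 exp_neg_2_0165_mul_0_496.1 (by norm_num)
  have Y_0_508 : Y 0.508 ≤ 0.3617010 := sum_mixWeight_mul_exp_mul_le hn (by norm_num)
    exp_neg_1_4793_mul_0_508.2 exp_neg_2_0165_mul_0_508.1 (by norm_num)
  have Y_0_523 : Y 0.523 ≤ 0.3532971 := sum_mixWeight_mul_exp_mul_le hn (by norm_num)
    exp_neg_1_4793_mul_0_523.2 exp_neg_2_0165_mul_0_523.1 (by norm_num)
  have Y_0_555 : Y 0.555 ≤ 0.3360213 := sum_mixWeight_mul_exp_mul_le hn (by norm_num)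
    exp_neg_1_4793_mul_0_555.2 exp_neg_2_0165_mul_0_555.1 (by norm_num)
  have Y_0_624 : Y 0.624 ≤ 0.3016149 := sum_mixWeight_mul_exp_mul_le hn (by norm_num)
    exp_neg_1_4793_mul_0_624.2 exp_neg_2_0165_mul_0_624.1 (by norm_num)
  have Y_0_676 : Y 0.676 ≤ 0.2780532 := sum_mixWeight_mul_exp_mul_le hn (by norm_num)
    exp_neg_1_4793_mul_0_676.2 exp_neg_2_0165_mul_0_676.1 (by norm_num)
  have tail := mixTail_le hn i
  set t := lev n i with ht
  rcases le_or_gt t 0.496 with h0 | h0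
  · have := piece (s := 0) (e := 0.496) (α := -X + 0.2420751 - M) (β := M) (lev_nonneg hi.le) h0
      (by linarith) (by linarith)
    linarith
  have hi1 : 1 ≤ i := by
    by_contra hi0
    rw [show i = 0 by omega, lev_zero] at ht
    linarith
  have htg : t = 1 / gam n i := lev_of_pos hi1
  have hg0 : 0 < gam n i := gam_pos hi.le
  rcases lt_or_ge (gam n i) 1.4793 with hg | hg
  · have ht1 : 0.624 ≤ t := by
      rw [htg, le_div_iff₀ hg0]
      linarith
    have := piece (s := 0.624) (e := 1) (α := -X - M) (β := M) ht1 (lev_le_one hi.le)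
      (by linarith) (by linarith)
    rw [mixTail_eq_zero hg]
    linarith
  have hg2 : gam n i ≤ 2.0165 := by
    rw [htg, lt_div_iff₀ hg0] at h0
    linarith
  have ht2 : t ≤ 0.676 := by
    rw [htg, div_le_iff₀ hg0]
    linarith
  have tail2 := mixTail_le_of_le hn hg hg2
  have E := exp_neg_1_4793
  -- On `[s, e]` the tail is replaced by its tangent at `1 / m`, and the convex function that
  -- results has to be bounded at `s` and at `e` only.
  have tangent : ∀ m ∈ Set.Icc (1.4793 : ℝ) 2.0165, ∀ s e : ℝ, s ≤ t → t ≤ e →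
      Y s - X + (0.5033 * ((3 - 1.4793) * Real.exp (-1.4793)) + 0.5606 * ((m - 2) * Real.exp (-m) -
        m ^ 2 * (3 - m) * Real.exp (-m) * (s - 1 / m) - (1.4793 - 2) * Real.exp (-1.4793))) ≤
        M * (1 - s) →
      Y e - X + (0.5033 * ((3 - 1.4793) * Real.exp (-1.4793)) + 0.5606 * ((m - 2) * Real.exp (-m) -
        m ^ 2 * (3 - m) * Real.exp (-m) * (e - 1 / m) - (1.4793 - 2) * Real.exp (-1.4793))) ≤
        M * (1 - e) →
      Y t - X + mixTail n i ≤ M * (1 - t) := by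
    intro m hm s e hs he h1 h2
    have htan := sub_two_mul_exp_neg_le_tangent (g := gam n i) (m := m)
      ⟨by linarith, by linarith⟩ ⟨by linarith [hm.1], by linarith [hm.2]⟩
    rw [← htg] at htan
    have := piece (s := s) (e := e) (α := -X - M + 0.5033 * ((3 - 1.4793) * Real.exp (-1.4793)) +
      0.5606 * ((m - 2) * Real.exp (-m) + m ^ 2 * (3 - m) * Real.exp (-m) * (1 / m) -
        (1.4793 - 2) * Real.exp (-1.4793)))
      (β := M - 0.5606 * (m ^ 2 * (3 - m) * Real.exp (-m))) hs he (by linarith) (by linarith)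
    linarith
  rcases le_or_gt t 0.508 with h1 | h1
  · have E' := exp_neg_1_99
    exact tangent 1.99 (by norm_num) 0.496 0.508 h0.le h1 (by linarith) (by linarith)
  rcases le_or_gt t 0.523 with h2 | h2
  · have E' := exp_neg_1_95
    exact tangent 1.95 (by norm_num) 0.508 0.523 h1.le h2 (by linarith) (by linarith)
  rcases le_or_gt t 0.555 with h3 | h3
  · have E' := exp_neg_1_88
    exact tangent 1.88 (by norm_num) 0.523 0.555 h2.le h3 (by linarith) (by linarith)
  rcases le_or_gt t 0.624 with h4 | h4
  · have E' := exp_neg_1_72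
    exact tangent 1.72 (by norm_num) 0.555 0.624 h3.le h4 (by linarith) (by linarith)
  have E' := exp_neg_1_48
  exact tangent 1.48 (by norm_num) 0.624 0.676 h4.le ht2 (by linarith) (by linarith)

end Large

end FacilityLocation

namespace FacilityLocation

theorem sum_clCoeff {n k i : ℕ} (hi : i < n) (hk : k ∈ Finset.Ico 1 n) :
    ∑ l ∈ Finset.Icc (i + 1) n, clCoeff n k l =
      Real.exp (-(gam n k * lev n i)) - Real.exp (-gam n k) +
        if i ≤ k then (3 - gam n k) * Real.exp (-gam n k) else 0 := by
  rw [Finset.mem_Ico] at hk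
  have h := sum_Icc_succ_sub_pred (fun l => -Real.exp (-(gam n k * lev n l))) hi.le
  rw [lev_self (by omega), mul_one] at h
  simp only [clCoeff]
  rw [Finset.sum_add_distrib, Finset.sum_ite_eq']
  congr 1
  · rw [show Real.exp (-(gam n k * lev n i)) - Real.exp (-gam n k) =
      -Real.exp (-gam n k) - -Real.exp (-(gam n k * lev n i)) by ring, ← h]
    exact Finset.sum_congr rfl fun l _ => by rw [pr]; ring
  · rw [mul_comm]
    exact if_congr (by rw [Finset.mem_Icc]; omega) rfl rfl

theorem lpOpt_le_of_large {n : ℕ} (hn : 1000000 ≤ n) : lpOpt n ≤ 1.488 := by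
  refine (isLeast_dualValues (by omega)).2 (mem_dualValues (qJ := 0.19554568) (q := mixWeight n)
    (by omega) (fun k _ hk => mixWeight_nonneg hk) (by norm_num) ?_ ?_ fun i hi => ?_)
  · rw [sum_mixWeight hn]
    norm_num
  · linarith [sum_mixWeight_mul_gam_le hn]
  · have h1 := sum_mixWeight_mul_exp_mul_gam_le hn
    have h2 := mix_row_le hn hi rfl (M := 1.488 - (∑ k ∈ Finset.Ico 1 n,
      mixWeight n k * (Real.exp (-gam n k) * gam n k) + 1.78 * 0.19554568)) (by linarith)
    refine Eq.trans_le ?_ h2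
    rw [Finset.sum_comm, mixTail, ← Finset.sum_sub_distrib, ← Finset.sum_add_distrib]
    refine Finset.sum_congr rfl fun k hk => ?_
    rw [← Finset.mul_sum, sum_clCoeff hi hk]
    ring

end FacilityLocation

theorem mainTheorem3 {F C X : Type*} [Fintype F] [DecidableEq F] [Nonempty F]
    [Fintype C] [DecidableEq C] [PseudoMetricSpace X] :
    -- the algorithms can be run on every instance
    (∀ I : FacilityLocation.Instance F C X,
      (∃ s, I.JMSOutput s) ∧ (∃ x y, I.IsOptimalFractional x y) ∧
      ∀ x y, I.IsOptimalFractional x y → ∀ γ : ℝ, 1 ≤ γ →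
        Nonempty (FacilityLocation.CSRun I x y γ)) ∧
    (∀ n : ℕ, 1 ≤ n →
      -- the factor revealing LP and its dual have optimal solutions, of the same value
      IsGreatest (FacilityLocation.lpValues n) (FacilityLocation.lpOpt n) ∧
      IsGreatest (FacilityLocation.lpValuesCapped n) (FacilityLocation.lpOptCapped n) ∧
      IsLeast (FacilityLocation.dualValues n) (FacilityLocation.lpOpt n) ∧
      ∀ (I : FacilityLocation.Instance F C X) (x : F → C → ℝ) (y : F → ℝ),
        I.IsOptimalFractional x y →
        ∀ (s : FacilityLocation.JMSState F C), I.JMSOutput s →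
        ∀ R : ∀ l : Fin n, FacilityLocation.CSRun I x y (FacilityLocation.gam n (l + 1)),
          -- the fractional optimum is a lower bound on the cost of every integral solution
          (∀ S : Finset F, S.Nonempty → I.fracCost x y ≤ I.cost S) ∧
          -- the best solution
          FacilityLocation.expectedBest (I.jmsCost s) R ≤
            FacilityLocation.lpOpt n * I.fracCost x y ∧
          ((∀ i, 1 ≤ i → i < n → I.profile x n (i + 1) ≤ I.fracCost x y) →
            FacilityLocation.expectedBest (I.jmsCost s) R ≤
              FacilityLocation.lpOptCapped n * I.fracCost x y) ∧
          -- every dual solution is a probability distribution over the algorithms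
          ∀ (v : ℝ) (q : ℕ → ℝ) (qJ u : ℝ) (r : ℕ → ℝ),
            FacilityLocation.DualFeasible n v q qJ u r →
            (∀ k ∈ Finset.Ico 1 n, 0 ≤ q k) ∧ 0 ≤ qJ ∧ ∑ k ∈ Finset.Ico 1 n, q k + qJ = 1 ∧
            FacilityLocation.expectedBest (I.jmsCost s) R ≤
              FacilityLocation.expectedMixture (I.jmsCost s) R q qJ ∧
            FacilityLocation.expectedMixture (I.jmsCost s) R q qJ ≤ v * I.fracCost x y) ∧
    ∃ N : ℕ, ∀ n ≥ N, FacilityLocation.lpOpt n ≤ 1.488 := by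
  refine ⟨fun I => ⟨I.exists_jmsOutput, I.exists_isOptimalFractional,
    fun x y h γ hγ => h.1.nonempty_csRun hγ⟩, fun n hn => ⟨FacilityLocation.isGreatest_lpOpt n,
    FacilityLocation.isGreatest_lpOptCapped n, FacilityLocation.isLeast_dualValues hn,
    fun I x y hopt s hs R => ?_⟩, ?_⟩
  · have hJ := I.jmsCost_le hs hopt.1
    refine ⟨fun S hS => hopt.fracCost_le_cost hS, ?_, fun hcap => ?_, fun v q qJ u r D => ?_⟩
    · exact FacilityLocation.expectedBest_le_mul R hopt.1 hJ fun hZ =>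
        (FacilityLocation.lpFeasible_of_pos R hn hopt.1 hJ hZ).le_lpOpt
    · exact FacilityLocation.expectedBest_le_mul R hopt.1 hJ fun hZ =>
        (FacilityLocation.lpFeasible_of_pos R hn hopt.1 hJ hZ).le_lpOptCapped
          fun i h1 hi => div_le_one_of_le₀ (hcap i h1 hi) hZ.le
    · exact ⟨fun k hk => D.q_nonneg k (Finset.mem_Ico.1 hk).1 (Finset.mem_Ico.1 hk).2,
        D.qJ_nonneg, D.col_T, D.expectedBest_le_expectedMixture R,
        D.expectedMixture_le R hn hopt.1 hJ⟩
  · exact ⟨1000000, fun n hn => FacilityLocation.lpOpt_le_of_large hn⟩
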